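/- Let $N\ge 2$, $0<s<1<p<N$, and let $\Omega\subset\mathbb R^N$ be a nonempty bounded open set with Lipschitz boundary. Let $V,g\in L^q(\Omega)$ for some $q\in\left(\frac{N}{sp},\infty\right)$, with $V\ge 0$ and $g>0$ a.e. in $\Omega$. Let $$X_0^{s,p}(\Omega)=\{u\in W^{1,p}(\mathbb R^N):\ u|_\Omega\in W^{1,p}_0(\Omega),\ u=0 \text{ a.e. in }\mathbb R^N\setminus\Omega\},$$ $$\|u\|_{X_0^{s,p}(\Omega)}^p=\int_\Omega|\nabla u|^p\,dx+\int_{\mathbb R^N}\int_{\mathbb R^N}\frac{|u(x)-u(y)|^p}{|x-y|^{N+ps}}\,dx\,dy .$$ A real number $\lambda$ is called an eigenvalue, with eigenfunction $u$, if $u\in X_0^{s,p}(\Omega)\setminus\{0\}$ is a weak solution of $$-\Delta_p u+(-\Delta_p)^s u+V|u|^{p-2}u=\lambda g|u|^{p-2}u\ \text{ in }\Omega,\qquad u=0\ \text{ in }\mathbb R^N\setminus\Omega,$$ that is, if for all $v\in X_0^{s,p}(\Omega)$ $$\int_\Omega|\nabla u|^{p-2}\nabla u\cdot\nabla v\,dx+\int_{\mathbb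 R^N}\int_{\mathbb R^N}\frac{|u(x)-u(y)|^{p-2}(u(x)-u(y))(v(x)-v(y))}{|x-y|^{N+ps}}\,dx\,dy+\int_\Omega V|u|^{p-2}uv\,dx=\lambda\int_\Omega g|u|^{p-2}uv\,dx .$$ An eigenvalue is called principal if it has an eigenfunction that is nonnegative a.e. Let $$\lambda_1=\inf_{u\in X_0^{s,p}(\Omega)\setminus\{0\}}\frac{\|u\|_{X_0^{s,p}(\Omega)}^p+\int_\Omega V|u|^p\,dx}{\int_\Omega g|u|^p\,dx}.$$ Then $\lambda_1$ is the first eigenvalue, i.e. the least positive eigenvalue. If $v$ is an eigenfunction associated with an eigenvalue $\lambda>\lambda_1$, then $v$ changes sign in $\Omega$: both $\{x\in\Omega: v(x)>0\}$ and $\{x\in\Omega: v(x)<0\}$ have positive Lebesgue measure. Consequently $\lambda_1$ is a principal eigenvalue, and it is the only one. -/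

import Mathlib

open MeasureTheory Filter Topology Set
open scoped ENNReal NNReal ContDiff Gradient

namespace MixedEigenvalue

noncomputable section

/-- The Euclidean space `ℝ^N`. -/
abbrev E (N : ℕ) := EuclideanSpace ℝ (Fin N)

/-- `Ω` has Lipschitz boundary: near each boundary point, in suitable orthonormal coordinates with
vertical direction `ν`, the set `Ω` is the strict epigraph of a Lipschitz function of the
horizontal part `x - ⟪ν, x⟫ ν`. -/
def HasLipschitzBoundary {N : ℕ} (Ω : Set (E N)) : Prop :=
  ∀ x₀ ∈ frontier Ω, ∃ ν : E N, ‖ν‖ = 1 ∧ ∃ r > 0, ∃ (K : ℝ≥0) (γ : E N → ℝ),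
    LipschitzWith K γ ∧
      ∀ x ∈ Metric.ball x₀ r, x ∈ Ω ↔ γ (x - (inner ℝ ν x) • ν) < inner ℝ ν x

/-- `φ ∈ C_c^∞(U)`. -/
structure IsTestFunction {N : ℕ} (U : Set (E N)) (φ : E N → ℝ) : Prop where
  contDiff : ContDiff ℝ ∞ φ
  hasCompactSupport : HasCompactSupport φ
  tsupport_subset : tsupport φ ⊆ U

/-- `G` is the weak (distributional) gradient of `u` in the open set `U`. -/
structure HasWeakGrad {N : ℕ} (U : Set (E N)) (u : E N → ℝ) (G : E N → E N) : Prop where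
  locallyIntegrableOn : LocallyIntegrableOn u U
  locallyIntegrableOn_grad : LocallyIntegrableOn G U
  integral_eq : ∀ φ : E N → ℝ, IsTestFunction U φ → ∀ w : E N,
    ∫ x in U, u x * fderiv ℝ φ x w = -∫ x in U, inner ℝ (G x) w * φ x

open Classical in
/-- The weak gradient `∇u` of `u` in `U` (unique almost everywhere in `U` if it exists, see
`HasWeakGrad.ae_eq`; zero by convention if there is none). -/
def weakGrad {N : ℕ} (U : Set (E N)) (u : E N → ℝ) : E N → E N :=
  if h : ∃ G, HasWeakGrad U u G then h.choose else 0

/-- The Sobolev space `W^{1,p}(U)`. -/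
structure MemW1 {N : ℕ} (U : Set (E N)) (p : ℝ) (u : E N → ℝ) : Prop where
  memLp : MemLp u (ENNReal.ofReal p) (volume.restrict U)
  exists_grad : ∃ G, HasWeakGrad U u G
  memLp_grad : MemLp (weakGrad U u) (ENNReal.ofReal p) (volume.restrict U)

/-- The space `W_0^{1,p}(U)`: the closure of `C_c^∞(U)` in `W^{1,p}(U)`. -/
structure MemW01 {N : ℕ} (U : Set (E N)) (p : ℝ) (u : E N → ℝ) : Prop where
  memW1 : MemW1 U p u
  exists_approx : ∃ φ : ℕ → E N → ℝ, (∀ n, IsTestFunction U (φ n)) ∧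
    Tendsto (fun n ↦ eLpNorm (fun x ↦ φ n x - u x) (ENNReal.ofReal p) (volume.restrict U))
      atTop (𝓝 0) ∧
    Tendsto (fun n ↦ eLpNorm (fun x ↦ ∇ (φ n) x - weakGrad U u x) (ENNReal.ofReal p)
      (volume.restrict U)) atTop (𝓝 0)

/-- The solution space `X_0(Ω)`: functions in `W^{1,p}(ℝ^N)` whose restriction to `Ω` is in
`W_0^{1,p}(Ω)` and which vanish (a.e.) outside `Ω`. -/
structure MemX0 {N : ℕ} (Ω : Set (E N)) (p : ℝ) (u : E N → ℝ) : Prop where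
  memW1 : MemW1 univ p u
  memW01 : MemW01 Ω p u
  eq_zero : ∀ᵐ x, x ∉ Ω → u x = 0

/-- `H_{s,p}(u, v)`: the weak form of the mixed operator `-Δ_p + (-Δ_p)^s`. -/
def mixedForm {N : ℕ} (Ω : Set (E N)) (s p : ℝ) (u v : E N → ℝ) : ℝ :=
  (∫ x in Ω, ‖weakGrad Ω u x‖ ^ (p - 2) * inner ℝ (weakGrad Ω u x) (weakGrad Ω v x)) +
    ∫ z : E N × E N, |u z.1 - u z.2| ^ (p - 2) * (u z.1 - u z.2) * (v z.1 - v z.2) /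
      ‖z.1 - z.2‖ ^ ((N : ℝ) + p * s)

/-- The `p`-th power of the norm of `X_0(Ω)`. -/
def normPow {N : ℕ} (Ω : Set (E N)) (s p : ℝ) (u : E N → ℝ) : ℝ :=
  (∫ x in Ω, ‖weakGrad Ω u x‖ ^ p) +
    ∫ z : E N × E N, |u z.1 - u z.2| ^ p / ‖z.1 - z.2‖ ^ ((N : ℝ) + p * s)

/-- `u` is a weak solution of `-Δ_p u + (-Δ_p)^s u + V |u|^{p-2} u = l g |u|^{p-2} u` in `Ω`,
`u = 0` outside `Ω`. -/
def IsWeakSolution {N : ℕ} (Ω : Set (E N)) (s p : ℝ) (V g : E N → ℝ) (l : ℝ)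
    (u : E N → ℝ) : Prop :=
  MemX0 Ω p u ∧ ∀ v, MemX0 Ω p v →
    mixedForm Ω s p u v + (∫ x in Ω, V x * |u x| ^ (p - 2) * u x * v x) -
      l * (∫ x in Ω, g x * |u x| ^ (p - 2) * u x * v x) = 0

/-- `u` is an eigenfunction associated with `l`. -/
def IsEigenfunction {N : ℕ} (Ω : Set (E N)) (s p : ℝ) (V g : E N → ℝ) (l : ℝ)
    (u : E N → ℝ) : Prop :=
  IsWeakSolution Ω s p V g l u ∧ ¬ u =ᵐ[volume] 0

/-- `l` is an eigenvalue. -/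
def IsEigenvalue {N : ℕ} (Ω : Set (E N)) (s p : ℝ) (V g : E N → ℝ) (l : ℝ) : Prop :=
  ∃ u, IsEigenfunction Ω s p V g l u

/-- `l` is a principal eigenvalue: it has a nonnegative eigenfunction. -/
def IsPrincipalEigenvalue {N : ℕ} (Ω : Set (E N)) (s p : ℝ) (V g : E N → ℝ) (l : ℝ) : Prop :=
  ∃ u, IsEigenfunction Ω s p V g l u ∧ ∀ᵐ x, 0 ≤ u x

/-- `lambda1`: the infimum of the Rayleigh quotient over `X_0(Ω) \ {0}`. -/
def lambda1 {N : ℕ} (Ω : Set (E N)) (s p : ℝ) (V g : E N → ℝ) : ℝ :=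
  sInf {R : ℝ | ∃ u, MemX0 Ω p u ∧ ¬ u =ᵐ[volume] 0 ∧
    R = (normPow Ω s p u + ∫ x in Ω, V x * |u x| ^ p) / ∫ x in Ω, g x * |u x| ^ p}

/-- `u` changes sign in `Ω`: it is positive on a subset of positive measure and negative on
another one. -/
def ChangesSign {N : ℕ} (Ω : Set (E N)) (u : E N → ℝ) : Prop :=
  0 < volume {x | x ∈ Ω ∧ 0 < u x} ∧ 0 < volume {x | x ∈ Ω ∧ u x < 0}

/-- The weak gradient is unique almost everywhere. -/
theorem HasWeakGrad.ae_eq {N : ℕ} {U : Set (E N)} (hU : IsOpen U) {u : E N → ℝ}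
    {G G' : E N → E N} (h : HasWeakGrad U u G) (h' : HasWeakGrad U u G') :
    ∀ᵐ x, x ∈ U → G x = G' x := by
  have key : ∀ i : Fin N, ∀ᵐ x, x ∈ U → inner ℝ (G x - G' x) (EuclideanSpace.single i (1 : ℝ)) =
      (0 : ℝ) := by
    intro i
    set w : E N := EuclideanSpace.single i (1 : ℝ)
    have hli : ∀ {F : E N → E N}, LocallyIntegrableOn F U →
        LocallyIntegrableOn (fun x ↦ inner ℝ (F x) w) U := by
      intro F hF x hx
      obtain ⟨t, ht, hint⟩ := hF x hx
      exact ⟨t, ht, hint.inner_const w⟩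
    have hloc : LocallyIntegrableOn (fun x ↦ inner ℝ (G x - G' x) w) U := by
      simp only [inner_sub_left]
      exact (hli h.locallyIntegrableOn_grad).sub (hli h'.locallyIntegrableOn_grad)
    refine hU.ae_eq_zero_of_integral_contDiff_smul_eq_zero hloc ?_
    intro φ h1 h2 h3
    have e := (h.integral_eq φ ⟨h1, h2, h3⟩ w).symm.trans (h'.integral_eq φ ⟨h1, h2, h3⟩ w)
    have hI : ∀ {F : E N → E N}, LocallyIntegrableOn F U →
        Integrable (fun x ↦ inner ℝ (F x) w * φ x) (volume.restrict U) := by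
      intro F hF
      have h4 : IntegrableOn (fun x ↦ inner ℝ (F x) w * φ x) (tsupport φ) := by
        have h5 : IntegrableOn (fun x ↦ inner ℝ (F x) w) (tsupport φ) :=
          (hli hF).integrableOn_compact_subset h3 h2
        exact h5.mul_continuousOn h1.continuous.continuousOn h2
      refine Integrable.integrableOn ((integrableOn_iff_integrable_of_support_subset ?_).1 h4)
      intro x hx
      by_contra hx'
      exact hx (by simp [image_eq_zero_of_notMem_tsupport hx'])
    have hsub := integral_sub (hI h.locallyIntegrableOn_grad) (hI h'.locallyIntegrableOn_grad)
    rw [neg_inj.1 e, sub_self] at hsub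
    rw [← setIntegral_eq_integral_of_forall_compl_eq_zero (s := U), ← hsub]
    · refine integral_congr_ae (ae_of_all _ fun x ↦ ?_)
      simp only [inner_sub_left, smul_eq_mul]
      ring
    · intro x hx
      have : φ x = 0 := image_eq_zero_of_notMem_tsupport fun hx' ↦ hx (h3 hx')
      simp [this]
  filter_upwards [ae_all_iff.2 key] with x hx hxU
  ext i
  have := hx i hxU
  rw [EuclideanSpace.inner_single_right] at this
  simpa [sub_eq_zero] using this

end

end MixedEigenvalue

/-! The energy is a sum of three p-th powers of `L^p` norms: of `∇u`, of the fractional difference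
quotient of `u`, and of `|V|^(1/p) u`. The weighted mass is the p-th power of the `L^p(Ω)` norm of
`|g|^(1/p) u`. Functions of `X_0` are handled as pairs `(u, G)` in the `L^p` closure of `(φ, ∇φ)`
over test functions (`InX`, `memX0_iff`), so that each estimate or identity has to be proved only
for test functions and then passed to the limit.

Existence. The Rayleigh quotient attains its infimum `λ₁` (`exists_minimizer`). Along a normalised
minimizing sequence, Rellich compactness makes the weighted functions Cauchy, so midpoints of late
terms still have mass near 1 and hence energy near `λ₁` or above. Uniform convexity of `‖·‖^p` then
forces the gradients to be Cauchy in `L^p`, so the limit is strong and no weak convergence is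
involved. Since the energy does not increase and the mass does not change under `u ↦ |u|`, the
modulus of a minimizer is again a minimizer, and its Euler–Lagrange equation says that `λ₁` is a
principal eigenvalue. It is positive by Poincaré. Testing an eigenvalue equation with its own
solution exhibits the eigenvalue as a Rayleigh quotient, so no eigenvalue lies below `λ₁`.

Uniqueness. Let `v ≥ 0` be a nonzero solution for some `l ≥ 0`, and test its equation with `|φ|^p (v
+ ε)^(1-p)`. The local and discrete Picone inequalities bound `l ∫ g |φ|^p (v/(v+ε))^(p-1)` plus the
integral of a nonnegative nonlocal gap by the energy of `φ`. On pairs with `v(x) = 0 < v(y)` the gap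
blows up like `ε^(1-p)` wherever `φ(x) ≠ 0`. Its integral stays bounded, so `v > 0` a.e. on `{φ ≠
0}` (`ae_pos_of_ne_zero`). This nonlocal argument takes the place of a strong maximum principle and
does not need `Ω` to be connected. Letting `ε → 0` gives `l * mass ≤ energy` for every function of
the space (`mul_mass_le_energy`); at the minimizer this reads `l ≤ λ₁`. Hence for `l > λ₁` neither
`v` nor `-v` can be nonnegative, which is the change of sign. -/

namespace MixedEigenvalue

noncomputable section

section

/-! ### Convergence in `L^p` -/

section LpGeneral

variable {α F : Type*} [MeasurableSpace α] [NormedAddCommGroup F] {μ : Measure α} {P : ℝ≥0∞}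

theorem exists_subseq_ae_of_tendsto_eLpNorm {f : ℕ → α → F} {g : α → F} (hP : P ≠ 0)
    (hf : ∀ n, AEStronglyMeasurable (f n) μ) (hg : AEStronglyMeasurable g μ)
    (h : Tendsto (fun n ↦ eLpNorm (fun x ↦ f n x - g x) P μ) atTop (𝓝 0)) :
    ∃ ns : ℕ → ℕ, StrictMono ns ∧ ∀ᵐ x ∂μ, Tendsto (fun i ↦ f (ns i) x) atTop (𝓝 (g x)) :=
  (tendstoInMeasure_of_tendsto_eLpNorm hP hf hg h).exists_seq_tendsto_ae

theorem tendsto_eLpNorm_sub_trans {f g : ℕ → α → F} {h : α → F} (hP : 1 ≤ P)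
    (hf : ∀ n, AEStronglyMeasurable (f n) μ) (hg : ∀ n, AEStronglyMeasurable (g n) μ)
    (hh : AEStronglyMeasurable h μ)
    (hfg : Tendsto (fun n ↦ eLpNorm (fun x ↦ f n x - g n x) P μ) atTop (𝓝 0))
    (hgh : Tendsto (fun n ↦ eLpNorm (fun x ↦ g n x - h x) P μ) atTop (𝓝 0)) :
    Tendsto (fun n ↦ eLpNorm (fun x ↦ f n x - h x) P μ) atTop (𝓝 0) := by
  refine tendsto_of_tendsto_of_tendsto_of_le_of_le tendsto_const_nhds
    (by simpa using hfg.add hgh) (fun _ ↦ zero_le) fun n ↦ ?_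
  refine le_trans (le_of_eq ?_) (eLpNorm_add_le ((hf n).sub (hg n)) ((hg n).sub hh) hP)
  congr 1
  ext x
  simp

theorem tendsto_eLpNorm_of_tendsto_sub {f : ℕ → α → F} {g : α → F} (hP : 1 ≤ P)
    (hf : ∀ n, AEStronglyMeasurable (f n) μ) (hg : MemLp g P μ)
    (h : Tendsto (fun n ↦ eLpNorm (fun x ↦ f n x - g x) P μ) atTop (𝓝 0)) :
    Tendsto (fun n ↦ eLpNorm (f n) P μ) atTop (𝓝 (eLpNorm g P μ)) := by
  have h1 : ∀ n, eLpNorm (f n) P μ ≤ eLpNorm g P μ + eLpNorm (fun x ↦ f n x - g x) P μ := by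
    intro n
    refine le_trans (le_of_eq ?_) (eLpNorm_add_le hg.1 ((hf n).sub hg.1) hP)
    congr 1; ext x; simp
  have h2 : ∀ n, eLpNorm g P μ - eLpNorm (fun x ↦ f n x - g x) P μ ≤ eLpNorm (f n) P μ := by
    intro n
    rw [tsub_le_iff_right]
    refine le_trans (le_of_eq ?_) (eLpNorm_sub_le (hf n) ((hf n).sub hg.1) hP)
    congr 1; ext x; simp
  refine tendsto_of_tendsto_of_tendsto_of_le_of_le ?_ ?_ h2 h1
  · simpa using ENNReal.Tendsto.sub (tendsto_const_nhds (x := eLpNorm g P μ)) h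
      (Or.inl hg.2.ne)
  · simpa using (tendsto_const_nhds (x := eLpNorm g P μ)).add h

theorem tendsto_eLpNorm_add_sub {f f' : ℕ → α → F} {g g' : α → F} (hP : 1 ≤ P)
    (hf : ∀ n, AEStronglyMeasurable (f n) μ) (hf' : ∀ n, AEStronglyMeasurable (f' n) μ)
    (hg : AEStronglyMeasurable g μ) (hg' : AEStronglyMeasurable g' μ)
    (h : Tendsto (fun n ↦ eLpNorm (fun x ↦ f n x - g x) P μ) atTop (𝓝 0))
    (h' : Tendsto (fun n ↦ eLpNorm (fun x ↦ f' n x - g' x) P μ) atTop (𝓝 0)) :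
    Tendsto (fun n ↦ eLpNorm (fun x ↦ (f n x + f' n x) - (g x + g' x)) P μ) atTop (𝓝 0) := by
  refine tendsto_of_tendsto_of_tendsto_of_le_of_le tendsto_const_nhds
    (by simpa using h.add h') (fun _ ↦ zero_le) fun n ↦ ?_
  refine le_trans (le_of_eq ?_) (eLpNorm_add_le ((hf n).sub hg) ((hf' n).sub hg') hP)
  congr 1
  ext x
  simp only [Pi.add_apply]
  abel

theorem tendsto_eLpNorm_smul_sub [NormedSpace ℝ F] {f : ℕ → α → F} {g : α → F} (c : ℝ)
    (h : Tendsto (fun n ↦ eLpNorm (fun x ↦ f n x - g x) P μ) atTop (𝓝 0)) :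
    Tendsto (fun n ↦ eLpNorm (fun x ↦ c • f n x - c • g x) P μ) atTop (𝓝 0) := by
  have : ∀ n, eLpNorm (fun x ↦ c • f n x - c • g x) P μ =
      ‖c‖ₑ * eLpNorm (fun x ↦ f n x - g x) P μ := by
    intro n
    rw [← eLpNorm_const_smul]
    congr 1; ext x; simp [smul_sub]
  simp_rw [this]
  simpa using ENNReal.Tendsto.const_mul h (Or.inr (by simp : ‖c‖ₑ ≠ ⊤))

/-- Dominated convergence in `L^P`. -/
theorem tendsto_eLpNorm_sub_of_dominated {f : ℕ → α → F} {g : α → F} {b : α → ℝ}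
    (hP : 1 ≤ P) (hP' : P ≠ ⊤) (hf : ∀ n, AEStronglyMeasurable (f n) μ) (hb : MemLp b P μ)
    (hfb : ∀ n, ∀ᵐ x ∂μ, ‖f n x‖ ≤ b x)
    (hlim : ∀ᵐ x ∂μ, Tendsto (fun n ↦ f n x) atTop (𝓝 (g x))) :
    MemLp g P μ ∧ Tendsto (fun n ↦ eLpNorm (fun x ↦ f n x - g x) P μ) atTop (𝓝 0) := by
  have hP0 : 0 < P.toReal := ENNReal.toReal_pos (zero_lt_one.trans_le hP).ne' hP'
  have hg : AEStronglyMeasurable g μ := aestronglyMeasurable_of_tendsto_ae atTop hf hlim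
  have hgb : ∀ᵐ x ∂μ, ‖g x‖ ≤ b x := by
    filter_upwards [hlim, ae_all_iff.2 hfb] with x hl hx
    exact le_of_tendsto hl.norm (Eventually.of_forall hx)
  refine ⟨hb.of_le hg (hgb.mono fun x hx ↦ hx.trans (le_abs_self _)), ?_⟩
  -- Both `f n` and `g` are bounded by `b`, so the p-th powers of the differences are dominated by
  -- that of `2 b`.
  have key : Tendsto (fun n ↦ ∫⁻ x, ‖f n x - g x‖ₑ ^ P.toReal ∂μ) atTop (𝓝 (∫⁻ _, 0 ∂μ)) := by
    refine tendsto_lintegral_of_dominated_convergence' (fun x ↦ ‖(2 : ℝ) • b x‖ₑ ^ P.toReal)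
      ?_ ?_ ?_ ?_
    · exact fun n ↦ ((hf n).sub hg).enorm.pow_const _
    · intro n
      filter_upwards [hfb n, hgb] with x hx hx'
      refine ENNReal.rpow_le_rpow ?_ hP0.le
      rw [← ofReal_norm, ← ofReal_norm]
      refine ENNReal.ofReal_le_ofReal ((norm_sub_le _ _).trans ?_)
      rw [Real.norm_eq_abs, smul_eq_mul]
      exact le_trans (by linarith) (le_abs_self _)
    · exact (lintegral_rpow_enorm_lt_top_of_eLpNorm_lt_top
        (zero_lt_one.trans_le hP).ne' hP' (hb.const_smul (2 : ℝ)).2).ne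
    · filter_upwards [hlim] with x hx
      have h0 : Tendsto (fun n ↦ f n x - g x) atTop (𝓝 0) := by simpa using hx.sub_const (g x)
      have := (ENNReal.continuous_rpow_const (y := P.toReal)).tendsto _ |>.comp h0.enorm
      simpa [hP0, Function.comp_def] using this
  have := (ENNReal.continuous_rpow_const (y := 1 / P.toReal)).tendsto _ |>.comp key
  simp only [eLpNorm_eq_lintegral_rpow_enorm_toReal (zero_lt_one.trans_le hP).ne' hP']
  simpa [hP0, Function.comp_def] using this

/-- If `c n → c` boundedly and `f n → g` in `L^P`, then `c n • f n → c • g` in `L^P`. -/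
theorem tendsto_eLpNorm_bdd_smul_sub [NormedSpace ℝ F] {f : ℕ → α → F} {g : α → F}
    {c : ℕ → α → ℝ} {c' : α → ℝ} {M : ℝ} (hP : 1 ≤ P) (hP' : P ≠ ⊤)
    (hf : ∀ n, AEStronglyMeasurable (f n) μ) (hg : MemLp g P μ)
    (hc : ∀ n, AEStronglyMeasurable (c n) μ) (hM : ∀ n, ∀ᵐ x ∂μ, ‖c n x‖ ≤ M)
    (hlim : ∀ᵐ x ∂μ, Tendsto (fun n ↦ c n x) atTop (𝓝 (c' x)))
    (h : Tendsto (fun n ↦ eLpNorm (fun x ↦ f n x - g x) P μ) atTop (𝓝 0)) :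
    MemLp (fun x ↦ c' x • g x) P μ ∧
    Tendsto (fun n ↦ eLpNorm (fun x ↦ c n x • f n x - c' x • g x) P μ) atTop (𝓝 0) := by
  -- Split `c n • f n - c' • g` as `c n • (f n - g) + (c n - c') • g`. The second term is handled
  -- here by domination, the first below by the bound `M`.
  have h1 := tendsto_eLpNorm_sub_of_dominated (f := fun n x ↦ c n x • g x)
    (g := fun x ↦ c' x • g x) (b := fun x ↦ M * ‖g x‖) hP hP' (fun n ↦ (hc n).smul hg.1)
    (hg.norm.const_mul M) (fun n ↦ (hM n).mono fun x hx ↦ by rw [norm_smul]; gcongr)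
    (hlim.mono fun x hx ↦ hx.smul_const (g x))
  refine ⟨h1.1, tendsto_eLpNorm_sub_trans (g := fun n x ↦ c n x • g x) hP
    (fun n ↦ (hc n).smul (hf n)) (fun n ↦ (hc n).smul hg.1) h1.1.1 ?_ h1.2⟩
  have : ∀ n, eLpNorm (fun x ↦ c n x • f n x - c n x • g x) P μ ≤
      ENNReal.ofReal M * eLpNorm (fun x ↦ f n x - g x) P μ := by
    intro n
    refine eLpNorm_le_mul_eLpNorm_of_ae_le_mul ?_ P
    filter_upwards [hM n] with x hx
    rw [← smul_sub, norm_smul]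
    gcongr
  refine tendsto_of_tendsto_of_tendsto_of_le_of_le tendsto_const_nhds
    (?_ : Tendsto (fun n ↦ ENNReal.ofReal M * eLpNorm (fun x ↦ f n x - g x) P μ) atTop (𝓝 0))
    (fun _ ↦ zero_le) this
  simpa using ENNReal.Tendsto.const_mul h (Or.inr ENNReal.ofReal_ne_top)

theorem integral_norm_rpow_eq {p : ℝ} (hp : 0 < p) {f : α → F}
    (hf : AEStronglyMeasurable f μ) :
    ∫ x, ‖f x‖ ^ p ∂μ = (eLpNorm f (ENNReal.ofReal p) μ).toReal ^ p := by
  have h0 : 0 ≤ ∫ x, ‖f x‖ ^ p ∂μ := integral_nonneg fun x ↦ by positivity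
  rw [toReal_eLpNorm hf, lpNorm_eq_integral_norm_rpow_toReal (by simpa) (by simp) hf,
    ENNReal.toReal_ofReal hp.le, ← Real.rpow_mul h0, inv_mul_cancel₀ hp.ne', Real.rpow_one]

theorem _root_.MeasureTheory.MemLp.integrable_norm_rpow_ofReal {p : ℝ} (hp : 0 < p) {f : α → F}
    (hf : MemLp f (ENNReal.ofReal p) μ) : Integrable (fun x ↦ ‖f x‖ ^ p) μ := by
  simpa [ENNReal.toReal_ofReal hp.le] using hf.integrable_norm_rpow (by simpa) (by simp)

theorem tendsto_integral_norm_rpow {p : ℝ} (hp : 1 ≤ p) {f : ℕ → α → F} {g : α → F}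
    (hf : ∀ n, AEStronglyMeasurable (f n) μ) (hg : MemLp g (ENNReal.ofReal p) μ)
    (h : Tendsto (fun n ↦ eLpNorm (fun x ↦ f n x - g x) (ENNReal.ofReal p) μ) atTop (𝓝 0)) :
    Tendsto (fun n ↦ ∫ x, ‖f n x‖ ^ p ∂μ) atTop (𝓝 (∫ x, ‖g x‖ ^ p ∂μ)) := by
  have hp0 : 0 < p := by linarith
  rw [integral_norm_rpow_eq hp0 hg.1]
  simp_rw [fun n ↦ integral_norm_rpow_eq hp0 (hf n)]
  exact ((ENNReal.tendsto_toReal hg.2.ne).comp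
    (tendsto_eLpNorm_of_tendsto_sub (by simpa) hf hg h)).rpow_const (Or.inr hp0.le)

end LpGeneral

end

/-! ### Test functions and their closure in the Sobolev norm -/

section

variable {N : ℕ} {U Ω : Set (E N)} {P : ℝ≥0∞} {u v : E N → ℝ} {G H : E N → E N} {φ ψ : E N → ℝ}

namespace IsTestFunction

theorem differentiable (h : IsTestFunction U φ) : Differentiable ℝ φ :=
  h.contDiff.differentiable (by simp)

theorem continuous (h : IsTestFunction U φ) : Continuous φ := h.contDiff.continuous

theorem continuous_gradient (h : IsTestFunction U φ) : Continuous (∇ φ) :=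
  (InnerProductSpace.toDual ℝ (E N)).symm.continuous.comp (h.contDiff.continuous_fderiv (by simp))

theorem hasCompactSupport_gradient (h : IsTestFunction U φ) : HasCompactSupport (∇ φ) :=
  (h.hasCompactSupport.fderiv ℝ).comp_left (map_zero _)

theorem memLp (h : IsTestFunction U φ) (q : ℝ≥0∞) : MemLp φ q volume :=
  h.continuous.memLp_of_hasCompactSupport h.hasCompactSupport

theorem memLp_gradient (h : IsTestFunction U φ) (q : ℝ≥0∞) : MemLp (∇ φ) q volume :=
  h.continuous_gradient.memLp_of_hasCompactSupport h.hasCompactSupport_gradient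

theorem apply_eq_zero (h : IsTestFunction U φ) {x : E N} (hx : x ∉ U) : φ x = 0 :=
  image_eq_zero_of_notMem_tsupport fun hx' ↦ hx (h.tsupport_subset hx')

theorem gradient_eq_zero (h : IsTestFunction U φ) {x : E N} (hx : x ∉ U) : ∇ φ x = 0 := by
  have : fderiv ℝ φ x = 0 := by
    refine image_eq_zero_of_notMem_tsupport fun hx' ↦ hx (h.tsupport_subset ?_)
    exact tsupport_fderiv_subset ℝ hx'
  simp [gradient, this]

theorem add (h : IsTestFunction U φ) (h' : IsTestFunction U ψ) :
    IsTestFunction U (fun x ↦ φ x + ψ x) where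
  contDiff := h.contDiff.add h'.contDiff
  hasCompactSupport := h.hasCompactSupport.add h'.hasCompactSupport
  tsupport_subset :=
    (tsupport_add φ ψ).trans (union_subset h.tsupport_subset h'.tsupport_subset)

theorem of_support (h : IsTestFunction U φ) (hψ : ContDiff ℝ ∞ ψ)
    (hs : ∀ x, φ x = 0 → ψ x = 0) : IsTestFunction U ψ := by
  have hs' : tsupport ψ ⊆ tsupport φ := closure_mono fun x hx hx' ↦ hx (hs x hx')
  exact ⟨hψ, h.hasCompactSupport.of_isClosed_subset (isClosed_tsupport _) hs',
    hs'.trans h.tsupport_subset⟩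

theorem const_mul (h : IsTestFunction U φ) (c : ℝ) : IsTestFunction U (fun x ↦ c * φ x) :=
  h.of_support (contDiff_const.mul h.contDiff) (by simp +contextual)

theorem mul (h : IsTestFunction U φ) (hψ : ContDiff ℝ ∞ ψ) :
    IsTestFunction U (fun x ↦ φ x * ψ x) :=
  h.of_support (h.contDiff.mul hψ) (by simp +contextual)

theorem comp (h : IsTestFunction U φ) {f : ℝ → ℝ} (hf : ContDiff ℝ ∞ f) (h0 : f 0 = 0) :
    IsTestFunction U (fun x ↦ f (φ x)) :=
  h.of_support (hf.comp h.contDiff) (by simp +contextual [h0])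

end IsTestFunction

theorem gradient_add_fun (hφ : Differentiable ℝ φ) (hψ : Differentiable ℝ ψ) (x : E N) :
    ∇ (fun x ↦ φ x + ψ x) x = ∇ φ x + ∇ ψ x := by
  simp [gradient, fderiv_fun_add (hφ x) (hψ x)]

theorem gradient_const_mul_fun (hφ : Differentiable ℝ φ) (c : ℝ) (x : E N) :
    ∇ (fun x ↦ c * φ x) x = c • ∇ φ x := by
  simp [gradient, fderiv_const_mul (hφ x) c]

theorem gradient_mul_fun (hφ : Differentiable ℝ φ) (hψ : Differentiable ℝ ψ) (x : E N) :
    ∇ (fun x ↦ φ x * ψ x) x = φ x • ∇ ψ x + ψ x • ∇ φ x := by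
  simp [gradient, fderiv_fun_mul (hφ x) (hψ x)]

theorem gradient_comp_fun (hφ : Differentiable ℝ φ) {f : ℝ → ℝ} (hf : Differentiable ℝ f)
    (x : E N) : ∇ (fun x ↦ f (φ x)) x = deriv f (φ x) • ∇ φ x := by
  have := ((hf (φ x)).hasDerivAt.comp_hasFDerivAt x (hφ x).hasFDerivAt).fderiv
  simp only [gradient]
  rw [show (fun x ↦ f (φ x)) = f ∘ φ from rfl, this]
  simp

/-- `(u, G)` is in the closure of `{(φ, ∇φ) | φ ∈ C_c^∞(Ω)}` in `L^P(ℝ^N) × L^P(ℝ^N; ℝ^N)`, i.e.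
`u` is the extension by zero of a function in `W_0^{1,P}(Ω)`, and `G` is its gradient. -/
structure InX (Ω : Set (E N)) (P : ℝ≥0∞) (u : E N → ℝ) (G : E N → E N) : Prop where
  memLp : MemLp u P volume
  memLp_grad : MemLp G P volume
  exists_approx : ∃ φ : ℕ → E N → ℝ, (∀ n, IsTestFunction Ω (φ n)) ∧
    Tendsto (fun n ↦ eLpNorm (fun x ↦ φ n x - u x) P volume) atTop (𝓝 0) ∧
    Tendsto (fun n ↦ eLpNorm (fun x ↦ ∇ (φ n) x - G x) P volume) atTop (𝓝 0)

namespace InX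

theorem of_test (h : IsTestFunction Ω φ) : InX Ω P φ (∇ φ) :=
  ⟨h.memLp P, h.memLp_gradient P, fun _ ↦ φ, fun _ ↦ h, by simp, by simp⟩

theorem congr_ae {u' : E N → ℝ} {G' : E N → E N} (h : InX Ω P u G) (hu : u =ᵐ[volume] u')
    (hG : G =ᵐ[volume] G') : InX Ω P u' G' := by
  obtain ⟨φ, h1, h2, h3⟩ := h.exists_approx
  refine ⟨h.memLp.ae_eq hu, h.memLp_grad.ae_eq hG, φ, h1, h2.congr fun n ↦ ?_,
    h3.congr fun n ↦ ?_⟩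
  · exact eLpNorm_congr_ae (hu.mono fun x hx ↦ by simp [hx])
  · exact eLpNorm_congr_ae (hG.mono fun x hx ↦ by simp [hx])

theorem exists_approx_ae (hP : 1 ≤ P) (h : InX Ω P u G) :
    ∃ φ : ℕ → E N → ℝ, (∀ n, IsTestFunction Ω (φ n)) ∧
      Tendsto (fun n ↦ eLpNorm (fun x ↦ φ n x - u x) P volume) atTop (𝓝 0) ∧
      Tendsto (fun n ↦ eLpNorm (fun x ↦ ∇ (φ n) x - G x) P volume) atTop (𝓝 0) ∧
      (∀ᵐ x, Tendsto (fun n ↦ φ n x) atTop (𝓝 (u x))) ∧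
      (∀ᵐ x, Tendsto (fun n ↦ ∇ (φ n) x) atTop (𝓝 (G x))) := by
  have hP0 : P ≠ 0 := (zero_lt_one.trans_le hP).ne'
  obtain ⟨φ, h1, h2, h3⟩ := h.exists_approx
  obtain ⟨ns, hns, h4⟩ := exists_subseq_ae_of_tendsto_eLpNorm hP0
    (fun n ↦ ((h1 n).memLp P).1) h.memLp.1 h2
  have h3' := h3.comp hns.tendsto_atTop
  obtain ⟨ms, hms, h5⟩ := exists_subseq_ae_of_tendsto_eLpNorm hP0
    (fun n ↦ ((h1 (ns n)).memLp_gradient P).1) h.memLp_grad.1 h3'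
  refine ⟨fun n ↦ φ (ns (ms n)), fun n ↦ h1 _,
    h2.comp (hns.tendsto_atTop.comp hms.tendsto_atTop), h3'.comp hms.tendsto_atTop, ?_, h5⟩
  filter_upwards [h4] with x hx
  exact hx.comp hms.tendsto_atTop

theorem add (hP : 1 ≤ P) (h : InX Ω P u G) (h' : InX Ω P v H) :
    InX Ω P (fun x ↦ u x + v x) (fun x ↦ G x + H x) := by
  obtain ⟨φ, h1, h2, h3⟩ := h.exists_approx
  obtain ⟨ψ, k1, k2, k3⟩ := h'.exists_approx
  refine ⟨h.memLp.add h'.memLp, h.memLp_grad.add h'.memLp_grad, fun n x ↦ φ n x + ψ n x,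
    fun n ↦ (h1 n).add (k1 n), ?_, ?_⟩
  · exact tendsto_eLpNorm_add_sub hP (fun n ↦ ((h1 n).memLp P).1) (fun n ↦ ((k1 n).memLp P).1)
      h.memLp.1 h'.memLp.1 h2 k2
  · simp_rw [fun n ↦ gradient_add_fun (h1 n).differentiable (k1 n).differentiable]
    exact tendsto_eLpNorm_add_sub hP (fun n ↦ ((h1 n).memLp_gradient P).1)
      (fun n ↦ ((k1 n).memLp_gradient P).1) h.memLp_grad.1 h'.memLp_grad.1 h3 k3

theorem const_mul (h : InX Ω P u G) (c : ℝ) :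
    InX Ω P (fun x ↦ c * u x) (fun x ↦ c • G x) := by
  obtain ⟨φ, h1, h2, h3⟩ := h.exists_approx
  refine ⟨h.memLp.const_mul c, h.memLp_grad.const_smul c, fun n x ↦ c * φ n x,
    fun n ↦ (h1 n).const_mul c, ?_, ?_⟩
  · exact tendsto_eLpNorm_smul_sub c h2
  · simp_rw [fun n ↦ gradient_const_mul_fun (h1 n).differentiable]
    exact tendsto_eLpNorm_smul_sub c h3

theorem sub (hP : 1 ≤ P) (h : InX Ω P u G) (h' : InX Ω P v H) :
    InX Ω P (fun x ↦ u x - v x) (fun x ↦ G x - H x) := by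
  simpa [sub_eq_add_neg] using h.add hP (h'.const_mul (-1))

/-- A diagonal argument: replacing each `w n` by a test function at distance less than `1 / (n + 1)`
shows that the class is closed. -/
theorem of_tendsto (hP : 1 ≤ P) {w : ℕ → E N → ℝ} {K : ℕ → E N → E N}
    (h : ∀ n, InX Ω P (w n) (K n)) (hu : MemLp u P volume) (hG : MemLp G P volume)
    (h1 : Tendsto (fun n ↦ eLpNorm (fun x ↦ w n x - u x) P volume) atTop (𝓝 0))
    (h2 : Tendsto (fun n ↦ eLpNorm (fun x ↦ K n x - G x) P volume) atTop (𝓝 0)) :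
    InX Ω P u G := by
  have : ∀ n : ℕ, ∃ φ, IsTestFunction Ω φ ∧
      eLpNorm (fun x ↦ φ x - w n x) P volume < ENNReal.ofReal (1 / (n + 1)) ∧
      eLpNorm (fun x ↦ ∇ φ x - K n x) P volume < ENNReal.ofReal (1 / (n + 1)) := by
    intro n
    obtain ⟨φ, k1, k2, k3⟩ := (h n).exists_approx
    have hn : (0 : ℝ≥0∞) < ENNReal.ofReal (1 / (n + 1)) := by
      rw [ENNReal.ofReal_pos]; positivity
    obtain ⟨m, hm⟩ := ((k2.eventually_lt_const hn).and (k3.eventually_lt_const hn)).exists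
    exact ⟨φ m, k1 m, hm⟩
  choose φ k1 k2 k3 using this
  have h0 : Tendsto (fun n : ℕ ↦ ENNReal.ofReal (1 / ((n : ℝ) + 1))) atTop (𝓝 0) := by
    simpa using ENNReal.tendsto_ofReal tendsto_one_div_add_atTop_nhds_zero_nat
  refine ⟨hu, hG, φ, k1, ?_, ?_⟩
  · refine tendsto_eLpNorm_sub_trans hP (fun n ↦ ((k1 n).memLp P).1) (fun n ↦ (h n).memLp.1)
      hu.1 ?_ h1
    exact tendsto_of_tendsto_of_tendsto_of_le_of_le tendsto_const_nhds h0 (fun _ ↦ zero_le)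
      fun n ↦ (k2 n).le
  · refine tendsto_eLpNorm_sub_trans hP (fun n ↦ ((k1 n).memLp_gradient P).1)
      (fun n ↦ (h n).memLp_grad.1) hG.1 ?_ h2
    exact tendsto_of_tendsto_of_tendsto_of_le_of_le tendsto_const_nhds h0 (fun _ ↦ zero_le)
      fun n ↦ (k3 n).le

theorem ae_eq_zero_of_notMem (hP : 1 ≤ P) (h : InX Ω P u G) :
    ∀ᵐ x, x ∉ Ω → u x = 0 ∧ G x = 0 := by
  obtain ⟨φ, h1, -, -, h4, h5⟩ := h.exists_approx_ae hP
  filter_upwards [h4, h5] with x hx hx' hxΩ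
  constructor
  · refine tendsto_nhds_unique hx ?_
    simp_rw [fun n ↦ (h1 n).apply_eq_zero hxΩ]
    exact tendsto_const_nhds
  · refine tendsto_nhds_unique hx' ?_
    simp_rw [fun n ↦ (h1 n).gradient_eq_zero hxΩ]
    exact tendsto_const_nhds

/-- A bound for a (sub)linear operator on test functions extends to all of `InX`. -/
theorem eLpNorm_le_of_test {α F : Type*} [MeasurableSpace α] [NormedAddCommGroup F]
    {μ : Measure α} {r : ℝ≥0∞} {C : ℝ≥0} (hP : 1 ≤ P) (T : (E N → ℝ) → α → F)
    (hT : ∀ (φ : ℕ → E N → ℝ) (u : E N → ℝ), (∀ n, IsTestFunction Ω (φ n)) →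
      (∀ᵐ x, Tendsto (fun n ↦ φ n x) atTop (𝓝 (u x))) →
      ∀ᵐ a ∂μ, Tendsto (fun n ↦ T (φ n) a) atTop (𝓝 (T u a)))
    (hmeas : ∀ φ, IsTestFunction Ω φ → AEStronglyMeasurable (T φ) μ)
    (hb : ∀ φ, IsTestFunction Ω φ → eLpNorm (T φ) r μ ≤ C * eLpNorm (∇ φ) P volume)
    (h : InX Ω P u G) : MemLp (T u) r μ ∧ eLpNorm (T u) r μ ≤ C * eLpNorm G P volume := by
  obtain ⟨φ, h1, -, h3, h4, -⟩ := h.exists_approx_ae hP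
  have hl := hT φ u h1 h4
  have h5 := ENNReal.Tendsto.const_mul (tendsto_eLpNorm_of_tendsto_sub hP
    (fun n ↦ ((h1 n).memLp_gradient P).1) h.memLp_grad h3)
    (Or.inr (ENNReal.coe_ne_top : (C : ℝ≥0∞) ≠ ⊤))
  have h6 : eLpNorm (T u) r μ ≤ C * eLpNorm G P volume := by
    -- Fatou: lower semicontinuity of the norm under a.e. convergence suffices, so neither linearity
    -- nor norm continuity of `T` is needed.
    refine (Lp.eLpNorm_lim_le_liminf_eLpNorm (fun n ↦ hmeas _ (h1 n)) _ hl).trans ?_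
    rw [← h5.liminf_eq]
    exact liminf_le_liminf (Eventually.of_forall fun n ↦ hb _ (h1 n))
  exact ⟨⟨aestronglyMeasurable_of_tendsto_ae atTop (fun n ↦ hmeas _ (h1 n)) hl,
    h6.trans_lt (ENNReal.mul_lt_top (by simp) h.memLp_grad.2)⟩, h6⟩

end InX

end

/-! ### The closure class is the solution space -/

section

variable {N : ℕ} {U Ω : Set (E N)} {P : ℝ≥0∞} {u v : E N → ℝ} {G H : E N → E N} {φ ψ : E N → ℝ}

theorem tendsto_integral_mul_of_tendsto_eLpNorm {α : Type*} [MeasurableSpace α] {μ : Measure α}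
    {Q : ℝ≥0∞} [ENNReal.HolderConjugate P Q] {f : ℕ → α → ℝ} {g k : α → ℝ}
    (hf : ∀ n, MemLp (f n) P μ) (hg : MemLp g P μ) (hk : MemLp k Q μ)
    (h : Tendsto (fun n ↦ eLpNorm (fun x ↦ f n x - g x) P μ) atTop (𝓝 0)) :
    Tendsto (fun n ↦ ∫ x, f n x * k x ∂μ) atTop (𝓝 (∫ x, g x * k x ∂μ)) := by
  have hI : ∀ {f : α → ℝ}, MemLp f P μ → Integrable (fun x ↦ f x * k x) μ := fun hf ↦
    memLp_one_iff_integrable.1 (hk.mul hf)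
  refine tendsto_integral_of_L1' _ (hI hg).1 (Eventually.of_forall fun n ↦ hI (hf n)) ?_
  refine tendsto_of_tendsto_of_tendsto_of_le_of_le tendsto_const_nhds
    (by simpa using ENNReal.Tendsto.mul_const h (Or.inr hk.2.ne)) (fun _ ↦ zero_le) fun n ↦ ?_
  refine le_trans (le_of_eq ?_) (eLpNorm_smul_le_mul_eLpNorm (p := P) (q := Q) (r := 1) hk.1
    ((hf n).sub hg).1)
  congr 1
  ext x
  simp [sub_mul]

/-- Integration by parts holds for the smooth approximants, and both sides pass to the limit by
Hölder against `ψ` and `∇ψ`. The approximants are smooth on the whole space and only `ψ` is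
localised, so `U` may be any set. -/
theorem InX.hasWeakGrad (hP : 1 ≤ P) (h : InX Ω P u G) (U : Set (E N)) : HasWeakGrad U u G where
  locallyIntegrableOn := (h.memLp.locallyIntegrable hP).locallyIntegrableOn U
  locallyIntegrableOn_grad := (h.memLp_grad.locallyIntegrable hP).locallyIntegrableOn U
  integral_eq := by
    intro ψ hψ w
    obtain ⟨φ, h1, h2, h3⟩ := h.exists_approx
    have : ENNReal.HolderConjugate P P.conjExponent := ENNReal.HolderConjugate.conjExponent hP
    have hfd : ∀ {φ : E N → ℝ} (x : E N), fderiv ℝ φ x w = inner ℝ (∇ φ x) w :=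
      fun x ↦ inner_gradient_left.symm
    rw [setIntegral_eq_integral_of_forall_compl_eq_zero,
      setIntegral_eq_integral_of_forall_compl_eq_zero]
    rotate_left
    · intro x hx; simp [hψ.apply_eq_zero hx]
    · intro x hx; simp [hfd, hψ.gradient_eq_zero hx]
    simp_rw [hfd]
    have hk : MemLp (fun x ↦ inner ℝ (∇ ψ x) w) P.conjExponent volume :=
      (hψ.memLp_gradient _).inner_const w
    have l1 := tendsto_integral_mul_of_tendsto_eLpNorm (fun n ↦ (h1 n).memLp P) h.memLp hk h2
    have l2 := tendsto_integral_mul_of_tendsto_eLpNorm (P := P)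
      (f := fun n x ↦ inner ℝ (∇ (φ n) x) w) (g := fun x ↦ inner ℝ (G x) w)
      (fun n ↦ ((h1 n).memLp_gradient P).inner_const w) (h.memLp_grad.inner_const w)
      (hψ.memLp P.conjExponent) (by
        refine tendsto_of_tendsto_of_tendsto_of_le_of_le tendsto_const_nhds
          (g := fun _ ↦ 0) (h := fun n ↦
            ENNReal.ofReal ‖w‖ * eLpNorm (fun x ↦ ∇ (φ n) x - G x) P volume) ?_
          (fun _ ↦ zero_le) fun n ↦ ?_
        · simpa using ENNReal.Tendsto.const_mul h3 (Or.inr (enorm_ne_top : ‖w‖ₑ ≠ ⊤))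
        · refine eLpNorm_le_mul_eLpNorm_of_ae_le_mul (ae_of_all _ fun x ↦ ?_) P
          rw [← inner_sub_left, mul_comm]
          exact norm_inner_le_norm _ _)
    refine tendsto_nhds_unique l1 (l2.neg.congr fun n ↦ ?_)
    have := integral_mul_fderiv_eq_neg_fderiv_mul_of_integrable (μ := volume) (f := φ n) (g := ψ)
      (v := w) ?_ ?_ ?_ (fun x _ ↦ (h1 n).differentiable x) (fun x _ ↦ hψ.differentiable x)
    · simp_rw [hfd] at this
      exact this.symm
    · simp_rw [hfd]
      exact (((h1 n).continuous_gradient.inner continuous_const).mul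
        hψ.continuous).integrable_of_hasCompactSupport (hψ.hasCompactSupport.mul_left)
    · simp_rw [hfd]
      exact ((h1 n).continuous.mul (hψ.continuous_gradient.inner
        continuous_const)).integrable_of_hasCompactSupport ((h1 n).hasCompactSupport.mul_right)
    · exact ((h1 n).continuous.mul hψ.continuous).integrable_of_hasCompactSupport
        ((h1 n).hasCompactSupport.mul_right)

theorem InX.weakGrad_ae_eq (hP : 1 ≤ P) (h : InX Ω P u G) (hU : IsOpen U) :
    weakGrad U u =ᵐ[volume.restrict U] G := by
  have hex : ∃ G, HasWeakGrad U u G := ⟨G, h.hasWeakGrad hP U⟩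
  rw [EventuallyEq, ae_restrict_iff' hU.measurableSet]
  have := hex.choose_spec.ae_eq hU (h.hasWeakGrad hP U)
  simpa [weakGrad, hex] using this

theorem InX.memW1 {p : ℝ} (hp : 1 ≤ p) (h : InX Ω (ENNReal.ofReal p) u G) (hU : IsOpen U) :
    MemW1 U p u where
  memLp := h.memLp.restrict U
  exists_grad := ⟨G, h.hasWeakGrad (by simpa) U⟩
  memLp_grad := (h.memLp_grad.restrict U).ae_eq (h.weakGrad_ae_eq (by simpa) hU).symm

theorem InX.memX0 {p : ℝ} (hp : 1 ≤ p) (hΩ : IsOpen Ω) (h : InX Ω (ENNReal.ofReal p) u G) :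
    MemX0 Ω p u where
  memW1 := h.memW1 hp isOpen_univ
  memW01 := by
    refine ⟨h.memW1 hp hΩ, ?_⟩
    obtain ⟨φ, h1, h2, h3⟩ := h.exists_approx
    refine ⟨φ, h1, ?_, ?_⟩
    · exact tendsto_of_tendsto_of_tendsto_of_le_of_le tendsto_const_nhds h2 (fun _ ↦ zero_le)
        fun n ↦ eLpNorm_mono_measure _ Measure.restrict_le_self
    · refine tendsto_of_tendsto_of_tendsto_of_le_of_le tendsto_const_nhds h3 (fun _ ↦ zero_le)
        fun n ↦ ?_
      refine le_trans (le_of_eq (eLpNorm_congr_ae ?_))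
        (eLpNorm_mono_measure _ Measure.restrict_le_self)
      filter_upwards [h.weakGrad_ae_eq (by simpa) hΩ] with x hx
      rw [hx]
  eq_zero := (h.ae_eq_zero_of_notMem (by simpa)).mono fun x hx hxΩ ↦ (hx hxΩ).1

/-- Test functions and their gradients vanish off `Ω`, and `u` does so a.e.; hence convergence on
`Ω` is convergence on the whole space once the gradient is extended by zero. -/
theorem MemX0.inX {p : ℝ} (hΩ : IsOpen Ω) (h : MemX0 Ω p u) :
    InX Ω (ENNReal.ofReal p) u (Ω.indicator (weakGrad Ω u)) := by
  obtain ⟨φ, h1, h2, h3⟩ := h.memW01.exists_approx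
  refine ⟨by simpa using h.memW1.memLp,
    (memLp_indicator_iff_restrict hΩ.measurableSet).2 h.memW01.memW1.memLp_grad, φ, h1,
    h2.congr fun n ↦ ?_, h3.congr fun n ↦ ?_⟩
  · rw [← eLpNorm_indicator_eq_eLpNorm_restrict hΩ.measurableSet]
    refine eLpNorm_congr_ae ?_
    filter_upwards [h.eq_zero] with x hx
    by_cases hxΩ : x ∈ Ω
    · simp [hxΩ]
    · simp [hxΩ, hx hxΩ, (h1 n).apply_eq_zero hxΩ]
  · rw [← eLpNorm_indicator_eq_eLpNorm_restrict hΩ.measurableSet]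
    refine eLpNorm_congr_ae (ae_of_all _ fun x ↦ ?_)
    by_cases hxΩ : x ∈ Ω
    · simp [hxΩ]
    · simp [hxΩ, (h1 n).gradient_eq_zero hxΩ]

theorem memX0_iff {p : ℝ} (hp : 1 ≤ p) (hΩ : IsOpen Ω) :
    MemX0 Ω p u ↔ ∃ G, InX Ω (ENNReal.ofReal p) u G :=
  ⟨fun h ↦ ⟨_, h.inX hΩ⟩, fun ⟨_, h⟩ ↦ h.memX0 hp hΩ⟩

end

/-! ### Poincaré, Sobolev, Gagliardo and weighted bounds by the gradient -/

section

variable {N : ℕ} {U Ω : Set (E N)} {u v : E N → ℝ} {G H : E N → E N} {φ ψ : E N → ℝ}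
  {p s : ℝ}

theorem norm_gradient_eq (φ : E N → ℝ) (x : E N) : ‖∇ φ x‖ = ‖fderiv ℝ φ x‖ := by
  simp [gradient]

theorem eLpNorm_gradient_eq (φ : E N → ℝ) (P : ℝ≥0∞) :
    eLpNorm (∇ φ) P volume = eLpNorm (fderiv ℝ φ) P volume :=
  eLpNorm_congr_norm_ae (ae_of_all _ fun x ↦ norm_gradient_eq φ x)

/-- The Poincaré inequality. -/
theorem InX.exists_poincare (hp : 1 ≤ p) (hpN : p < N) (hΩ : Bornology.IsBounded Ω) :
    ∃ C : ℝ≥0, ∀ u G, InX Ω (ENNReal.ofReal p) u G →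
      eLpNorm u (ENNReal.ofReal p) volume ≤ C * eLpNorm G (ENNReal.ofReal p) volume := by
  refine ⟨eLpNormLESNormFDerivOfLeConst ℝ (volume : Measure (E N)) Ω p.toNNReal p.toNNReal,
    fun u G h ↦ (h.eLpNorm_le_of_test (by simpa) (fun φ ↦ φ) (fun _ _ _ h ↦ h)
      (fun φ h ↦ (h.memLp 0).1) fun φ hφ ↦ ?_).2⟩
  rw [eLpNorm_gradient_eq]
  refine eLpNorm_le_eLpNorm_fderiv volume (hφ.contDiff.of_le (by simp))
    ((subset_tsupport _).trans hφ.tsupport_subset) (by simpa) ?_ hΩ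
  rw [finrank_euclideanSpace_fin, Real.toNNReal_lt_natCast']
  refine ⟨hpN, fun h0 ↦ ?_⟩
  rw [h0, Nat.cast_zero] at hpN
  linarith

/-- The Sobolev inequality. -/
theorem InX.exists_sobolev (hp : 1 ≤ p) (hpN : p < N) :
    ∃ C : ℝ≥0, ∀ u G, InX Ω (ENNReal.ofReal p) u G →
      MemLp u (ENNReal.ofReal (p⁻¹ - (N : ℝ)⁻¹)⁻¹) volume ∧
      eLpNorm u (ENNReal.ofReal (p⁻¹ - (N : ℝ)⁻¹)⁻¹) volume ≤
        C * eLpNorm G (ENNReal.ofReal p) volume := by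
  have hN : (0 : ℝ) < N := by linarith
  refine ⟨SNormLESNormFDerivOfEqConst ℝ (volume : Measure (E N)) p.toNNReal,
    fun u G h ↦ h.eLpNorm_le_of_test (by simpa) (fun φ ↦ φ) (fun _ _ _ h ↦ h)
      (fun φ h ↦ (h.memLp 0).1) fun φ hφ ↦ ?_⟩
  rw [eLpNorm_gradient_eq]
  -- The exponent `(p⁻¹ - N⁻¹)⁻¹` is the Sobolev conjugate `Np / (N - p)`.
  refine eLpNorm_le_eLpNorm_fderiv_of_eq volume (hφ.contDiff.of_le (by simp))
    hφ.hasCompactSupport (by simpa) ?_ ?_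
  · rw [finrank_euclideanSpace_fin]; exact_mod_cast hN
  · rw [finrank_euclideanSpace_fin, Real.coe_toNNReal, inv_inv, NNReal.coe_inv,
      Real.coe_toNNReal _ (by linarith)]
    exact inv_nonneg.2 (sub_nonneg.2 (inv_anti₀ (by linarith) hpN.le))

/-- Write `φ(x + h) - φ(x)` as the integral of `∇φ(x + t h) · h` over `t ∈ (0, 1]`, apply Jensen in
`t`, then Tonelli and the translation invariance of Lebesgue measure. -/
theorem IsTestFunction.lintegral_translate_sub_le (hφ : IsTestFunction U φ) (hp : 1 ≤ p)
    (h : E N) : ∫⁻ x, ‖φ x - φ (x + h)‖ₑ ^ p ≤ ‖h‖ₑ ^ p * ∫⁻ x, ‖∇ φ x‖ₑ ^ p := by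
  have hp0 : 0 < p := by linarith
  have hc := hφ.continuous_gradient
  have h1 : ∀ x, ‖φ x - φ (x + h)‖ₑ ^ p ≤
      ‖h‖ₑ ^ p * ∫⁻ t in Ioc (0 : ℝ) 1, ‖∇ φ (x + t • h)‖ₑ ^ p := by
    intro x
    have hct : Continuous fun t : ℝ ↦ ∇ φ (x + t • h) := hc.comp (by fun_prop)
    have hd : ∀ t : ℝ, HasDerivAt (fun t : ℝ ↦ φ (x + t • h)) (inner ℝ (∇ φ (x + t • h)) h) t := by
      intro t
      have h2 : HasDerivAt (fun t : ℝ ↦ x + t • h) h t := by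
        simpa using ((hasDerivAt_id t).smul_const h).const_add x
      have := (hφ.differentiable (x + t • h)).hasFDerivAt.comp_hasDerivAt t h2
      rwa [← inner_gradient_left] at this
    have hi : φ (x + h) - φ x = ∫ t in (0 : ℝ)..1, inner ℝ (∇ φ (x + t • h)) h := by
      rw [intervalIntegral.integral_eq_sub_of_hasDerivAt (fun t _ ↦ hd t)]
      · simp
      · exact (hct.inner continuous_const).intervalIntegrable _ _
    have hP : IsProbabilityMeasure (volume.restrict (Ioc (0 : ℝ) 1)) := ⟨by simp⟩
    have h3 : ∫⁻ t in Ioc (0 : ℝ) 1, ‖∇ φ (x + t • h)‖ₑ ≤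
        (∫⁻ t in Ioc (0 : ℝ) 1, ‖∇ φ (x + t • h)‖ₑ ^ p) ^ (1 / p) := by
      have := eLpNorm_le_eLpNorm_of_exponent_le (p := 1) (q := ENNReal.ofReal p)
        (μ := volume.restrict (Ioc (0 : ℝ) 1)) (by simpa) hct.aestronglyMeasurable
      rwa [eLpNorm_one_eq_lintegral_enorm, eLpNorm_eq_lintegral_rpow_enorm_toReal (by simpa)
        (by simp), ENNReal.toReal_ofReal hp0.le] at this
    calc ‖φ x - φ (x + h)‖ₑ ^ p
        ≤ (‖h‖ₑ * ∫⁻ t in Ioc (0 : ℝ) 1, ‖∇ φ (x + t • h)‖ₑ) ^ p := by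
          refine ENNReal.rpow_le_rpow ?_ hp0.le
          rw [← enorm_neg, neg_sub, hi, intervalIntegral.integral_of_le zero_le_one]
          refine (enorm_integral_le_lintegral_enorm _).trans ?_
          rw [← lintegral_const_mul' _ _ enorm_ne_top]
          refine lintegral_mono fun t ↦ ?_
          rw [mul_comm]
          simp only [← ofReal_norm, ← ENNReal.ofReal_mul (norm_nonneg _)]
          exact ENNReal.ofReal_le_ofReal (norm_inner_le_norm _ _)
      _ ≤ (‖h‖ₑ * (∫⁻ t in Ioc (0 : ℝ) 1, ‖∇ φ (x + t • h)‖ₑ ^ p) ^ (1 / p)) ^ p := by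
          gcongr
      _ = _ := by
          rw [ENNReal.mul_rpow_of_nonneg _ _ hp0.le, ← ENNReal.rpow_mul, one_div,
            inv_mul_cancel₀ hp0.ne', ENNReal.rpow_one]
  calc ∫⁻ x, ‖φ x - φ (x + h)‖ₑ ^ p
      ≤ ∫⁻ x, ‖h‖ₑ ^ p * ∫⁻ t in Ioc (0 : ℝ) 1, ‖∇ φ (x + t • h)‖ₑ ^ p := lintegral_mono h1
    _ = ‖h‖ₑ ^ p * ∫⁻ x, ∫⁻ t in Ioc (0 : ℝ) 1, ‖∇ φ (x + t • h)‖ₑ ^ p :=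
        lintegral_const_mul' _ _ (ENNReal.rpow_ne_top_of_nonneg hp0.le enorm_ne_top)
    _ = ‖h‖ₑ ^ p * ∫⁻ t in Ioc (0 : ℝ) 1, ∫⁻ x, ‖∇ φ (x + t • h)‖ₑ ^ p := by
        rw [lintegral_lintegral_swap]
        refine Continuous.aemeasurable ?_
        refine (ENNReal.continuous_rpow_const).comp (continuous_enorm.comp ?_)
        exact hc.comp (by fun_prop)
    _ = ‖h‖ₑ ^ p * ∫⁻ x, ‖∇ φ x‖ₑ ^ p := by
        congr 1
        simp_rw [fun t : ℝ ↦ lintegral_add_right_eq_self (μ := (volume : Measure (E N)))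
          (fun x ↦ ‖∇ φ x‖ₑ ^ p) (t • h)]
        simp

/-- In polar coordinates the integrand is `r^(p(1-s)-1)` near the origin, integrable because `s <
1`, and a multiple of `r^(-1-ps)` at infinity, integrable because `s > 0`. -/
theorem lintegral_rpow_norm_kernel_lt_top (hN : 0 < N) (hs0 : 0 < s) (hs1 : s < 1) (hp : 0 < p)
    (c : ℝ) : ∫⁻ h : E N, ENNReal.ofReal (‖h‖ ^ (-(N + p * s)) *
      if ‖h‖ < 1 then ‖h‖ ^ p else c) < ⊤ := by
  have : Nontrivial (E N) := by
    have : Nonempty (Fin N) := ⟨⟨0, hN⟩⟩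
    infer_instance
  suffices h : Integrable (fun h : E N ↦ ‖h‖ ^ (-(N + p * s)) *
      if ‖h‖ < 1 then ‖h‖ ^ p else c) volume from
    lt_of_le_of_lt (lintegral_mono fun x ↦ by
      rw [← ofReal_norm]; exact ENNReal.ofReal_le_ofReal (le_abs_self _)) h.2
  rw [integrable_fun_norm_addHaar volume
    (f := fun r : ℝ ↦ r ^ (-(N + p * s)) * if r < 1 then r ^ p else c)]
  rw [finrank_euclideanSpace_fin, ← Ioo_union_Ici_eq_Ioi (zero_lt_one' ℝ)]
  have hpow : ∀ y : ℝ, 0 < y → y ^ (N - 1) = y ^ ((N : ℝ) - 1) := by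
    intro y hy
    rw [← Real.rpow_natCast, Nat.cast_sub (by lia)]
    simp
  refine IntegrableOn.union ?_ ?_
  · have h1 : IntegrableOn (fun y : ℝ ↦ y ^ (p * (1 - s) - 1)) (Ioo 0 1) := by
      rw [intervalIntegral.integrableOn_Ioo_rpow_iff zero_lt_one]
      nlinarith
    refine h1.congr_fun (fun y hy ↦ ?_) measurableSet_Ioo
    simp only [hy.2, if_true, smul_eq_mul]
    rw [hpow y hy.1, ← Real.rpow_add hy.1, ← Real.rpow_add hy.1]
    congr 1; ring
  · have h1 : IntegrableOn (fun y : ℝ ↦ y ^ (-1 - p * s) * c) (Ici 1) := by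
      rw [integrableOn_Ici_iff_integrableOn_Ioi]
      exact (integrableOn_Ioi_rpow_of_lt (by nlinarith) zero_lt_one).mul_const c
    refine h1.congr_fun (fun y (hy : 1 ≤ y) ↦ ?_) measurableSet_Ici
    have hy0 : 0 < y := by linarith
    simp only [not_lt.2 hy, if_false, smul_eq_mul]
    rw [hpow y hy0, ← mul_assoc, ← Real.rpow_add hy0]
    congr 2; ring

/-- The difference quotient of fractional order `s` whose `L^p` norm is the Gagliardo seminorm. -/
def fracDiff (s p : ℝ) (u : E N → ℝ) (z : E N × E N) : ℝ :=
  ‖z.1 - z.2‖ ^ (-(((N : ℝ) + p * s) / p)) * (u z.1 - u z.2)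

theorem measurable_fracDiff_kernel :
    Measurable fun z : E N × E N ↦ ‖z.1 - z.2‖ ^ (-(((N : ℝ) + p * s) / p)) := by
  fun_prop

theorem norm_fracDiff_rpow (hp : 0 < p) (u : E N → ℝ) (z : E N × E N) :
    ‖fracDiff s p u z‖ ^ p = ‖z.1 - z.2‖ ^ (-(N + p * s)) * ‖u z.1 - u z.2‖ ^ p := by
  have h0 : 0 ≤ ‖z.1 - z.2‖ := norm_nonneg _
  rw [fracDiff, norm_mul, Real.mul_rpow (norm_nonneg _) (norm_nonneg _),
    Real.norm_of_nonneg (Real.rpow_nonneg h0 _), ← Real.rpow_mul h0]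
  congr 2
  field_simp

/-- The substitution `y = x + h` turns the seminorm into an integral over `h` of the kernel times
`‖φ - φ(· + h)‖_p^p`. For `‖h‖ < 1` the translation estimate gives the factor `‖h‖^p`; for larger
`h` the triangle inequality and the Poincaré constant `C` give `2^p C^p`. -/
theorem IsTestFunction.lintegral_fracDiff_le (hφ : IsTestFunction U φ) (hp : 1 ≤ p) {C : ℝ≥0}
    (hC : eLpNorm φ (ENNReal.ofReal p) volume ≤ C * eLpNorm (∇ φ) (ENNReal.ofReal p) volume) :
    ∫⁻ z, ‖fracDiff s p φ z‖ₑ ^ p ≤ (∫⁻ h : E N, ENNReal.ofReal (‖h‖ ^ (-(N + p * s)) *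
      if ‖h‖ < 1 then ‖h‖ ^ p else 2 ^ p * C ^ p)) * ∫⁻ x, ‖∇ φ x‖ₑ ^ p := by
  have hp0 : 0 < p := by linarith
  set k : E N → ℝ≥0∞ := fun h ↦ ENNReal.ofReal (‖h‖ ^ (-(N + p * s))) with hk
  have hkm : Measurable k := by fun_prop
  have hφm : Measurable φ := hφ.continuous.measurable
  have h1 : ∀ z : E N × E N, ‖fracDiff s p φ z‖ₑ ^ p = k (z.2 - z.1) * ‖φ z.1 - φ z.2‖ₑ ^ p := by
    intro z
    rw [← ofReal_norm, ENNReal.ofReal_rpow_of_nonneg (norm_nonneg _) hp0.le,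
      norm_fracDiff_rpow hp0, ENNReal.ofReal_mul (Real.rpow_nonneg (norm_nonneg _) _),
      ← ENNReal.ofReal_rpow_of_nonneg (norm_nonneg _) hp0.le, ofReal_norm, norm_sub_rev]
  have h2 : ∀ h, ∫⁻ x, ‖φ x - φ (x + h)‖ₑ ^ p ≤
      ENNReal.ofReal (if ‖h‖ < 1 then ‖h‖ ^ p else 2 ^ p * C ^ p) * ∫⁻ x, ‖∇ φ x‖ₑ ^ p := by
    intro h
    split_ifs with hh
    · refine (hφ.lintegral_translate_sub_le hp h).trans (le_of_eq ?_)
      rw [← ofReal_norm, ENNReal.ofReal_rpow_of_nonneg (norm_nonneg _) hp0.le]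
    · have e1 : eLpNorm (fun x ↦ φ x - φ (x + h)) (ENNReal.ofReal p) volume ≤
          2 * (C * eLpNorm (∇ φ) (ENNReal.ofReal p) volume) := by
        refine (eLpNorm_sub_le hφ.continuous.aestronglyMeasurable
          (hφ.continuous.comp (by fun_prop)).aestronglyMeasurable (by simpa)).trans ?_
        rw [eLpNorm_comp_measurePreserving (f := fun x : E N ↦ x + h)
          hφ.continuous.aestronglyMeasurable (measurePreserving_add_right volume h), two_mul]
        gcongr
      have e2 := ENNReal.rpow_le_rpow e1 hp0.le
      rw [ENNReal.mul_rpow_of_nonneg _ _ hp0.le, ENNReal.mul_rpow_of_nonneg _ _ hp0.le] at e2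
      simp only [eLpNorm_eq_lintegral_rpow_enorm_toReal
        (show ENNReal.ofReal p ≠ 0 by simpa) ENNReal.ofReal_ne_top, ENNReal.toReal_ofReal hp0.le,
        ← ENNReal.rpow_mul, one_div, inv_mul_cancel₀ hp0.ne', ENNReal.rpow_one] at e2
      refine e2.trans (le_of_eq ?_)
      rw [ENNReal.ofReal_mul (by positivity), ← ENNReal.ofReal_rpow_of_nonneg (by simp) hp0.le,
        ← ENNReal.ofReal_rpow_of_nonneg (by simp) hp0.le, mul_assoc]
      simp
  have hm2 : Measurable fun z : E N × E N ↦ k (z.2 - z.1) * ‖φ z.1 - φ z.2‖ₑ ^ p := by fun_prop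
  calc ∫⁻ z, ‖fracDiff s p φ z‖ₑ ^ p
      = ∫⁻ x, ∫⁻ y, k (y - x) * ‖φ x - φ y‖ₑ ^ p := by
        simp_rw [h1]
        rw [Measure.volume_eq_prod, lintegral_prod _ hm2.aemeasurable]
    _ = ∫⁻ x, ∫⁻ h, k h * ‖φ x - φ (x + h)‖ₑ ^ p := by
        refine lintegral_congr fun x ↦ ?_
        rw [← lintegral_add_left_eq_self _ x]
        simp
    _ = ∫⁻ h, ∫⁻ x, k h * ‖φ x - φ (x + h)‖ₑ ^ p := by
        rw [lintegral_lintegral_swap]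
        exact Measurable.aemeasurable (by fun_prop)
    _ = ∫⁻ h, k h * ∫⁻ x, ‖φ x - φ (x + h)‖ₑ ^ p :=
        lintegral_congr fun h ↦ lintegral_const_mul' _ _ ENNReal.ofReal_ne_top
    _ ≤ ∫⁻ h, k h * (ENNReal.ofReal (if ‖h‖ < 1 then ‖h‖ ^ p else 2 ^ p * C ^ p) *
          ∫⁻ x, ‖∇ φ x‖ₑ ^ p) := by
        gcongr with h
        exact h2 h
    _ = _ := by
        rw [← lintegral_mul_const]
        · refine lintegral_congr fun h ↦ ?_
          rw [← mul_assoc, hk, ← ENNReal.ofReal_mul (by positivity)]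
        · refine ENNReal.measurable_ofReal.comp ?_
          refine Measurable.mul (by fun_prop) (Measurable.ite ?_ (by fun_prop) (by fun_prop))
          exact measurableSet_lt measurable_norm measurable_const

theorem ae_prod_of_ae {q : E N → Prop} (h : ∀ᵐ x, q x) :
    ∀ᵐ z : E N × E N, q z.1 ∧ q z.2 :=
  (Measure.quasiMeasurePreserving_fst.ae h).and (Measure.quasiMeasurePreserving_snd.ae h)

/-- The Gagliardo seminorm is bounded by the norm of the gradient. -/
theorem InX.exists_fracDiff_bound (hs0 : 0 < s) (hs1 : s < 1) (hp : 1 ≤ p) (hpN : p < N)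
    (hΩ : Bornology.IsBounded Ω) :
    ∃ C : ℝ≥0, ∀ u G, InX Ω (ENNReal.ofReal p) u G →
      MemLp (fracDiff s p u) (ENNReal.ofReal p) volume ∧
      eLpNorm (fracDiff s p u) (ENNReal.ofReal p) volume ≤
        C * eLpNorm G (ENNReal.ofReal p) volume := by
  have hp0 : 0 < p := by linarith
  obtain ⟨C, hC⟩ := exists_poincare hp hpN hΩ
  have hN : 0 < N := by have : (0 : ℝ) < N := by linarith
                        exact_mod_cast this
  have hK := lintegral_rpow_norm_kernel_lt_top hN hs0 hs1 hp0 (2 ^ p * C ^ p)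
  set K := ∫⁻ h : E N, ENNReal.ofReal (‖h‖ ^ (-(N + p * s)) *
    if ‖h‖ < 1 then ‖h‖ ^ p else 2 ^ p * C ^ p)
  have hK' : K ^ (1 / p) ≠ ⊤ := ENNReal.rpow_ne_top_of_nonneg (by positivity) hK.ne
  refine ⟨(K ^ (1 / p)).toNNReal, fun u G h ↦ h.eLpNorm_le_of_test (by simpa) (fracDiff s p) ?_ ?_ ?_⟩
  · intro φ u _ h2
    filter_upwards [ae_prod_of_ae h2] with z hz
    exact (hz.1.sub hz.2).const_mul _
  · intro φ hφ
    have := hφ.continuous.measurable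
    exact (measurable_fracDiff_kernel.mul
      (by fun_prop : Measurable fun z : E N × E N ↦ φ z.1 - φ z.2)).aestronglyMeasurable
  · intro φ hφ
    rw [ENNReal.coe_toNNReal hK', eLpNorm_eq_lintegral_rpow_enorm_toReal (by simpa) (by simp),
      eLpNorm_eq_lintegral_rpow_enorm_toReal (by simpa) (by simp), ENNReal.toReal_ofReal hp0.le,
      ← ENNReal.mul_rpow_of_nonneg _ _ (by positivity)]
    exact ENNReal.rpow_le_rpow (hφ.lintegral_fracDiff_le hp (hC _ _ (InX.of_test hφ)))
      (by positivity)

/-- A function `u` weighted by the `p`-th root of `V`. -/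
def rootWeight (p : ℝ) (V u : E N → ℝ) (x : E N) : ℝ := |V x| ^ (1 / p) * u x

/-- The exponent `N` is the Hölder partner of the Sobolev exponent: `1/p = 1/N + (1/p - 1/N)`. It
corresponds to `V ∈ L^(N/p)`, which follows from `V ∈ L^q` because `Ω` has finite measure. -/
theorem memLp_rootWeight {q : ℝ} (hp : 1 ≤ p) (hq : N / p ≤ q)
    (hΩ : Bornology.IsBounded Ω) {V : E N → ℝ}
    (hV : MemLp V (ENNReal.ofReal q) (volume.restrict Ω)) :
    MemLp (fun x ↦ |V x| ^ (1 / p)) (ENNReal.ofReal N) (volume.restrict Ω) := by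
  have hp0 : 0 < p := by linarith
  have : IsFiniteMeasure (volume.restrict Ω) := ⟨by simpa using hΩ.measure_lt_top⟩
  have h1 := (hV.mono_exponent (ENNReal.ofReal_le_ofReal hq)).norm_rpow_div (ENNReal.ofReal (1 / p))
  rw [ENNReal.toReal_ofReal (by positivity), ← ENNReal.ofReal_div_of_pos (by positivity)] at h1
  rwa [show (N : ℝ) / p / (1 / p) = N by field_simp] at h1

theorem InX.eLpNorm_mul_le (hp : 1 ≤ p) (hpN : p < N) {C : ℝ≥0} (hC : ∀ u G,
      InX Ω (ENNReal.ofReal p) u G → MemLp u (ENNReal.ofReal (p⁻¹ - (N : ℝ)⁻¹)⁻¹) volume ∧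
      eLpNorm u (ENNReal.ofReal (p⁻¹ - (N : ℝ)⁻¹)⁻¹) volume ≤
        C * eLpNorm G (ENNReal.ofReal p) volume)
    {k : E N → ℝ} (hk : MemLp k (ENNReal.ofReal N) (volume.restrict Ω))
    (h : InX Ω (ENNReal.ofReal p) u G) :
    MemLp (fun x ↦ k x * u x) (ENNReal.ofReal p) (volume.restrict Ω) ∧
    eLpNorm (fun x ↦ k x * u x) (ENNReal.ofReal p) (volume.restrict Ω) ≤
      eLpNorm k (ENNReal.ofReal N) (volume.restrict Ω) *
        (C * eLpNorm G (ENNReal.ofReal p) volume) := by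
  have hlt : (N : ℝ)⁻¹ < p⁻¹ := inv_strictAnti₀ (by linarith) hpN
  have : ENNReal.HolderTriple (ENNReal.ofReal N) (ENNReal.ofReal (p⁻¹ - (N : ℝ)⁻¹)⁻¹)
      (ENNReal.ofReal p) := by
    constructor
    have h1 : (0 : ℝ) < N := by linarith
    rw [← ENNReal.ofReal_inv_of_pos h1, ← ENNReal.ofReal_inv_of_pos (inv_pos.2 (by linarith)),
      ← ENNReal.ofReal_inv_of_pos (by linarith), ← ENNReal.ofReal_add]
    · congr 1; rw [inv_inv]; ring
    · positivity
    · rw [inv_inv]; linarith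
  have hu := hC u G h
  refine ⟨(hu.1.restrict Ω).mul hk, ?_⟩
  refine (eLpNorm_smul_le_mul_eLpNorm
    (q := ENNReal.ofReal (p⁻¹ - (N : ℝ)⁻¹)⁻¹) (hu.1.restrict Ω).1 hk.1).trans
    (mul_le_mul_right ?_ _)
  exact (eLpNorm_mono_measure _ Measure.restrict_le_self).trans hu.2

theorem InX.exists_rootWeight_bound {q : ℝ} (hp : 1 ≤ p) (hpN : p < N) (hq : N / p ≤ q)
    (hΩ : Bornology.IsBounded Ω) {V : E N → ℝ}
    (hV : MemLp V (ENNReal.ofReal q) (volume.restrict Ω)) :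
    ∃ C : ℝ≥0, ∀ u G, InX Ω (ENNReal.ofReal p) u G →
      MemLp (rootWeight p V u) (ENNReal.ofReal p) (volume.restrict Ω) ∧
      eLpNorm (rootWeight p V u) (ENNReal.ofReal p) (volume.restrict Ω) ≤
        C * eLpNorm G (ENNReal.ofReal p) volume := by
  obtain ⟨C, hC⟩ := InX.exists_sobolev (Ω := Ω) hp hpN
  have hk := memLp_rootWeight hp hq hΩ hV
  refine ⟨(eLpNorm (fun x ↦ |V x| ^ (1 / p)) (ENNReal.ofReal N) (volume.restrict Ω)).toNNReal * C,
    fun u G h ↦ ?_⟩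
  have := h.eLpNorm_mul_le hp hpN hC hk
  rw [ENNReal.coe_mul, ENNReal.coe_toNNReal hk.2.ne, mul_assoc]
  exact this

end

/-! ### Convexity and differentiability of `∫ ‖·‖^p` -/

section

section NormPower

variable {α F : Type*} [MeasurableSpace α] {μ : Measure α} [NormedAddCommGroup F]
  [InnerProductSpace ℝ F] {p : ℝ}

theorem norm_rpow_midpoint_le (hp : 1 ≤ p) (a b : F) :
    ‖(2⁻¹ : ℝ) • (a + b)‖ ^ p ≤ (‖a‖ ^ p + ‖b‖ ^ p) / 2 := by
  have h1 := (convexOn_rpow hp).2 (norm_nonneg a) (norm_nonneg b)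
    (by norm_num : (0 : ℝ) ≤ 2⁻¹) (by norm_num : (0 : ℝ) ≤ 2⁻¹) (by norm_num)
  simp only [smul_eq_mul] at h1
  refine le_trans (Real.rpow_le_rpow (norm_nonneg _) ?_ (by linarith)) (h1.trans_eq (by ring))
  rw [norm_smul, Real.norm_of_nonneg (by norm_num)]
  linarith [norm_add_le a b]

/-- For equal norms the triangle inequality is strict, since distinct vectors of equal norm are not
on one ray; for unequal norms `r ↦ r^p` is strictly convex. -/
theorem norm_rpow_midpoint_lt (hp : 1 < p) {a b : F} (hab : a ≠ b) :
    ‖(2⁻¹ : ℝ) • (a + b)‖ ^ p < (‖a‖ ^ p + ‖b‖ ^ p) / 2 := by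
  by_cases hn : ‖a‖ = ‖b‖
  · have h1 : ‖(2⁻¹ : ℝ) • (a + b)‖ < ‖b‖ := by
      rw [norm_smul, Real.norm_of_nonneg (by norm_num)]
      have : ‖a + b‖ < ‖a‖ + ‖b‖ := by
        refine lt_of_le_of_ne (norm_add_le a b) fun h ↦ hab ?_
        rw [← sameRay_iff_norm_add] at h
        exact (sameRay_iff_of_norm_eq hn).1 h
      linarith
    rw [hn]
    calc _ < ‖b‖ ^ p := Real.rpow_lt_rpow (norm_nonneg _) h1 (by linarith)
      _ = _ := by ring
  · have h1 := (strictConvexOn_rpow hp).2 (norm_nonneg a) (norm_nonneg b) hn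
      (by norm_num : (0 : ℝ) < 2⁻¹) (by norm_num : (0 : ℝ) < 2⁻¹) (by norm_num)
    simp only [smul_eq_mul] at h1
    refine lt_of_le_of_lt (Real.rpow_le_rpow (norm_nonneg _) ?_ (by linarith))
      (h1.trans_eq (by ring))
    rw [norm_smul, Real.norm_of_nonneg (by norm_num)]
    linarith [norm_add_le a b]

/-- A quantitative form of the strict convexity of `‖·‖ ^ p`. -/
theorem exists_norm_sub_rpow_le [FiniteDimensional ℝ F] (hp : 1 < p) {ε : ℝ} (hε : 0 < ε) :
    ∃ C : ℝ, 0 ≤ C ∧ ∀ a b : F, ‖a - b‖ ^ p ≤ ε * (‖a‖ ^ p + ‖b‖ ^ p) +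
      C * ((‖a‖ ^ p + ‖b‖ ^ p) / 2 - ‖(2⁻¹ : ℝ) • (a + b)‖ ^ p) := by
  have hp0 : 0 < p := by linarith
  set D : F × F → ℝ := fun z ↦ (‖z.1‖ ^ p + ‖z.2‖ ^ p) / 2 - ‖(2⁻¹ : ℝ) • (z.1 + z.2)‖ ^ p with hD
  set S : Set (F × F) := {z | ‖z.1‖ ^ p + ‖z.2‖ ^ p = 1 ∧ ε ≤ ‖z.1 - z.2‖ ^ p} with hS
  have hrc : Continuous fun r : ℝ ↦ r ^ p := Real.continuous_rpow_const hp0.le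
  have hDc : Continuous D := by
    refine Continuous.sub (Continuous.div_const (Continuous.add ?_ ?_) _) ?_ <;>
      exact hrc.comp (by fun_prop)
  have hSc : IsCompact S := by
    refine Metric.isCompact_of_isClosed_isBounded ?_ ?_
    · rw [hS, ofPred_and]
      refine IsClosed.inter (isClosed_eq (Continuous.add ?_ ?_) continuous_const)
        (isClosed_le continuous_const ?_) <;> exact hrc.comp (by fun_prop)
    · refine (Metric.isBounded_closedBall (x := (0 : F × F)) (r := 1)).subset ?_
      rintro ⟨a, b⟩ ⟨h1, -⟩
      have key : ∀ x y : ℝ, 0 ≤ x → 0 ≤ y → x ^ p + y ^ p = 1 → x ≤ 1 := by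
        intro x y hx hy h
        by_contra! hx1
        have := Real.one_lt_rpow hx1 hp0
        have := Real.rpow_nonneg hy p
        linarith
      rw [mem_closedBall_zero_iff, Prod.norm_mk, max_le_iff]
      exact ⟨key _ _ (norm_nonneg _) (norm_nonneg _) h1,
        key _ _ (norm_nonneg _) (norm_nonneg _) (by rw [add_comm]; exact h1)⟩
  -- On the compact set `S` of normalised, separated pairs the midpoint deficit `D` is continuous
  -- and positive, hence at least some `δ > 0`.
  obtain ⟨δ, hδ, hδ'⟩ := hSc.exists_forall_le' hDc.continuousOn (a := 0) (by
    rintro ⟨a, b⟩ ⟨-, h2⟩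
    have hab : a ≠ b := by
      rintro rfl
      simp [hp0.ne'] at h2
      linarith
    have := norm_rpow_midpoint_lt hp hab
    simp only [hD]
    linarith)
  -- With `m = ‖a‖^p + ‖b‖^p`, convexity gives `‖a - b‖^p ≤ 2^p m`. If the pair is not already
  -- covered by the `ε` term, scaling it into `S` gives `m ≤ δ⁻¹ D(a, b)`.
  refine ⟨2 ^ p * δ⁻¹, by positivity, fun a b ↦ ?_⟩
  have hdef : 0 ≤ (‖a‖ ^ p + ‖b‖ ^ p) / 2 - ‖(2⁻¹ : ℝ) • (a + b)‖ ^ p :=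
    sub_nonneg.2 (norm_rpow_midpoint_le hp.le a b)
  have ha := Real.rpow_nonneg (norm_nonneg a) p
  have hb := Real.rpow_nonneg (norm_nonneg b) p
  by_cases hm : ‖a - b‖ ^ p ≤ ε * (‖a‖ ^ p + ‖b‖ ^ p)
  · have : 0 ≤ 2 ^ p * δ⁻¹ * ((‖a‖ ^ p + ‖b‖ ^ p) / 2 - ‖(2⁻¹ : ℝ) • (a + b)‖ ^ p) := by positivity
    linarith
  push Not at hm
  have hmpos : 0 < ‖a‖ ^ p + ‖b‖ ^ p := by
    refine lt_of_le_of_ne (by linarith) fun h0 ↦ ?_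
    have h1 : ‖a‖ ^ p = 0 := by linarith
    have h2 : ‖b‖ ^ p = 0 := by linarith
    rw [Real.rpow_eq_zero (norm_nonneg _) hp0.ne', norm_eq_zero] at h1 h2
    simp [h1, h2, hp0.ne'] at hm
  set m := ‖a‖ ^ p + ‖b‖ ^ p with hmdef
  -- All quantities are homogeneous of degree `p`, so this factor normalises `m` to 1.
  set t := m ^ (-p⁻¹) with ht
  have ht0 : 0 < t := Real.rpow_pos_of_pos hmpos _
  have htp : t ^ p = m⁻¹ := by
    rw [ht, ← Real.rpow_mul hmpos.le, neg_mul, inv_mul_cancel₀ hp0.ne', Real.rpow_neg_one]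
  have hsc : ∀ x : F, ‖t • x‖ ^ p = m⁻¹ * ‖x‖ ^ p := fun x ↦ by
    rw [norm_smul, Real.mul_rpow (norm_nonneg _) (norm_nonneg _), Real.norm_of_nonneg ht0.le, htp]
  have hmem : (t • a, t • b) ∈ S := by
    refine ⟨?_, ?_⟩
    · simp only [hsc]
      rw [← mul_add, ← hmdef, inv_mul_cancel₀ hmpos.ne']
    · simp only [← smul_sub, hsc]
      rw [inv_mul_eq_div, le_div_iff₀ hmpos]
      exact hm.le
  have h1 := hδ' _ hmem
  simp only [hD, ← smul_add, smul_comm (2⁻¹ : ℝ) t, hsc] at h1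
  rw [← mul_add, ← hmdef, mul_div_assoc, ← mul_sub, inv_mul_eq_div, le_div_iff₀ hmpos] at h1
  have h2 : ‖a - b‖ ^ p ≤ 2 ^ p * m := by
    have h3 : ‖a - b‖ ^ p ≤ (‖a‖ + ‖b‖) ^ p :=
      Real.rpow_le_rpow (norm_nonneg _) (norm_sub_le a b) hp0.le
    have h4 : (2⁻¹ * (‖a‖ + ‖b‖)) ^ p ≤ m / 2 := by
      have := (convexOn_rpow hp.le).2 (norm_nonneg a) (norm_nonneg b)
        (by norm_num : (0 : ℝ) ≤ 2⁻¹) (by norm_num : (0 : ℝ) ≤ 2⁻¹) (by norm_num)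
      simp only [smul_eq_mul] at this
      rw [mul_add]
      linarith
    rw [Real.mul_rpow (by norm_num) (by positivity), Real.inv_rpow (by norm_num),
      inv_mul_le_iff₀ (by positivity)] at h4
    have : (0 : ℝ) < 2 ^ p := by positivity
    nlinarith
  have h5 : m ≤ δ⁻¹ * (m / 2 - ‖(2⁻¹ : ℝ) • (a + b)‖ ^ p) := by
    rw [inv_mul_eq_div, le_div_iff₀ hδ]; linarith
  have h6 : 2 ^ p * m ≤ 2 ^ p * (δ⁻¹ * (m / 2 - ‖(2⁻¹ : ℝ) • (a + b)‖ ^ p)) := by gcongr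
  have h7 : 0 ≤ ε * m := by positivity
  linarith

theorem norm_pairing_le (hp : 1 < p) (a b : F) :
    |‖a‖ ^ (p - 2) * inner ℝ a b| ≤ ‖a‖ ^ (p - 1) * ‖b‖ := by
  rw [abs_mul, abs_of_nonneg (Real.rpow_nonneg (norm_nonneg _) _)]
  rcases eq_or_ne a 0 with rfl | ha
  · simp [show p - 1 ≠ 0 by linarith]
  · have hpos : 0 < ‖a‖ := norm_pos_iff.2 ha
    calc ‖a‖ ^ (p - 2) * |inner ℝ a b| ≤ ‖a‖ ^ (p - 2) * (‖a‖ * ‖b‖) := by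
          gcongr; exact abs_real_inner_le_norm a b
      _ = ‖a‖ ^ (p - 1) * ‖b‖ := by
          rw [← mul_assoc, ← Real.rpow_add_one hpos.ne']; congr 2; ring

theorem rpow_mul_le_add_rpow (hp : 1 ≤ p) {x y : ℝ} (hx : 0 ≤ x) (hy : 0 ≤ y) :
    x ^ (p - 1) * y ≤ x ^ p + y ^ p := by
  have key : ∀ m : ℝ, 0 ≤ m → m ^ (p - 1) * m = m ^ p := by
    intro m hm
    rcases hm.eq_or_lt with rfl | hm
    · simp [show p ≠ 0 by linarith]
    · rw [← Real.rpow_add_one hm.ne']; congr 1; ring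
  have h1 := Real.rpow_nonneg hx p
  have h2 := Real.rpow_nonneg hy p
  rcases le_total x y with h | h
  · have : x ^ (p - 1) * y ≤ y ^ (p - 1) * y := by gcongr
    rw [key y hy] at this
    linarith
  · have : x ^ (p - 1) * y ≤ x ^ (p - 1) * x := by gcongr
    rw [key x hx] at this
    linarith

theorem aestronglyMeasurable_pairing {a b : α → F} (ha : AEStronglyMeasurable a μ)
    (hb : AEStronglyMeasurable b μ) :
    AEStronglyMeasurable (fun x ↦ ‖a x‖ ^ (p - 2) * inner ℝ (a x) (b x)) μ :=
  (ha.norm.aemeasurable.pow_const _).aestronglyMeasurable.mul (ha.inner hb)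

theorem integrable_pairing (hp : 1 < p) {a b : α → F} (ha : MemLp a (ENNReal.ofReal p) μ)
    (hb : MemLp b (ENNReal.ofReal p) μ) :
    Integrable (fun x ↦ ‖a x‖ ^ (p - 2) * inner ℝ (a x) (b x)) μ := by
  refine ((ha.integrable_norm_rpow_ofReal (by linarith)).add
    (hb.integrable_norm_rpow_ofReal (by linarith))).mono'
    (aestronglyMeasurable_pairing ha.1 hb.1) (ae_of_all _ fun x ↦ ?_)
  exact (norm_pairing_le hp _ _).trans
    (rpow_mul_le_add_rpow hp.le (norm_nonneg _) (norm_nonneg _))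

/-- Differentiation under the integral sign: since `p > 1`, `‖·‖^p` is differentiable even at the
origin, and for `|t| < 1` the derivative is dominated by `p ((‖a‖ + ‖b‖)^p + ‖b‖^p)`. -/
theorem hasDerivAt_integral_norm_rpow (hp : 1 < p) {a b : α → F}
    (ha : MemLp a (ENNReal.ofReal p) μ) (hb : MemLp b (ENNReal.ofReal p) μ) :
    HasDerivAt (fun t : ℝ ↦ ∫ x, ‖a x + t • b x‖ ^ p ∂μ)
      (p * ∫ x, ‖a x‖ ^ (p - 2) * inner ℝ (a x) (b x) ∂μ) 0 := by
  have hp0 : 0 < p := by linarith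
  have hmem : ∀ t : ℝ, MemLp (fun x ↦ a x + t • b x) (ENNReal.ofReal p) μ :=
    fun t ↦ ha.add (hb.const_smul t)
  have hint : ∀ t : ℝ, Integrable (fun x ↦ ‖a x + t • b x‖ ^ p) μ :=
    fun t ↦ (hmem t).integrable_norm_rpow_ofReal hp0
  have hnab : Integrable (fun x ↦ ‖(‖a x‖ + ‖b x‖)‖ ^ p) μ :=
    (ha.norm.add hb.norm).integrable_norm_rpow_ofReal hp0
  have key := hasDerivAt_integral_of_dominated_loc_of_deriv_le (μ := μ) (x₀ := (0 : ℝ))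
    (s := Metric.ball 0 1) (F := fun t x ↦ ‖a x + t • b x‖ ^ p)
    (F' := fun t x ↦ p * (‖a x + t • b x‖ ^ (p - 2) * inner ℝ (a x + t • b x) (b x)))
    (bound := fun x ↦ p * (‖(‖a x‖ + ‖b x‖)‖ ^ p + ‖b x‖ ^ p))
    (Metric.ball_mem_nhds _ one_pos) (Eventually.of_forall fun t ↦ (hint t).1) (hint 0)
    ((aestronglyMeasurable_pairing (hmem 0).1 hb.1).const_mul p) ?_ ?_ ?_
  · simpa [integral_const_mul] using key.2
  · refine ae_of_all _ fun x t ht ↦ ?_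
    rw [mem_ball_zero_iff, Real.norm_eq_abs] at ht
    rw [norm_mul, Real.norm_of_nonneg hp0.le]
    gcongr
    refine (norm_pairing_le hp _ _).trans ((rpow_mul_le_add_rpow hp.le (norm_nonneg _)
      (norm_nonneg _)).trans ?_)
    gcongr
    rw [Real.norm_of_nonneg (by positivity)]
    refine (norm_add_le _ _).trans ?_
    rw [norm_smul, Real.norm_eq_abs]
    nlinarith [norm_nonneg (b x)]
  · exact ((hnab.add (hb.integrable_norm_rpow_ofReal hp0))).const_mul p
  · refine ae_of_all _ fun x t _ ↦ ?_
    have h1 : HasDerivAt (fun t : ℝ ↦ a x + t • b x) (b x) t := by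
      simpa using ((hasDerivAt_id t).smul_const (b x)).const_add (a x)
    refine ((hasFDerivAt_norm_rpow (a x + t • b x) hp).comp_hasDerivAt t h1).congr_deriv ?_
    simp only [smul_apply, innerSL_apply_apply, smul_eq_mul, mul_assoc]

theorem integral_norm_rpow_midpoint_le (hp : 1 ≤ p) {a b : α → F}
    (ha : MemLp a (ENNReal.ofReal p) μ) (hb : MemLp b (ENNReal.ofReal p) μ) :
    ∫ x, ‖(2⁻¹ : ℝ) • (a x + b x)‖ ^ p ∂μ ≤ (∫ x, ‖a x‖ ^ p ∂μ + ∫ x, ‖b x‖ ^ p ∂μ) / 2 := by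
  have hp0 : 0 < p := by linarith
  have h1 := ha.integrable_norm_rpow_ofReal hp0
  have h2 := hb.integrable_norm_rpow_ofReal hp0
  rw [← integral_add h1 h2, ← integral_div]
  exact integral_mono (((ha.add hb).const_smul (2⁻¹ : ℝ)).integrable_norm_rpow_ofReal hp0)
    ((h1.add h2).div_const 2) fun x ↦ norm_rpow_midpoint_le hp _ _

theorem integral_norm_sub_rpow_le (hp : 1 < p) {a b : α → F}
    (ha : MemLp a (ENNReal.ofReal p) μ) (hb : MemLp b (ENNReal.ofReal p) μ) {ε C : ℝ}
    (hC : ∀ a b : F, ‖a - b‖ ^ p ≤ ε * (‖a‖ ^ p + ‖b‖ ^ p) +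
      C * ((‖a‖ ^ p + ‖b‖ ^ p) / 2 - ‖(2⁻¹ : ℝ) • (a + b)‖ ^ p)) :
    ∫ x, ‖a x - b x‖ ^ p ∂μ ≤ ε * (∫ x, ‖a x‖ ^ p ∂μ + ∫ x, ‖b x‖ ^ p ∂μ) +
      C * ((∫ x, ‖a x‖ ^ p ∂μ + ∫ x, ‖b x‖ ^ p ∂μ) / 2 -
        ∫ x, ‖(2⁻¹ : ℝ) • (a x + b x)‖ ^ p ∂μ) := by
  have hp0 : 0 < p := by linarith
  have h1 := ha.integrable_norm_rpow_ofReal hp0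
  have h2 := hb.integrable_norm_rpow_ofReal hp0
  have h3 : Integrable (fun x ↦ ‖(2⁻¹ : ℝ) • (a x + b x)‖ ^ p) μ :=
    ((ha.add hb).const_smul (2⁻¹ : ℝ)).integrable_norm_rpow_ofReal hp0
  have h4 := (ha.sub hb).integrable_norm_rpow_ofReal hp0
  have h12 : Integrable (fun x ↦ ‖a x‖ ^ p + ‖b x‖ ^ p) μ := h1.add h2
  have h12' : Integrable (fun x ↦ (‖a x‖ ^ p + ‖b x‖ ^ p) / 2) μ := h12.div_const 2
  have h5 : Integrable (fun x ↦ (‖a x‖ ^ p + ‖b x‖ ^ p) / 2 - ‖(2⁻¹ : ℝ) • (a x + b x)‖ ^ p) μ :=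
    h12'.sub h3
  have h6 := integral_mono h4 ((h12.const_mul ε).add (h5.const_mul C)) fun x ↦ hC (a x) (b x)
  refine h6.trans (le_of_eq ?_)
  simp only [Pi.add_apply]
  rw [integral_add (h12.const_mul ε) (h5.const_mul C), integral_const_mul, integral_const_mul,
    integral_sub h12' h3, integral_div, integral_add h1 h2]

end NormPower

end

/-! ### Rellich compactness through averages on balls -/

section

section Compactness

variable {N : ℕ} {Ω : Set (E N)} {p s : ℝ}

theorem enorm_integral_rpow_le {α : Type*} [MeasurableSpace α] {ν : Measure α}
    [IsProbabilityMeasure ν] (hp : 1 ≤ p) {f : α → ℝ} (hf : AEStronglyMeasurable f ν) :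
    ‖∫ x, f x ∂ν‖ₑ ^ p ≤ ∫⁻ x, ‖f x‖ₑ ^ p ∂ν := by
  have hp0 : 0 < p := by linarith
  have h := eLpNorm_le_eLpNorm_of_exponent_le (p := 1) (q := ENNReal.ofReal p) (μ := ν)
    (by simpa) hf
  rw [eLpNorm_one_eq_lintegral_enorm, eLpNorm_eq_lintegral_rpow_enorm_toReal (by simpa)
    (by simp), ENNReal.toReal_ofReal hp0.le] at h
  refine (ENNReal.rpow_le_rpow ((enorm_integral_le_lintegral_enorm f).trans h) hp0.le).trans
    (le_of_eq ?_)
  rw [← ENNReal.rpow_mul, one_div, inv_mul_cancel₀ hp0.ne', ENNReal.rpow_one]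

/-- The uniform probability measure on a ball. -/
def ballMeasure (c : E N) (r : ℝ) : Measure (E N) :=
  (volume (Metric.ball c r))⁻¹ • volume.restrict (Metric.ball c r)

theorem isProbabilityMeasure_ballMeasure (c : E N) {r : ℝ} (hr : 0 < r) :
    IsProbabilityMeasure (ballMeasure c r) := by
  constructor
  rw [ballMeasure, Measure.smul_apply, Measure.restrict_apply_univ, smul_eq_mul]
  exact ENNReal.inv_mul_cancel (Metric.measure_ball_pos volume c hr).ne' measure_ball_lt_top.ne

theorem integrable_ballMeasure (hp : 1 ≤ p) {w : E N → ℝ}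
    (hw : MemLp w (ENNReal.ofReal p) volume) (c : E N) {r : ℝ} (hr : 0 < r) :
    Integrable w (ballMeasure c r) := by
  have := isProbabilityMeasure_ballMeasure c hr
  refine MemLp.integrable (q := ENNReal.ofReal p) (by simpa) ?_
  exact (hw.restrict _).smul_measure
    (ENNReal.inv_ne_top.2 (Metric.measure_ball_pos volume c hr).ne')

/-- By Jensen, the deviation from the mean over a ball containing `x` is at most the mean of `|w(x)
- w(y)|^p`. There `‖x - y‖ ≤ 2r`, so the singular kernel can be inserted at the price of
`(2r)^(N+ps)`. The ball may vary with `x`, so that it can be taken from a finite cover. -/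
theorem lintegral_sub_average_le (hs : 0 < s) (hp : 1 ≤ p) {w : E N → ℝ}
    (hw : MemLp w (ENNReal.ofReal p) volume)
    (hw' : AEStronglyMeasurable (fracDiff s p w) volume) {r : ℝ} (hr : 0 < r) {f : E N → E N}
    (hf : ∀ x ∈ Ω, x ∈ Metric.ball (f x) r) (hΩ : MeasurableSet Ω) :
    ∫⁻ x in Ω, ‖w x - ∫ y, w y ∂(ballMeasure (f x) r)‖ₑ ^ p ≤
      (volume (Metric.ball (0 : E N) r))⁻¹ * ENNReal.ofReal ((2 * r) ^ (N + p * s)) *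
        ∫⁻ z, ‖fracDiff s p w z‖ₑ ^ p := by
  have hp0 : 0 < p := by linarith
  have hps : 0 < p * s := mul_pos hp0 hs
  have h1 : ∀ x ∈ Ω, ‖w x - ∫ y, w y ∂(ballMeasure (f x) r)‖ₑ ^ p ≤
      (volume (Metric.ball (0 : E N) r))⁻¹ * ENNReal.ofReal ((2 * r) ^ (N + p * s)) *
        ∫⁻ y, ‖fracDiff s p w (x, y)‖ₑ ^ p := by
    intro x hx
    have hP := isProbabilityMeasure_ballMeasure (f x) hr
    have hi := integrable_ballMeasure hp hw (f x) hr
    have e1 : w x - ∫ y, w y ∂(ballMeasure (f x) r) =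
        ∫ y, (w x - w y) ∂(ballMeasure (f x) r) := by
      rw [integral_sub (integrable_const _) hi]; simp
    rw [e1]
    refine (enorm_integral_rpow_le hp ((integrable_const _).sub hi).1).trans ?_
    rw [ballMeasure, lintegral_smul_measure, smul_eq_mul, Measure.addHaar_ball_center, mul_assoc,
      ← lintegral_const_mul' _ _ ENNReal.ofReal_ne_top]
    refine mul_le_mul_right ?_ _
    refine (setLIntegral_mono' measurableSet_ball fun y hy ↦ ?_).trans (setLIntegral_le_lintegral _ _)
    rcases eq_or_ne x y with rfl | hxy
    · simp [hp0]
    have hd0 : 0 < ‖x - y‖ := norm_pos_iff.2 (sub_ne_zero.2 hxy)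
    have hd : ‖x - y‖ ≤ 2 * r := by
      rw [← dist_eq_norm]
      have h1 := Metric.mem_ball.1 (hf x hx)
      have h2 := Metric.mem_ball'.1 hy
      linarith [dist_triangle x (f x) y]
    rw [← ofReal_norm, ENNReal.ofReal_rpow_of_nonneg (norm_nonneg _) hp0.le, ← ofReal_norm,
      ENNReal.ofReal_rpow_of_nonneg (norm_nonneg _) hp0.le, norm_fracDiff_rpow hp0,
      ← ENNReal.ofReal_mul (by positivity)]
    refine ENNReal.ofReal_le_ofReal ?_
    rw [← mul_assoc]
    refine le_mul_of_one_le_left (by positivity) ?_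
    rw [Real.rpow_neg hd0.le, ← div_eq_mul_inv, one_le_div (by positivity)]
    exact Real.rpow_le_rpow hd0.le hd (by positivity)
  refine (setLIntegral_mono' hΩ h1).trans ?_
  refine (setLIntegral_le_lintegral _ _).trans ?_
  rw [lintegral_const_mul', Measure.volume_eq_prod, lintegral_prod]
  · exact hw'.enorm.pow_const _
  · exact ENNReal.mul_ne_top (ENNReal.inv_ne_top.2 (Metric.measure_ball_pos volume _ hr).ne')
      ENNReal.ofReal_ne_top

/-- The volume scales like `r^N`, so the factor is a constant times `r^(ps)`. -/
theorem tendsto_ball_factor (hs : 0 < s) (hp : 0 < p) :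
    Tendsto (fun r : ℝ ↦ (volume (Metric.ball (0 : E N) r))⁻¹ *
      ENNReal.ofReal ((2 * r) ^ (N + p * s))) (𝓝[>] 0) (𝓝 0) := by
  have hps : 0 < p * s := mul_pos hp hs
  have h1 : Tendsto (fun r : ℝ ↦ (volume (Metric.ball (0 : E N) 1))⁻¹ *
      ENNReal.ofReal (2 ^ (N + p * s) * r ^ (p * s))) (𝓝[>] 0) (𝓝 0) := by
    have h2 : Tendsto (fun r : ℝ ↦ 2 ^ (N + p * s) * r ^ (p * s)) (𝓝[>] 0) (𝓝 0) := by
      have : Continuous fun r : ℝ ↦ 2 ^ (N + p * s) * r ^ (p * s) :=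
        continuous_const.mul (Real.continuous_rpow_const hps.le)
      have := this.tendsto 0
      rw [Real.zero_rpow hps.ne', mul_zero] at this
      exact this.mono_left nhdsWithin_le_nhds
    have h3 := ENNReal.Tendsto.const_mul (ENNReal.tendsto_ofReal h2)
      (Or.inr (ENNReal.inv_ne_top.2 (Metric.measure_ball_pos volume (0 : E N) one_pos).ne'))
    simpa using h3
  refine h1.congr' ?_
  filter_upwards [self_mem_nhdsWithin] with r (hr : 0 < r)
  have hrN : (0 : ℝ) < r ^ N := by positivity
  rw [Measure.addHaar_ball_of_pos _ _ hr, finrank_euclideanSpace_fin,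
    ENNReal.mul_inv (Or.inl (by simpa using hrN)) (Or.inl ENNReal.ofReal_ne_top),
    ← ENNReal.ofReal_inv_of_pos hrN, mul_right_comm, ← ENNReal.ofReal_mul (by positivity), mul_comm]
  congr 2
  rw [Real.mul_rpow (by norm_num) hr.le, Real.rpow_add hr, Real.rpow_natCast]
  field_simp

/-- Compare `u n - u m` with its averages over small balls. The deviation is uniformly small by the
Gagliardo bound, and finitely many balls cover `Ω`, so the averages are uniformly close for late
indices. -/
theorem cauchy_of_tendsto_averages (hs : 0 < s) (hp : 1 ≤ p) (hΩ : Bornology.IsBounded Ω)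
    (hΩm : MeasurableSet Ω) {u : ℕ → E N → ℝ} (hu : ∀ n, MemLp (u n) (ENNReal.ofReal p) volume)
    (hu' : ∀ n m, AEStronglyMeasurable (fracDiff s p fun x ↦ u n x - u m x) volume)
    {A : ℝ≥0∞} (hA : A ≠ ⊤)
    (hb : ∀ n m, ∫⁻ z, ‖fracDiff s p (fun x ↦ u n x - u m x) z‖ₑ ^ p ≤ A)
    (havg : ∀ k j : ℕ, ∃ a : ℝ, Tendsto (fun n ↦ ∫ y, u n y ∂(ballMeasure
      (TopologicalSpace.denseSeq (E N) k) (1 / (j + 1)))) atTop (𝓝 a))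
    {ε : ℝ≥0∞} (hε : 0 < ε) :
    ∃ n₀, ∀ n ≥ n₀, ∀ m ≥ n₀, ∫⁻ x in Ω, ‖u n x - u m x‖ₑ ^ p ≤ ε := by
  have hp0 : 0 < p := by linarith
  set d := TopologicalSpace.denseSeq (E N)
  have hvol : volume Ω ≠ ⊤ := hΩ.measure_lt_top.ne
  -- The radius `1 / (j + 1)` is chosen so that the deviation costs less than `ε / 2`; the factor
  -- `2^(p-1)` comes from `(a + b)^p ≤ 2^(p-1) (a^p + b^p)`.
  obtain ⟨j, hj⟩ : ∃ j : ℕ, (2 : ℝ≥0∞) ^ (p - 1) * ((volume (Metric.ball (0 : E N) (1 / (j + 1))))⁻¹ *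
      ENNReal.ofReal ((2 * (1 / (j + 1))) ^ (N + p * s)) * A) < ε / 2 := by
    have h1 : Tendsto (fun j : ℕ ↦ 1 / ((j : ℝ) + 1)) atTop (𝓝[>] 0) :=
      tendsto_nhdsWithin_iff.2 ⟨tendsto_one_div_add_atTop_nhds_zero_nat,
        Eventually.of_forall fun j ↦ by simp only [mem_Ioi]; positivity⟩
    have h2 := ENNReal.Tendsto.const_mul (a := (2 : ℝ≥0∞) ^ (p - 1)) (ENNReal.Tendsto.mul_const
      ((tendsto_ball_factor (N := N) hs hp0).comp h1) (Or.inr hA))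
      (Or.inr (ENNReal.rpow_ne_top_of_nonneg (by linarith) (by simp)))
    simp only [zero_mul, mul_zero] at h2
    exact (h2.eventually_lt_const (ENNReal.half_pos hε.ne')).exists
  set r : ℝ := 1 / (j + 1) with hr
  have hr0 : 0 < r := by positivity
  obtain ⟨M, hM⟩ : ∃ M : ℕ, ∀ x ∈ Ω, ∃ k < M, x ∈ Metric.ball (d k) r := by
    obtain ⟨t, ht⟩ := hΩ.isCompact_closure.elim_finite_subcover (fun k ↦ Metric.ball (d k) r)
      (fun _ ↦ Metric.isOpen_ball) (fun x _ ↦ by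
        obtain ⟨k, hk⟩ := (TopologicalSpace.denseRange_denseSeq (E N)).exists_dist_lt x hr0
        exact mem_iUnion.2 ⟨k, hk⟩)
    obtain ⟨M, hM⟩ := t.exists_nat_subset_range
    refine ⟨M, fun x hx ↦ ?_⟩
    obtain ⟨k, hk, hx⟩ := mem_iUnion₂.1 (ht (subset_closure hx))
    exact ⟨k, Finset.mem_range.1 (hM hk), hx⟩
  obtain ⟨η, hη0, hη⟩ : ∃ η : ℝ, 0 < η ∧
      (2 : ℝ≥0∞) ^ (p - 1) * (ENNReal.ofReal η ^ p * volume Ω) < ε / 2 := by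
    have h1 : Tendsto (fun η : ℝ ↦ (2 : ℝ≥0∞) ^ (p - 1) * (ENNReal.ofReal η ^ p * volume Ω))
        (𝓝[>] 0) (𝓝 0) := by
      have h2 : Tendsto (fun η : ℝ ↦ ENNReal.ofReal η ^ p) (𝓝[>] 0) (𝓝 0) := by
        have := ((ENNReal.continuous_rpow_const (y := p)).comp ENNReal.continuous_ofReal).tendsto 0
        simp only [Function.comp_def, ENNReal.ofReal_zero, ENNReal.zero_rpow_of_pos hp0] at this
        exact this.mono_left nhdsWithin_le_nhds
      simpa using ENNReal.Tendsto.const_mul (a := (2 : ℝ≥0∞) ^ (p - 1))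
        (ENNReal.Tendsto.mul_const h2 (Or.inr hvol))
        (Or.inr (ENNReal.rpow_ne_top_of_nonneg (by linarith) (by simp)))
    obtain ⟨η, h1, h2⟩ := ((h1.eventually_lt_const (ENNReal.half_pos hε.ne')).and
      self_mem_nhdsWithin).exists
    exact ⟨η, h2, h1⟩
  have hn0 : ∀ k, ∃ n₀, ∀ n ≥ n₀, ∀ m ≥ n₀,
      |∫ y, u n y ∂(ballMeasure (d k) r) - ∫ y, u m y ∂(ballMeasure (d k) r)| < η := by
    intro k
    obtain ⟨a, ha⟩ := havg k j
    exact Metric.cauchySeq_iff.1 ha.cauchySeq η hη0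
  choose n₀ hn₀ using hn0
  -- Only the `M` balls of the cover matter, so the largest of their thresholds works.
  refine ⟨(Finset.range M).sup n₀, fun n hn m hm ↦ ?_⟩
  choose! κ hκM hκ using hM
  have hw : MemLp (fun x ↦ u n x - u m x) (ENNReal.ofReal p) volume := (hu n).sub (hu m)
  have h1 := lintegral_sub_average_le (f := fun x ↦ d (κ x)) hs hp hw (hu' n m) hr0 hκ hΩm
  have h2 : ∀ x ∈ Ω, ‖u n x - u m x‖ₑ ^ p ≤ (2 : ℝ≥0∞) ^ (p - 1) *
      (‖(u n x - u m x) - ∫ y, (u n y - u m y) ∂(ballMeasure (d (κ x)) r)‖ₑ ^ p +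
        ENNReal.ofReal η ^ p) := by
    intro x hx
    set a := ∫ y, (u n y - u m y) ∂(ballMeasure (d (κ x)) r) with ha
    have h3 : ‖a‖ₑ ≤ ENNReal.ofReal η := by
      rw [ha, integral_sub (integrable_ballMeasure hp (hu n) _ hr0)
        (integrable_ballMeasure hp (hu m) _ hr0), ← ofReal_norm]
      refine ENNReal.ofReal_le_ofReal (hn₀ (κ x) n ?_ m ?_).le
      · exact (Finset.le_sup (Finset.mem_range.2 (hκM x hx))).trans hn
      · exact (Finset.le_sup (Finset.mem_range.2 (hκM x hx))).trans hm
    calc ‖u n x - u m x‖ₑ ^ p ≤ (‖(u n x - u m x) - a‖ₑ + ‖a‖ₑ) ^ p := by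
          refine ENNReal.rpow_le_rpow ?_ hp0.le
          refine le_trans (le_of_eq ?_) (enorm_add_le _ _)
          rw [sub_add_cancel]
      _ ≤ 2 ^ (p - 1) * (‖(u n x - u m x) - a‖ₑ ^ p + ‖a‖ₑ ^ p) :=
          ENNReal.rpow_add_le_mul_rpow_add_rpow _ _ hp
      _ ≤ _ := by gcongr
  calc ∫⁻ x in Ω, ‖u n x - u m x‖ₑ ^ p
      ≤ ∫⁻ x in Ω, (2 : ℝ≥0∞) ^ (p - 1) *
      (‖(u n x - u m x) - ∫ y, (u n y - u m y) ∂(ballMeasure (d (κ x)) r)‖ₑ ^ p +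
        ENNReal.ofReal η ^ p) := setLIntegral_mono' hΩm h2
    _ ≤ ε / 2 + ε / 2 := by
        rw [lintegral_const_mul' _ _ (ENNReal.rpow_ne_top_of_nonneg (by linarith) (by simp)),
          lintegral_add_right _ measurable_const, mul_add, setLIntegral_const]
        refine add_le_add (le_trans ?_ hj.le) hη.le
        refine mul_le_mul_right (h1.trans ?_) _
        exact mul_le_mul_right (hb n m) _
    _ = ε := ENNReal.add_halves ε

/-- Each average is bounded uniformly in `n`, so the family of all averages is a sequence in a
countable product of compact intervals. Sequential compactness of that product replaces a diagonal
extraction. -/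
theorem exists_subseq_tendsto_averages (hp : 1 ≤ p) {u : ℕ → E N → ℝ}
    (hu : ∀ n, MemLp (u n) (ENNReal.ofReal p) volume) {A : ℝ≥0∞} (hA : A ≠ ⊤)
    (hb : ∀ n, ∫⁻ x, ‖u n x‖ₑ ^ p ≤ A) :
    ∃ ns : ℕ → ℕ, StrictMono ns ∧ ∀ k j : ℕ, ∃ a : ℝ,
      Tendsto (fun n ↦ ∫ y, u (ns n) y ∂(ballMeasure
        (TopologicalSpace.denseSeq (E N) k) (1 / (j + 1)))) atTop (𝓝 a) := by
  have hp0 : 0 < p := by linarith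
  set d := TopologicalSpace.denseSeq (E N)
  set X : ℕ → (ℕ × ℕ → ℝ) := fun n kj ↦ ∫ y, u n y ∂(ballMeasure (d kj.1) (1 / (kj.2 + 1)))
  set R : ℕ × ℕ → ℝ≥0∞ := fun kj ↦
    ((volume (Metric.ball (d kj.1) (1 / (kj.2 + 1))))⁻¹ * A) ^ (1 / p) with hR
  have hRtop : ∀ kj, R kj ≠ ⊤ := fun kj ↦ ENNReal.rpow_ne_top_of_nonneg (by positivity)
    (ENNReal.mul_ne_top (ENNReal.inv_ne_top.2
      (Metric.measure_ball_pos volume _ (by positivity)).ne') hA)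
  have hX : ∀ n, X n ∈ Set.pi univ fun kj ↦ Icc (-(R kj).toReal) (R kj).toReal := by
    intro n kj _
    have hr : (0 : ℝ) < 1 / (kj.2 + 1) := by positivity
    have := isProbabilityMeasure_ballMeasure (d kj.1) hr
    rw [mem_Icc, ← abs_le, ← Real.norm_eq_abs, ← ENNReal.ofReal_le_iff_le_toReal (hRtop kj),
      ofReal_norm]
    have h1 := enorm_integral_rpow_le hp (integrable_ballMeasure hp (hu n) (d kj.1) hr).1
    have h2 : ∫⁻ x, ‖u n x‖ₑ ^ p ∂(ballMeasure (d kj.1) (1 / (kj.2 + 1))) ≤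
        (volume (Metric.ball (d kj.1) (1 / (kj.2 + 1))))⁻¹ * A := by
      rw [ballMeasure, lintegral_smul_measure, smul_eq_mul]
      exact mul_le_mul_right ((setLIntegral_le_lintegral _ _).trans (hb n)) _
    rw [hR, ← ENNReal.rpow_le_rpow_iff hp0, ← ENNReal.rpow_mul, one_div_mul_cancel hp0.ne',
      ENNReal.rpow_one]
    exact h1.trans h2
  obtain ⟨a, -, ns, hns, ha⟩ := (isCompact_univ_pi fun kj : ℕ × ℕ ↦
    isCompact_Icc (a := -(R kj).toReal) (b := (R kj).toReal)).tendsto_subseq hX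
  exact ⟨ns, hns, fun k j ↦ ⟨a (k, j), (tendsto_pi_nhds.1 ha) (k, j)⟩⟩

theorem lintegral_rpow_le_of_eLpNorm_le {α F : Type*} [MeasurableSpace α] [NormedAddCommGroup F]
    {μ : Measure α} (hp : 0 < p) {f : α → F} {A : ℝ≥0∞} (h : eLpNorm f (ENNReal.ofReal p) μ ≤ A) :
    ∫⁻ x, ‖f x‖ₑ ^ p ∂μ ≤ A ^ p := by
  rw [eLpNorm_eq_lintegral_rpow_enorm_toReal (by simpa) (by simp), ENNReal.toReal_ofReal hp.le] at h
  refine le_trans (le_of_eq ?_) (ENNReal.rpow_le_rpow h hp.le)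
  rw [← ENNReal.rpow_mul, one_div, inv_mul_cancel₀ hp.ne', ENNReal.rpow_one]

theorem eLpNorm_le_of_lintegral_rpow_le {α F : Type*} [MeasurableSpace α] [NormedAddCommGroup F]
    {μ : Measure α} (hp : 0 < p) {f : α → F} {A : ℝ≥0∞} (h : ∫⁻ x, ‖f x‖ₑ ^ p ∂μ ≤ A ^ p) :
    eLpNorm f (ENNReal.ofReal p) μ ≤ A := by
  rw [eLpNorm_eq_lintegral_rpow_enorm_toReal (by simpa) (by simp), ENNReal.toReal_ofReal hp.le]
  refine (ENNReal.rpow_le_rpow h (by positivity)).trans (le_of_eq ?_)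
  rw [← ENNReal.rpow_mul, one_div, mul_inv_cancel₀ hp.ne', ENNReal.rpow_one]

/-- Truncation: the bounded part of a weight is absorbed by unweighted compactness, and the part
small in `L^P` by Hölder and Sobolev. This is how the unbounded weight enters the compactness
theorem. -/
theorem exists_indicator_eLpNorm_le {α : Type*} [MeasurableSpace α] {μ : Measure α} {P : ℝ≥0∞}
    {k : α → ℝ} (hk : MemLp k P μ) {δ : ℝ} (hδ : 0 < δ) :
    ∃ (k₁ k₂ : α → ℝ) (M : ℝ), 0 ≤ M ∧ MemLp k₂ P μ ∧ AEStronglyMeasurable k₁ μ ∧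
      (∀ᵐ x ∂μ, k x = k₁ x + k₂ x) ∧
      (∀ x, ‖k₁ x‖ ≤ M) ∧ eLpNorm k₂ P μ ≤ ENNReal.ofReal δ := by
  obtain ⟨k', hk'm, hk'⟩ := hk.1
  have hk'L : MemLp k' P μ := hk.ae_eq hk'
  obtain ⟨M, hM0, hM⟩ := hk'L.eLpNorm_indicator_norm_ge_pos_le hk'm hδ
  have hset : MeasurableSet {x | M ≤ ‖k' x‖₊} :=
    measurableSet_le measurable_const hk'm.measurable.norm
  refine ⟨{x | M ≤ ‖k' x‖₊}ᶜ.indicator k', {x | M ≤ ‖k' x‖₊}.indicator k', M, hM0.le,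
    hk'L.indicator hset, (hk'm.indicator hset.compl).aestronglyMeasurable, ?_, ?_, hM⟩
  · filter_upwards [hk'] with x hx
    rw [hx, Set.indicator_compl_add_self_apply]
  · intro x
    by_cases hx : x ∈ {x | M ≤ ‖k' x‖₊}
    · rw [indicator_of_notMem (by simpa using hx)]
      simpa using hM0.le
    · rw [indicator_of_mem (by exact hx)]
      have : ¬ M ≤ ‖k' x‖ := hx
      linarith

/-- Rellich–Kondrachov: a bounded sequence has a subsequence which is Cauchy in `L^p(Ω; g dx)`. -/
theorem InX.exists_subseq_cauchy {q : ℝ} (hs0 : 0 < s) (hs1 : s < 1) (hp : 1 ≤ p) (hpN : p < N)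
    (hq : N / p ≤ q) (hΩ : Bornology.IsBounded Ω) (hΩm : MeasurableSet Ω) {g : E N → ℝ}
    (hg : MemLp g (ENNReal.ofReal q) (volume.restrict Ω)) {u : ℕ → E N → ℝ} {G : ℕ → E N → E N}
    (hu : ∀ n, InX Ω (ENNReal.ofReal p) (u n) (G n)) {A : ℝ≥0}
    (hA : ∀ n, eLpNorm (G n) (ENNReal.ofReal p) volume ≤ A) :
    ∃ ns : ℕ → ℕ, StrictMono ns ∧ ∀ ε : ℝ≥0∞, 0 < ε → ∃ n₀, ∀ n ≥ n₀, ∀ m ≥ n₀,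
      eLpNorm (rootWeight p g fun x ↦ u (ns n) x - u (ns m) x) (ENNReal.ofReal p)
        (volume.restrict Ω) ≤ ε := by
  have hp0 : 0 < p := by linarith
  obtain ⟨CP, hCP⟩ := InX.exists_poincare hp hpN hΩ
  obtain ⟨CS, hCS⟩ := InX.exists_sobolev (Ω := Ω) hp hpN
  obtain ⟨CF, hCF⟩ := InX.exists_fracDiff_bound hs0 hs1 hp hpN hΩ
  have hP1 : (1 : ℝ≥0∞) ≤ ENNReal.ofReal p := by simpa
  obtain ⟨ns, hns, havg⟩ := exists_subseq_tendsto_averages (A := (CP * A : ℝ≥0∞) ^ p) hp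
    (fun n ↦ (hu n).memLp) (ENNReal.rpow_ne_top_of_nonneg hp0.le
      (ENNReal.mul_ne_top (by simp) (by simp)))
    (fun n ↦ lintegral_rpow_le_of_eLpNorm_le hp0 ((hCP _ _ (hu n)).trans
      (mul_le_mul_right (hA n) _)))
  have hsub : ∀ n m, InX Ω (ENNReal.ofReal p) (fun x ↦ u (ns n) x - u (ns m) x)
      (fun x ↦ G (ns n) x - G (ns m) x) := fun n m ↦ (hu _).sub hP1 (hu _)
  have hGsub : ∀ n m, eLpNorm (fun x ↦ G (ns n) x - G (ns m) x) (ENNReal.ofReal p) volume ≤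
      A + A := fun n m ↦ (eLpNorm_sub_le (hu _).memLp_grad.1 (hu _).memLp_grad.1 hP1).trans
    (add_le_add (hA _) (hA _))
  refine ⟨ns, hns, fun ε hε ↦ ?_⟩
  have hkL := memLp_rootWeight hp hq hΩ hg
  wlog hεtop : ε ≠ ⊤ generalizing ε
  · exact ⟨0, fun n _ m _ ↦ by simp [not_not.1 hεtop]⟩
  have hε0 : 0 < ε.toReal := ENNReal.toReal_pos hε.ne' hεtop
  have hD : (0 : ℝ) < CS * (A + A) + 1 := by positivity
  -- Gradients of differences have norm at most `2A`, so this tolerance makes the contribution of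
  -- `k₂` at most `ε / 2`; the added 1 keeps the denominator positive.
  obtain ⟨k₁, k₂, M, hM0, hk₂, hk₁m, hk, hk₁, hk₂'⟩ := exists_indicator_eLpNorm_le hkL
    (show 0 < ε.toReal / 2 / (CS * (A + A) + 1) by positivity)
  obtain ⟨n₀, hn₀⟩ := cauchy_of_tendsto_averages (Ω := Ω)
    (A := (CF * (A + A) : ℝ≥0∞) ^ p) hs0 hp hΩ hΩm (fun n ↦ (hu (ns n)).memLp)
    (fun n m ↦ (hCF _ _ (hsub n m)).1.1)
    (ENNReal.rpow_ne_top_of_nonneg hp0.le (ENNReal.mul_ne_top (by simp) (by simp)))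
    (fun n m ↦ lintegral_rpow_le_of_eLpNorm_le hp0 ((hCF _ _ (hsub n m)).2.trans
      (mul_le_mul_right (hGsub n m) _))) havg
    (ε := ENNReal.ofReal (ε.toReal / 2 / (M + 1)) ^ p) (ENNReal.rpow_pos (by
      rw [ENNReal.ofReal_pos]; positivity) (by simp))
  refine ⟨n₀, fun n hn m hm ↦ ?_⟩
  set w : E N → ℝ := fun x ↦ u (ns n) x - u (ns m) x with hw
  have hwX := hsub n m
  have e1 : eLpNorm (rootWeight p g w) (ENNReal.ofReal p) (volume.restrict Ω) =
      eLpNorm ((fun x ↦ k₁ x * w x) + fun x ↦ k₂ x * w x) (ENNReal.ofReal p)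
        (volume.restrict Ω) := by
    refine eLpNorm_congr_ae ?_
    filter_upwards [hk] with x hx
    simp only [rootWeight, Pi.add_apply]
    rw [hx, add_mul]
  have h2 := hwX.eLpNorm_mul_le hp hpN hCS hk₂
  have h3 : eLpNorm (fun x ↦ k₂ x * w x) (ENNReal.ofReal p) (volume.restrict Ω) ≤
      ENNReal.ofReal (ε.toReal / 2) := by
    refine h2.2.trans ?_
    calc _ ≤ ENNReal.ofReal (ε.toReal / 2 / (CS * (A + A) + 1)) *
          ENNReal.ofReal (CS * (A + A) + 1) := by
          refine mul_le_mul' hk₂' ?_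
          refine (mul_le_mul_right (hGsub n m) _).trans ?_
          rw [ENNReal.ofReal_add (by positivity) (by norm_num), ENNReal.ofReal_mul (by simp),
            ENNReal.ofReal_add (by simp) (by simp)]
          simp
      _ = _ := by rw [← ENNReal.ofReal_mul (by positivity), div_mul_cancel₀ _ hD.ne']
  have h4 : eLpNorm (fun x ↦ k₁ x * w x) (ENNReal.ofReal p) (volume.restrict Ω) ≤
      ENNReal.ofReal (ε.toReal / 2) := by
    calc _ ≤ ENNReal.ofReal (M + 1) * eLpNorm w (ENNReal.ofReal p) (volume.restrict Ω) := by
          refine eLpNorm_le_mul_eLpNorm_of_ae_le_mul (ae_of_all _ fun x ↦ ?_) _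
          rw [norm_mul]
          gcongr
          linarith [hk₁ x]
      _ ≤ ENNReal.ofReal (M + 1) * ENNReal.ofReal (ε.toReal / 2 / (M + 1)) :=
          mul_le_mul_right (eLpNorm_le_of_lintegral_rpow_le hp0 (hn₀ n hn m hm)) _
      _ = _ := by
          rw [← ENNReal.ofReal_mul (by positivity), mul_div_cancel₀ _ (by positivity)]
  rw [e1]
  refine (eLpNorm_add_le (hk₁m.mul (hwX.memLp.restrict Ω).1) h2.1.1 hP1).trans
    ((add_le_add h4 h3).trans ?_)
  rw [← ENNReal.ofReal_add (by positivity) (by positivity), add_halves,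
    ENNReal.ofReal_toReal hεtop]

end Compactness

end

/-! ### The energy, its minimizers and their Euler–Lagrange equation -/

section

/-- The standing assumptions on the domain, the exponents and the weights. -/
structure Admissible {N : ℕ} (Ω : Set (E N)) (s p q : ℝ) (V g : E N → ℝ) : Prop where
  s_pos : 0 < s
  s_lt_one : s < 1
  one_lt_p : 1 < p
  p_lt : p < N
  le_q : N / p ≤ q
  isOpen : IsOpen Ω
  isBounded : Bornology.IsBounded Ω
  memLp_V : MemLp V (ENNReal.ofReal q) (volume.restrict Ω)
  memLp_g : MemLp g (ENNReal.ofReal q) (volume.restrict Ω)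

/-- The energy `∫_Ω |G|^p + [u]_{s,p}^p + ∫_Ω |V| |u|^p`. -/
def energy {N : ℕ} (Ω : Set (E N)) (s p : ℝ) (V : E N → ℝ) (u : E N → ℝ) (G : E N → E N) : ℝ :=
  (∫ x in Ω, ‖G x‖ ^ p) + (∫ z, ‖fracDiff s p u z‖ ^ p) + ∫ x in Ω, ‖rootWeight p V u x‖ ^ p

/-- The weighted mass `∫_Ω |g| |u|^p`. -/
def mass {N : ℕ} (Ω : Set (E N)) (p : ℝ) (g u : E N → ℝ) : ℝ :=
  ∫ x in Ω, ‖rootWeight p g u x‖ ^ p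

/-- The pairing `∫ |a|^{p-2} a · b`, the derivative of `p⁻¹ ∫ |a|^p` in the direction `b`. -/
def pairing {α F : Type*} [MeasurableSpace α] [NormedAddCommGroup F] [InnerProductSpace ℝ F]
    (μ : Measure α) (p : ℝ) (a b : α → F) : ℝ :=
  ∫ x, ‖a x‖ ^ (p - 2) * inner ℝ (a x) (b x) ∂μ

section Energy

variable {N : ℕ} {Ω : Set (E N)} {s p q : ℝ} {V g : E N → ℝ} {u v : E N → ℝ} {G H : E N → E N}

theorem fracDiff_add_smul (u v : E N → ℝ) (t : ℝ) (z : E N × E N) :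
    fracDiff s p (fun x ↦ u x + t * v x) z = fracDiff s p u z + t • fracDiff s p v z := by
  simp only [fracDiff, smul_eq_mul]; ring

theorem rootWeight_add_smul (u v : E N → ℝ) (t : ℝ) (x : E N) :
    rootWeight p V (fun x ↦ u x + t * v x) x = rootWeight p V u x + t • rootWeight p V v x := by
  simp only [rootWeight, smul_eq_mul]; ring

theorem fracDiff_sub (u v : E N → ℝ) (z : E N × E N) :
    fracDiff s p (fun x ↦ u x - v x) z = fracDiff s p u z - fracDiff s p v z := by
  simp only [fracDiff]; ring

theorem rootWeight_sub (u v : E N → ℝ) (x : E N) :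
    rootWeight p V (fun x ↦ u x - v x) x = rootWeight p V u x - rootWeight p V v x := by
  simp only [rootWeight]; ring

theorem fracDiff_midpoint (u v : E N → ℝ) (z : E N × E N) :
    fracDiff s p (fun x ↦ 2⁻¹ * (u x + v x)) z =
      (2⁻¹ : ℝ) • (fracDiff s p u z + fracDiff s p v z) := by
  simp only [fracDiff, smul_eq_mul]; ring

theorem rootWeight_midpoint (u v : E N → ℝ) (x : E N) :
    rootWeight p V (fun x ↦ 2⁻¹ * (u x + v x)) x =
      (2⁻¹ : ℝ) • (rootWeight p V u x + rootWeight p V v x) := by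
  simp only [rootWeight, smul_eq_mul]; ring

theorem integral_norm_const_smul_rpow {α F : Type*} [MeasurableSpace α] [NormedAddCommGroup F]
    [NormedSpace ℝ F] {μ : Measure α} (c : ℝ) (f : α → F) :
    ∫ x, ‖c • f x‖ ^ p ∂μ = |c| ^ p * ∫ x, ‖f x‖ ^ p ∂μ := by
  rw [← integral_const_mul]
  refine integral_congr_ae (ae_of_all _ fun x ↦ ?_)
  simp only
  rw [norm_smul, Real.mul_rpow (norm_nonneg _) (norm_nonneg _), Real.norm_eq_abs]

theorem energy_const_mul (c : ℝ) (u : E N → ℝ) (G : E N → E N) :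
    energy Ω s p V (fun x ↦ c * u x) (fun x ↦ c • G x) = |c| ^ p * energy Ω s p V u G := by
  have h1 : ∀ z, fracDiff s p (fun x ↦ c * u x) z = c • fracDiff s p u z := fun z ↦ by
    simp only [fracDiff, smul_eq_mul]; ring
  have h2 : ∀ x, rootWeight p V (fun x ↦ c * u x) x = c • rootWeight p V u x := fun x ↦ by
    simp only [rootWeight, smul_eq_mul]; ring
  simp only [energy, h1, h2, integral_norm_const_smul_rpow]
  ring

theorem mass_const_mul (c : ℝ) (u : E N → ℝ) :
    mass Ω p g (fun x ↦ c * u x) = |c| ^ p * mass Ω p g u := by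
  have h2 : ∀ x, rootWeight p g (fun x ↦ c * u x) x = c • rootWeight p g u x := fun x ↦ by
    simp only [rootWeight, smul_eq_mul]; ring
  simp only [mass, h2, integral_norm_const_smul_rpow]

theorem energy_nonneg : 0 ≤ energy Ω s p V u G := by
  unfold energy
  have h : ∀ {α : Type} [MeasurableSpace α] {F : Type} [NormedAddCommGroup F] (μ : Measure α)
      (f : α → F), 0 ≤ ∫ x, ‖f x‖ ^ p ∂μ := fun μ f ↦ integral_nonneg fun x ↦ by positivity
  have := h (volume.restrict Ω) G
  have := h volume (fracDiff s p u)
  have := h (volume.restrict Ω) (rootWeight p V u)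
  linarith

theorem integral_grad_le_energy : ∫ x in Ω, ‖G x‖ ^ p ≤ energy Ω s p V u G := by
  unfold energy
  have h1 : 0 ≤ ∫ z, ‖fracDiff s p u z‖ ^ p := integral_nonneg fun x ↦ by positivity
  have h2 : 0 ≤ ∫ x in Ω, ‖rootWeight p V u x‖ ^ p := integral_nonneg fun x ↦ by positivity
  linarith

theorem mass_nonneg : 0 ≤ mass Ω p g u := integral_nonneg fun x ↦ by positivity

namespace Admissible

variable (h : Admissible Ω s p q V g)
include h

theorem p_pos : 0 < p := zero_lt_one.trans h.one_lt_p

theorem one_le_P : 1 ≤ ENNReal.ofReal p := by simpa using h.one_lt_p.le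

theorem memLp_fracDiff (hu : InX Ω (ENNReal.ofReal p) u G) :
    MemLp (fracDiff s p u) (ENNReal.ofReal p) volume := by
  obtain ⟨C, hC⟩ := InX.exists_fracDiff_bound h.s_pos h.s_lt_one h.one_lt_p.le h.p_lt h.isBounded
  exact (hC u G hu).1

theorem memLp_rootWeight_V (hu : InX Ω (ENNReal.ofReal p) u G) :
    MemLp (rootWeight p V u) (ENNReal.ofReal p) (volume.restrict Ω) := by
  obtain ⟨C, hC⟩ := InX.exists_rootWeight_bound h.one_lt_p.le h.p_lt h.le_q h.isBounded h.memLp_V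
  exact (hC u G hu).1

theorem memLp_rootWeight_g (hu : InX Ω (ENNReal.ofReal p) u G) :
    MemLp (rootWeight p g u) (ENNReal.ofReal p) (volume.restrict Ω) := by
  obtain ⟨C, hC⟩ := InX.exists_rootWeight_bound h.one_lt_p.le h.p_lt h.le_q h.isBounded h.memLp_g
  exact (hC u G hu).1

theorem eLpNorm_grad_restrict (hu : InX Ω (ENNReal.ofReal p) u G) :
    eLpNorm G (ENNReal.ofReal p) (volume.restrict Ω) = eLpNorm G (ENNReal.ofReal p) volume := by
  rw [← eLpNorm_indicator_eq_eLpNorm_restrict h.isOpen.measurableSet]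
  refine eLpNorm_congr_ae ?_
  filter_upwards [hu.ae_eq_zero_of_notMem h.one_le_P] with x hx
  by_cases hxΩ : x ∈ Ω
  · simp [hxΩ]
  · simp [hxΩ, (hx hxΩ).2]

theorem eLpNorm_grad_eq (hu : InX Ω (ENNReal.ofReal p) u G) :
    eLpNorm G (ENNReal.ofReal p) volume = ENNReal.ofReal ((∫ x in Ω, ‖G x‖ ^ p) ^ p⁻¹) := by
  rw [integral_norm_rpow_eq h.p_pos (hu.memLp_grad.restrict Ω).1,
    Real.rpow_rpow_inv ENNReal.toReal_nonneg h.p_pos.ne',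
    ENNReal.ofReal_toReal (hu.memLp_grad.restrict Ω).2.ne, h.eLpNorm_grad_restrict hu]

/-- As `T` respects differences and is controlled by the gradient, `L^p` convergence of the
gradients alone carries over to `T`. It is used for the Gagliardo quotient and for both weights. -/
theorem tendsto_of_bound {α : Type*} [MeasurableSpace α] {μ : Measure α} {w : ℕ → E N → ℝ}
    {K : ℕ → E N → E N} {C : ℝ≥0} {T : (E N → ℝ) → α → ℝ}
    (hC : ∀ u G, InX Ω (ENNReal.ofReal p) u G → MemLp (T u) (ENNReal.ofReal p) μ ∧
      eLpNorm (T u) (ENNReal.ofReal p) μ ≤ C * eLpNorm G (ENNReal.ofReal p) volume)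
    (hT : ∀ u v a, T (fun x ↦ u x - v x) a = T u a - T v a)
    (hw : ∀ n, InX Ω (ENNReal.ofReal p) (w n) (K n)) (hu : InX Ω (ENNReal.ofReal p) u G)
    (hK : Tendsto (fun n ↦ eLpNorm (fun x ↦ K n x - G x) (ENNReal.ofReal p) volume) atTop (𝓝 0)) :
    Tendsto (fun n ↦ ∫ x, ‖T (w n) x‖ ^ p ∂μ) atTop (𝓝 (∫ x, ‖T u x‖ ^ p ∂μ)) := by
  refine tendsto_integral_norm_rpow h.one_lt_p.le (fun n ↦ (hC _ _ (hw n)).1.1) (hC _ _ hu).1 ?_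
  refine tendsto_of_tendsto_of_tendsto_of_le_of_le tendsto_const_nhds
    (h := fun n ↦ C * eLpNorm (fun x ↦ K n x - G x) (ENNReal.ofReal p) volume)
    (by simpa using ENNReal.Tendsto.const_mul hK (Or.inr (ENNReal.coe_ne_top : (C : ℝ≥0∞) ≠ ⊤)))
    (fun _ ↦ zero_le) fun n ↦ ?_
  have := (hC _ _ ((hw n).sub h.one_le_P hu)).2
  refine le_trans (le_of_eq ?_) this
  congr 1
  ext x
  exact (hT _ _ _).symm

theorem tendsto_mass {w : ℕ → E N → ℝ} {K : ℕ → E N → E N}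
    (hw : ∀ n, InX Ω (ENNReal.ofReal p) (w n) (K n)) (hu : InX Ω (ENNReal.ofReal p) u G)
    (hK : Tendsto (fun n ↦ eLpNorm (fun x ↦ K n x - G x) (ENNReal.ofReal p) volume) atTop (𝓝 0)) :
    Tendsto (fun n ↦ mass Ω p g (w n)) atTop (𝓝 (mass Ω p g u)) := by
  obtain ⟨C, hC⟩ := InX.exists_rootWeight_bound h.one_lt_p.le h.p_lt h.le_q h.isBounded h.memLp_g
  exact h.tendsto_of_bound hC rootWeight_sub hw hu hK

theorem tendsto_energy {w : ℕ → E N → ℝ} {K : ℕ → E N → E N}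
    (hw : ∀ n, InX Ω (ENNReal.ofReal p) (w n) (K n)) (hu : InX Ω (ENNReal.ofReal p) u G)
    (hK : Tendsto (fun n ↦ eLpNorm (fun x ↦ K n x - G x) (ENNReal.ofReal p) volume) atTop (𝓝 0)) :
    Tendsto (fun n ↦ energy Ω s p V (w n) (K n)) atTop (𝓝 (energy Ω s p V u G)) := by
  obtain ⟨C, hC⟩ := InX.exists_rootWeight_bound h.one_lt_p.le h.p_lt h.le_q h.isBounded h.memLp_V
  obtain ⟨C', hC'⟩ :=
    InX.exists_fracDiff_bound h.s_pos h.s_lt_one h.one_lt_p.le h.p_lt h.isBounded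
  refine ((tendsto_integral_norm_rpow h.one_lt_p.le
    (fun n ↦ ((hw n).memLp_grad.restrict Ω).1) (hu.memLp_grad.restrict Ω) ?_).add
    (h.tendsto_of_bound hC' fracDiff_sub hw hu hK)).add
    (h.tendsto_of_bound hC rootWeight_sub hw hu hK)
  exact tendsto_of_tendsto_of_tendsto_of_le_of_le tendsto_const_nhds hK (fun _ ↦ zero_le)
    fun n ↦ eLpNorm_mono_measure _ Measure.restrict_le_self

/-- Poincaré transfers the Cauchy property from gradients to functions. The subsequence gives
summable rates `2^(-n)`, as the completeness theorem for `L^p` requires. -/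
theorem exists_subseq_inX_of_cauchy {w : ℕ → E N → ℝ} {K : ℕ → E N → E N}
    (hw : ∀ n, InX Ω (ENNReal.ofReal p) (w n) (K n))
    (hc : ∀ ε : ℝ≥0∞, 0 < ε → ∃ n₀, ∀ n ≥ n₀, ∀ m ≥ n₀,
      eLpNorm (fun x ↦ K n x - K m x) (ENNReal.ofReal p) volume ≤ ε) :
    ∃ ns : ℕ → ℕ, StrictMono ns ∧ ∃ u G, InX Ω (ENNReal.ofReal p) u G ∧
      Tendsto (fun n ↦ eLpNorm (fun x ↦ K (ns n) x - G x) (ENNReal.ofReal p) volume)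
        atTop (𝓝 0) := by
  obtain ⟨C, hC⟩ := InX.exists_poincare (N := N) h.one_lt_p.le h.p_lt h.isBounded
  set B : ℕ → ℝ≥0∞ := fun n ↦ 2⁻¹ ^ n with hB
  have hB0 : ∀ n, 0 < B n := fun n ↦ ENNReal.pow_pos (by simp) n
  have hBs : ∑' n, B n ≠ ⊤ := by simp [hB, ENNReal.tsum_geometric]
  have hev : ∀ n, ∀ᶠ k in atTop, ∀ i ≥ k, ∀ j ≥ k,
      eLpNorm (fun x ↦ K i x - K j x) (ENNReal.ofReal p) volume < B n ∧
      eLpNorm (fun x ↦ w i x - w j x) (ENNReal.ofReal p) volume < B n := by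
    intro n
    have hD : (0 : ℝ≥0∞) < B n / 2 / (C + 1) :=
      ENNReal.div_pos (ENNReal.half_pos (hB0 n).ne').ne' (by simp)
    obtain ⟨n₀, hn₀⟩ := hc _ hD
    -- Dividing by `C + 1` puts both the gradients and, after the Poincaré factor `C`, the functions
    -- below `B n`.
    have hlt : (C + 1 : ℝ≥0∞) * (B n / 2 / (C + 1)) < B n := by
      rw [ENNReal.mul_div_cancel (by simp) (by simp)]
      exact ENNReal.half_lt_self (hB0 n).ne' (ENNReal.pow_ne_top (by simp))
    refine eventually_atTop.2 ⟨n₀, fun k hk i hi j hj ↦ ?_⟩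
    have h1 := hn₀ i (hk.trans hi) j (hk.trans hj)
    refine ⟨lt_of_le_of_lt (h1.trans ?_) hlt, lt_of_le_of_lt
      ((hC _ _ ((hw i).sub h.one_le_P (hw j))).trans ?_) hlt⟩
    · exact le_mul_of_one_le_left (zero_le) (by simp)
    · exact mul_le_mul' (by simp) h1
  obtain ⟨ns, hns, hP⟩ := extraction_forall_of_eventually hev
  obtain ⟨u, hu, hut⟩ := Lp.cauchy_complete_eLpNorm h.one_le_P (fun n ↦ (hw (ns n)).memLp) hBs
    fun n i j hi hj ↦ (hP n _ (hns.monotone hi) _ (hns.monotone hj)).2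
  obtain ⟨G, hG, hGt⟩ := Lp.cauchy_complete_eLpNorm h.one_le_P
    (fun n ↦ (hw (ns n)).memLp_grad) hBs
    fun n i j hi hj ↦ (hP n _ (hns.monotone hi) _ (hns.monotone hj)).1
  exact ⟨ns, hns, u, G, InX.of_tendsto h.one_le_P (fun n ↦ hw (ns n)) hu hG hut hGt, hGt⟩

theorem inX_midpoint (hu : InX Ω (ENNReal.ofReal p) u G) (hv : InX Ω (ENNReal.ofReal p) v H) :
    InX Ω (ENNReal.ofReal p) (fun x ↦ 2⁻¹ * (u x + v x)) (fun x ↦ (2⁻¹ : ℝ) • (G x + H x)) :=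
  (hu.add h.one_le_P hv).const_mul 2⁻¹

/-- Uniform convexity of the energy with respect to the gradient. -/
theorem integral_grad_sub_le {ε C : ℝ} (hC0 : 0 ≤ C)
    (hC : ∀ a b : E N, ‖a - b‖ ^ p ≤ ε * (‖a‖ ^ p + ‖b‖ ^ p) +
      C * ((‖a‖ ^ p + ‖b‖ ^ p) / 2 - ‖(2⁻¹ : ℝ) • (a + b)‖ ^ p)) (hε : 0 ≤ ε)
    (hu : InX Ω (ENNReal.ofReal p) u G) (hv : InX Ω (ENNReal.ofReal p) v H) :
    ∫ x in Ω, ‖G x - H x‖ ^ p ≤ ε * (energy Ω s p V u G + energy Ω s p V v H) +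
      C * ((energy Ω s p V u G + energy Ω s p V v H) / 2 -
        energy Ω s p V (fun x ↦ 2⁻¹ * (u x + v x)) (fun x ↦ (2⁻¹ : ℝ) • (G x + H x))) := by
  have h1 := integral_norm_sub_rpow_le h.one_lt_p (hu.memLp_grad.restrict Ω)
    (hv.memLp_grad.restrict Ω) hC
  have h2 := integral_norm_rpow_midpoint_le h.one_lt_p.le (h.memLp_fracDiff hu)
    (h.memLp_fracDiff hv)
  have h3 := integral_norm_rpow_midpoint_le h.one_lt_p.le (h.memLp_rootWeight_V hu)
    (h.memLp_rootWeight_V hv)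
  -- The nonlocal and potential terms have nonnegative midpoint deficits, so the deficit of the
  -- gradient term is at most that of the whole energy.
  refine h1.trans (add_le_add ?_ ?_)
  · exact mul_le_mul_of_nonneg_left (add_le_add integral_grad_le_energy integral_grad_le_energy) hε
  · refine mul_le_mul_of_nonneg_left ?_ hC0
    simp only [energy, fracDiff_midpoint, rootWeight_midpoint]
    linarith

/-- The infimum of the Rayleigh quotient is attained. -/
theorem exists_minimizer {l : ℝ} (hl : 0 ≤ l)
    (hmin : ∀ u G, InX Ω (ENNReal.ofReal p) u G → l * mass Ω p g u ≤ energy Ω s p V u G)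
    (hinf : ∀ ε > 0, ∃ u G, InX Ω (ENNReal.ofReal p) u G ∧ mass Ω p g u = 1 ∧
      energy Ω s p V u G ≤ l + ε) :
    ∃ u G, InX Ω (ENNReal.ofReal p) u G ∧ mass Ω p g u = 1 ∧ energy Ω s p V u G = l := by
  have hp0 := h.p_pos
  choose! w₀ K₀ hw₀ hm₀ he₀ using fun n : ℕ ↦ hinf (1 / ((n : ℝ) + 1)) (by positivity)
  have hbd : ∀ n, eLpNorm (K₀ n) (ENNReal.ofReal p) volume ≤ ((l + 1) ^ p⁻¹).toNNReal := by
    intro n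
    rw [h.eLpNorm_grad_eq (hw₀ n)]
    refine ENNReal.ofReal_le_ofReal (Real.rpow_le_rpow (integral_nonneg fun x ↦ by positivity)
      (integral_grad_le_energy.trans ((he₀ n).trans ?_)) (by positivity))
    gcongr
    rw [div_le_one (by positivity)]
    have : (0 : ℝ) ≤ n := by positivity
    linarith
  obtain ⟨ns, hns, hcau⟩ := InX.exists_subseq_cauchy h.s_pos h.s_lt_one h.one_lt_p.le h.p_lt
    h.le_q h.isBounded h.isOpen.measurableSet h.memLp_g hw₀ hbd
  set w := fun n ↦ w₀ (ns n)
  set K := fun n ↦ K₀ (ns n)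
  have hw : ∀ n, InX Ω (ENNReal.ofReal p) (w n) (K n) := fun n ↦ hw₀ (ns n)
  have hm : ∀ n, mass Ω p g (w n) = 1 := fun n ↦ hm₀ (ns n)
  have hlow : ∀ n, l ≤ energy Ω s p V (w n) (K n) := fun n ↦ by
    simpa [hm n] using hmin _ _ (hw n)
  have het : Tendsto (fun n ↦ energy Ω s p V (w n) (K n)) atTop (𝓝 l) := by
    refine tendsto_of_tendsto_of_tendsto_of_le_of_le tendsto_const_nhds
      (h := fun n ↦ l + 1 / ((ns n : ℝ) + 1)) ?_ hlow fun n ↦ he₀ (ns n)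
    simpa using (tendsto_one_div_add_atTop_nhds_zero_nat (𝕜 := ℝ)).comp
      hns.tendsto_atTop |>.const_add l
  -- Compactness enters here: late terms are close in the weighted norm, so their midpoints almost
  -- keep the normalisation.
  have hmid : ∀ δ > 0, ∃ n₀, ∀ n ≥ n₀, ∀ m ≥ n₀,
      1 - δ ≤ mass Ω p g (fun x ↦ 2⁻¹ * (w n x + w m x)) := by
    intro δ hδ
    have hcont : Tendsto (fun η : ℝ ↦ (1 - η) ^ p) (𝓝[>] 0) (𝓝 1) := by
      have : Continuous fun η : ℝ ↦ (1 - η) ^ p :=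
        (Real.continuous_rpow_const hp0.le).comp (by fun_prop)
      have := this.tendsto 0
      simp only [sub_zero, Real.one_rpow] at this
      exact this.mono_left nhdsWithin_le_nhds
    obtain ⟨η, ⟨hη1, hη2⟩, hη0⟩ := ((hcont.eventually_const_lt (show 1 - δ < 1 by linarith)).and
      ((tendsto_id'.2 nhdsWithin_le_nhds).eventually_lt_const (zero_lt_one' ℝ))).and
      self_mem_nhdsWithin |>.exists
    simp only [id] at hη2 hη0
    obtain ⟨n₀, hn₀⟩ := hcau (ENNReal.ofReal (2 * η)) (by rw [ENNReal.ofReal_pos]; positivity)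
    refine ⟨n₀, fun n hn m hm' ↦ hη1.le.trans ?_⟩
    have hmem := h.memLp_rootWeight_g (h.inX_midpoint (hw n) (hw m))
    have hmn := h.memLp_rootWeight_g (hw n)
    have hmsub := h.memLp_rootWeight_g ((hw n).sub h.one_le_P (hw m))
    -- `w n` is the midpoint plus half of `w n - w m`; a difference of norm at most `2 η` leaves the
    -- midpoint norm at least `1 - η`.
    have e1 : eLpNorm (rootWeight p g (w n)) (ENNReal.ofReal p) (volume.restrict Ω) ≤
        eLpNorm (rootWeight p g fun x ↦ 2⁻¹ * (w n x + w m x)) (ENNReal.ofReal p)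
          (volume.restrict Ω) + ‖(2⁻¹ : ℝ)‖ₑ * eLpNorm (rootWeight p g fun x ↦ w n x - w m x)
          (ENNReal.ofReal p) (volume.restrict Ω) := by
      rw [← eLpNorm_const_smul]
      refine le_trans (le_of_eq ?_) (eLpNorm_add_le hmem.1 (hmsub.1.const_smul _) h.one_le_P)
      congr 1
      ext x
      simp only [rootWeight, Pi.add_apply, Pi.smul_apply, smul_eq_mul]
      ring
    have e2 := hn₀ n hn m hm'
    have e3 : (eLpNorm (rootWeight p g (w n)) (ENNReal.ofReal p) (volume.restrict Ω)).toReal = 1 := by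
      have := hm n
      rw [mass, integral_norm_rpow_eq hp0 hmn.1] at this
      rw [← Real.rpow_rpow_inv (ENNReal.toReal_nonneg (a := eLpNorm (rootWeight p g (w n)) _ _))
        hp0.ne', this, Real.one_rpow]
    have e4 : 1 ≤ (eLpNorm (rootWeight p g fun x ↦ 2⁻¹ * (w n x + w m x)) (ENNReal.ofReal p)
          (volume.restrict Ω)).toReal + 2⁻¹ * (2 * η) := by
      rw [← e3]
      refine (ENNReal.toReal_mono (ENNReal.add_ne_top.2 ⟨hmem.2.ne, ENNReal.mul_ne_top
        enorm_ne_top ENNReal.ofReal_ne_top⟩) (e1.trans (add_le_add_right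
        (mul_le_mul_right e2 _) _))).trans (le_of_eq ?_)
      rw [ENNReal.toReal_add hmem.2.ne (ENNReal.mul_ne_top
        enorm_ne_top ENNReal.ofReal_ne_top), ENNReal.toReal_mul, toReal_enorm,
        ENNReal.toReal_ofReal (by positivity), Real.norm_of_nonneg (by norm_num)]
    rw [mass, integral_norm_rpow_eq hp0 hmem.1]
    exact Real.rpow_le_rpow (by linarith) (by linarith) hp0.le
  -- Late energies are at most `l + δ`, while the midpoint energy is at least `l (1 - δ)`. The
  -- deficit is therefore at most `(1 + l) δ`, and uniform convexity controls the gradients.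
  have hGc : ∀ ε : ℝ≥0∞, 0 < ε → ∃ n₀, ∀ n ≥ n₀, ∀ m ≥ n₀,
      eLpNorm (fun x ↦ K n x - K m x) (ENNReal.ofReal p) volume ≤ ε := by
    intro ε hε
    wlog hεtop : ε ≠ ⊤ generalizing ε
    · exact ⟨0, fun n _ m _ ↦ by simp [not_not.1 hεtop]⟩
    have hε0 : 0 < ε.toReal := ENNReal.toReal_pos hε.ne' hεtop
    set e := ε.toReal ^ p with he
    have he0 : 0 < e := Real.rpow_pos_of_pos hε0 p
    -- The two energies add up to at most `2 (l + 1)`, so this parameter makes the first term at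
    -- most `e / 2`; `δ` is chosen to do the same for the deficit term.
    obtain ⟨C, hC0, hC⟩ := exists_norm_sub_rpow_le (F := E N) h.one_lt_p
      (show 0 < e / (4 * (l + 1)) by positivity)
    set δ := min 1 (e / (2 * (C * (1 + l) + 1))) with hδ
    have hδ0 : 0 < δ := by positivity
    have hδ1 : δ ≤ 1 := min_le_left _ _
    have hδ2 : C * ((1 + l) * δ) ≤ e / 2 := by
      have h1 : δ ≤ e / (2 * (C * (1 + l) + 1)) := min_le_right _ _
      rw [le_div_iff₀ (by positivity)] at h1
      nlinarith
    obtain ⟨n₀, hn₀⟩ := hmid δ hδ0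
    obtain ⟨n₁, hn₁⟩ := eventually_atTop.1 (het.eventually_lt_const (show l < l + δ by linarith))
    refine ⟨max n₀ n₁, fun n hn m hm' ↦ ?_⟩
    have k1 := hn₀ n (le_of_max_le_left hn) m (le_of_max_le_left hm')
    have k2 := (hn₁ n (le_of_max_le_right hn)).le
    have k3 := (hn₁ m (le_of_max_le_right hm')).le
    have k4 := hmin _ _ (h.inX_midpoint (hw n) (hw m))
    have k5 := h.integral_grad_sub_le hC0 hC (by positivity) (hw n) (hw m)
    rw [h.eLpNorm_grad_eq ((hw n).sub h.one_le_P (hw m))]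
    rw [← ENNReal.ofReal_toReal hεtop]
    refine ENNReal.ofReal_le_ofReal ?_
    rw [Real.rpow_inv_le_iff_of_pos (integral_nonneg fun x ↦ by positivity) hε0.le hp0, ← he]
    refine k5.trans ?_
    have k6 : e / (4 * (l + 1)) * (energy Ω s p V (w n) (K n) + energy Ω s p V (w m) (K m)) ≤
        e / (4 * (l + 1)) * (2 * (l + 1)) := by
      refine mul_le_mul_of_nonneg_left ?_ (by positivity)
      linarith
    have k7 : e / (4 * (l + 1)) * (2 * (l + 1)) = e / 2 := by field_simp; ring
    have k8 : C * ((energy Ω s p V (w n) (K n) + energy Ω s p V (w m) (K m)) / 2 -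
        energy Ω s p V (fun x ↦ 2⁻¹ * (w n x + w m x)) (fun x ↦ (2⁻¹ : ℝ) • (K n x + K m x))) ≤
        C * ((1 + l) * δ) := by
      refine mul_le_mul_of_nonneg_left ?_ hC0
      have := mul_le_mul_of_nonneg_left k1 hl
      linarith
    linarith
  obtain ⟨ms, hms, u, G, hu, hut⟩ := h.exists_subseq_inX_of_cauchy hw hGc
  refine ⟨u, G, hu, ?_, ?_⟩
  · refine tendsto_nhds_unique (h.tendsto_mass (fun n ↦ hw (ms n)) hu hut) ?_
    simp_rw [hm]
    exact tendsto_const_nhds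
  · exact tendsto_nhds_unique (h.tendsto_energy (fun n ↦ hw (ms n)) hu hut)
      (het.comp hms.tendsto_atTop)

/-- The Euler–Lagrange equation of a minimizer of the Rayleigh quotient. -/
theorem euler_lagrange {l : ℝ}
    (hmin : ∀ u G, InX Ω (ENNReal.ofReal p) u G → l * mass Ω p g u ≤ energy Ω s p V u G)
    (hu : InX Ω (ENNReal.ofReal p) u G) (heq : energy Ω s p V u G = l * mass Ω p g u)
    (hv : InX Ω (ENNReal.ofReal p) v H) :
    pairing (volume.restrict Ω) p G H + pairing volume p (fracDiff s p u) (fracDiff s p v) +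
      pairing (volume.restrict Ω) p (rootWeight p V u) (rootWeight p V v) -
      l * pairing (volume.restrict Ω) p (rootWeight p g u) (rootWeight p g v) = 0 := by
  have hp := h.one_lt_p
  have d1 := hasDerivAt_integral_norm_rpow hp (hu.memLp_grad.restrict Ω) (hv.memLp_grad.restrict Ω)
  have d2 := hasDerivAt_integral_norm_rpow hp (h.memLp_fracDiff hu) (h.memLp_fracDiff hv)
  have d3 := hasDerivAt_integral_norm_rpow hp (h.memLp_rootWeight_V hu) (h.memLp_rootWeight_V hv)
  have d4 := hasDerivAt_integral_norm_rpow hp (h.memLp_rootWeight_g hu) (h.memLp_rootWeight_g hv)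
  have d := ((d1.add d2).add d3).sub (d4.const_mul l)
  -- Instead of differentiating a quotient, use that `energy - l * mass` is nonnegative along the
  -- line `u + t v` and vanishes at `t = 0`.
  have hloc : IsLocalMin (fun t : ℝ ↦ (∫ x in Ω, ‖G x + t • H x‖ ^ p) +
      (∫ z, ‖fracDiff s p u z + t • fracDiff s p v z‖ ^ p) +
      (∫ x in Ω, ‖rootWeight p V u x + t • rootWeight p V v x‖ ^ p) -
      l * ∫ x in Ω, ‖rootWeight p g u x + t • rootWeight p g v x‖ ^ p) 0 := by
    refine Eventually.of_forall fun t ↦ ?_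
    have h1 := hmin _ _ (hu.add h.one_le_P (hv.const_mul t))
    simp only [energy, mass, fracDiff_add_smul, rootWeight_add_smul] at h1 heq
    simp only [zero_smul, add_zero]
    linarith
  have := hloc.hasDerivAt_eq_zero d
  simp only [pairing]
  have hp0 := h.p_pos
  refine (mul_eq_zero.1 (?_ : p * _ = 0)).resolve_left hp0.ne'
  linarith

end Admissible

end Energy

end

/-! ### Chain rules and the Picone test function -/

section

variable {N : ℕ} {Ω : Set (E N)} {P : ℝ≥0∞} {u v : E N → ℝ} {G H : E N → E N} {φ : E N → ℝ}

/-- A smooth approximation of `|t|`. -/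
def smoothAbs (δ t : ℝ) : ℝ := Real.sqrt (t ^ 2 + δ ^ 2) - δ

section SmoothAbs

variable {δ : ℝ}

theorem contDiff_smoothAbs (hδ : 0 < δ) : ContDiff ℝ ∞ (smoothAbs δ) := by
  refine ContDiff.sub (ContDiff.sqrt (by fun_prop) fun t ↦ ?_) contDiff_const
  positivity

theorem hasDerivAt_smoothAbs (hδ : 0 < δ) (t : ℝ) :
    HasDerivAt (smoothAbs δ) (t / Real.sqrt (t ^ 2 + δ ^ 2)) t := by
  have h1 : HasDerivAt (fun t : ℝ ↦ t ^ 2 + δ ^ 2) (2 * t) t := by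
    simpa using ((hasDerivAt_id t).pow 2).add_const (δ ^ 2)
  have h2 := (h1.sqrt (by positivity)).sub_const δ
  exact h2.congr_deriv (mul_div_mul_left _ _ two_ne_zero)

theorem smoothAbs_nonneg (t : ℝ) : 0 ≤ smoothAbs δ t := by
  rw [smoothAbs, sub_nonneg]
  exact Real.le_sqrt_of_sq_le (by nlinarith [sq_nonneg t])

theorem smoothAbs_zero (hδ : 0 ≤ δ) : smoothAbs δ 0 = 0 := by
  simp [smoothAbs, Real.sqrt_sq hδ]

theorem abs_div_sqrt_le_one (t : ℝ) : |t / Real.sqrt (t ^ 2 + δ ^ 2)| ≤ 1 := by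
  rw [abs_div, abs_of_nonneg (Real.sqrt_nonneg _)]
  refine div_le_one_of_le₀ (Real.abs_le_sqrt ?_) (Real.sqrt_nonneg _)
  nlinarith [sq_nonneg δ]

theorem tendsto_smoothAbs {d : ℕ → ℝ} (hd : Tendsto d atTop (𝓝 0)) (t : ℝ) :
    Tendsto (fun n ↦ smoothAbs (d n) t) atTop (𝓝 |t|) := by
  have : Continuous fun δ : ℝ ↦ smoothAbs δ t := by unfold smoothAbs; fun_prop
  simpa [smoothAbs, Real.sqrt_sq_eq_abs, Function.comp_def] using (this.tendsto 0).comp hd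

/-- The limit is the sign of `t`; at `t = 0` both sides vanish, since `0 / 0 = 0`. -/
theorem tendsto_div_sqrt {d : ℕ → ℝ} (hd : Tendsto d atTop (𝓝 0)) (t : ℝ) :
    Tendsto (fun n ↦ t / Real.sqrt (t ^ 2 + d n ^ 2)) atTop (𝓝 (t / |t|)) := by
  rcases eq_or_ne t 0 with rfl | ht
  · simp
  · have h1 : Tendsto (fun n ↦ Real.sqrt (t ^ 2 + d n ^ 2)) atTop (𝓝 |t|) := by
      have : Continuous fun δ : ℝ ↦ Real.sqrt (t ^ 2 + δ ^ 2) := by fun_prop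
      simpa [Real.sqrt_sq_eq_abs, Function.comp_def] using (this.tendsto 0).comp hd
    exact tendsto_const_nhds.div h1 (abs_ne_zero.2 ht)

end SmoothAbs

namespace InX

/-- As `f 0 = 0`, the compositions `f ∘ φ n` are test functions. They converge because `f` is
`M`-Lipschitz, and their gradients because `f' ∘ φ n` is bounded and converges a.e. -/
theorem comp_smooth (hP : 1 ≤ P) (hP' : P ≠ ⊤) (h : InX Ω P u G) {f f' : ℝ → ℝ}
    (hf : ContDiff ℝ ∞ f) (hf' : ∀ t, HasDerivAt f (f' t) t) (h0 : f 0 = 0) {M : ℝ}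
    (hM : ∀ t, |f' t| ≤ M) : InX Ω P (fun x ↦ f (u x)) (fun x ↦ f' (u x) • G x) := by
  obtain ⟨φ, h1, h2, h3, h4, -⟩ := h.exists_approx_ae hP
  have hderiv : deriv f = f' := funext fun t ↦ (hf' t).deriv
  have hf'c : Continuous f' := hderiv ▸ hf.continuous_deriv (by simp)
  have hlip : ∀ a b : ℝ, ‖f a - f b‖ ≤ M * ‖a - b‖ := fun a b ↦
    Convex.norm_image_sub_le_of_norm_hasDerivWithin_le (s := univ)
      (fun t _ ↦ (hf' t).hasDerivWithinAt) (fun t _ ↦ hM t) convex_univ (mem_univ _) (mem_univ _)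
  have key := tendsto_eLpNorm_bdd_smul_sub (c := fun n x ↦ f' (φ n x)) (c' := fun x ↦ f' (u x))
    hP hP' (fun n ↦ ((h1 n).memLp_gradient P).1) h.memLp_grad
    (fun n ↦ (hf'c.comp (h1 n).continuous).aestronglyMeasurable)
    (fun n ↦ ae_of_all _ fun x ↦ hM _)
    (h4.mono fun x hx ↦ (hf'c.tendsto _).comp hx) h3
  refine ⟨?_, key.1, fun n x ↦ f (φ n x), fun n ↦ (h1 n).comp hf h0, ?_, ?_⟩
  · refine h.memLp.of_le_mul (c := M) (hf.continuous.comp_aestronglyMeasurable h.memLp.1)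
      (ae_of_all _ fun x ↦ ?_)
    simpa [h0] using hlip (u x) 0
  · refine tendsto_of_tendsto_of_tendsto_of_le_of_le tendsto_const_nhds
      (h := fun n ↦ ENNReal.ofReal M * eLpNorm (fun x ↦ φ n x - u x) P volume)
      (by simpa using ENNReal.Tendsto.const_mul h2 (Or.inr ENNReal.ofReal_ne_top))
      (fun _ ↦ zero_le) fun n ↦ ?_
    exact eLpNorm_le_mul_eLpNorm_of_ae_le_mul (ae_of_all _ fun x ↦ hlip _ _) P
  · simp_rw [fun n ↦ gradient_comp_fun (h1 n).differentiable (hf.differentiable (by simp)), hderiv]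
    exact key.2

/-- The chain rule for `F(|u|)`. -/
theorem comp_abs (hP : 1 ≤ P) (hP' : P ≠ ⊤) (h : InX Ω P u G) {F F' : ℝ → ℝ}
    (hF : ∀ δ > 0, ContDiff ℝ ∞ fun t ↦ F (smoothAbs δ t))
    (hF' : ∀ t, 0 ≤ t → HasDerivAt F (F' t) t) (hF'c : ∀ t, 0 ≤ t → ContinuousAt F' t)
    (h0 : F 0 = 0) {M : ℝ} (hM : ∀ t, 0 ≤ t → |F' t| ≤ M) :
    InX Ω P (fun x ↦ F |u x|) (fun x ↦ (F' |u x| * (u x / |u x|)) • G x) := by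
  set d : ℕ → ℝ := fun n ↦ 1 / ((n : ℝ) + 1)
  have hd0 : ∀ n, 0 < d n := fun n ↦ by positivity
  have hd : Tendsto d atTop (𝓝 0) := tendsto_one_div_add_atTop_nhds_zero_nat
  have hder : ∀ n t, HasDerivAt (fun t ↦ F (smoothAbs (d n) t))
      (F' (smoothAbs (d n) t) * (t / Real.sqrt (t ^ 2 + d n ^ 2))) t := fun n t ↦
    (hF' _ (smoothAbs_nonneg t)).comp t (hasDerivAt_smoothAbs (hd0 n) t)
  have hbd : ∀ n t, |F' (smoothAbs (d n) t) * (t / Real.sqrt (t ^ 2 + d n ^ 2))| ≤ M := by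
    intro n t
    rw [abs_mul]
    have h1 := hM _ (smoothAbs_nonneg (δ := d n) t)
    have h2 := abs_div_sqrt_le_one (δ := d n) t
    nlinarith [abs_nonneg (F' (smoothAbs (d n) t)), abs_nonneg (t / Real.sqrt (t ^ 2 + d n ^ 2))]
  -- `smoothAbs` is smooth and nonnegative, so `F` and `F'` are evaluated only on the half-line
  -- where they are controlled; then `d n → 0` with dominated convergence.
  have hn : ∀ n, InX Ω P (fun x ↦ F (smoothAbs (d n) (u x)))
      (fun x ↦ (F' (smoothAbs (d n) (u x)) * (u x / Real.sqrt (u x ^ 2 + d n ^ 2))) • G x) :=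
    fun n ↦ h.comp_smooth hP hP' (hF _ (hd0 n)) (hder n)
      (by rw [smoothAbs_zero (hd0 n).le, h0]) (hbd n)
  have hc : ∀ n, AEStronglyMeasurable (fun x ↦
      F' (smoothAbs (d n) (u x)) * (u x / Real.sqrt (u x ^ 2 + d n ^ 2))) volume := by
    intro n
    have h1 : deriv (fun t ↦ F (smoothAbs (d n) t)) =
        fun t ↦ F' (smoothAbs (d n) t) * (t / Real.sqrt (t ^ 2 + d n ^ 2)) :=
      funext fun t ↦ (hder n t).deriv
    have h2 : Continuous fun t ↦ F' (smoothAbs (d n) t) * (t / Real.sqrt (t ^ 2 + d n ^ 2)) :=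
      h1 ▸ (hF _ (hd0 n)).continuous_deriv (by simp)
    exact h2.comp_aestronglyMeasurable h.memLp.1
  have k1 := tendsto_eLpNorm_sub_of_dominated (f := fun n x ↦ F (smoothAbs (d n) (u x)))
    (g := fun x ↦ F |u x|) (b := fun x ↦ M * ‖u x‖) hP hP' (fun n ↦ (hn n).memLp.1)
    (h.memLp.norm.const_mul M) (fun n ↦ ae_of_all _ fun x ↦ ?_) (ae_of_all _ fun x ↦ ?_)
  · have k2 := tendsto_eLpNorm_bdd_smul_sub (f := fun _ ↦ G) (g := G)
      (c' := fun x ↦ F' |u x| * (u x / |u x|)) hP hP' (fun _ ↦ h.memLp_grad.1) h.memLp_grad hc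
      (fun n ↦ ae_of_all _ fun x ↦ hbd n (u x)) (ae_of_all _ fun x ↦ ?_) (by simp)
    · exact InX.of_tendsto hP hn k1.1 k2.1 k1.2 k2.2
    · exact ((hF'c _ (abs_nonneg _)).tendsto.comp (tendsto_smoothAbs hd (u x))).mul
        (tendsto_div_sqrt hd (u x))
  · have := Convex.norm_image_sub_le_of_norm_hasDerivWithin_le (s := univ) (x := 0) (y := u x)
      (fun t _ ↦ (hder n t).hasDerivWithinAt) (fun t _ ↦ hbd n t) convex_univ (mem_univ _)
      (mem_univ _)
    simpa [smoothAbs_zero (hd0 n).le, h0] using this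
  · exact (hF' _ (abs_nonneg _)).continuousAt.tendsto.comp (tendsto_smoothAbs hd (u x))

theorem abs (hP : 1 ≤ P) (hP' : P ≠ ⊤) (h : InX Ω P u G) :
    InX Ω P (fun x ↦ |u x|) (fun x ↦ (u x / |u x|) • G x) := by
  simpa using h.comp_abs (F := fun t ↦ t) (F' := fun _ ↦ 1) (M := 1) hP hP'
    (fun δ hδ ↦ contDiff_smoothAbs hδ) (fun t _ ↦ hasDerivAt_id t)
    (fun _ _ ↦ continuousAt_const) rfl (by simp)

theorem grad_unique (hP : 1 ≤ P) (h : InX Ω P u G) (h' : InX Ω P u H) : G =ᵐ[volume] H := by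
  have := (h.hasWeakGrad hP univ).ae_eq isOpen_univ (h'.hasWeakGrad hP univ)
  exact this.mono fun x hx ↦ hx (mem_univ x)

theorem mul_test (hP : 1 ≤ P) (hP' : P ≠ ⊤) (h : InX Ω P u G) {χ : E N → ℝ}
    (hχ : IsTestFunction Ω χ) :
    InX Ω P (fun x ↦ χ x * u x) (fun x ↦ χ x • G x + u x • ∇ χ x) := by
  obtain ⟨φ, h1, h2, h3, h4, -⟩ := h.exists_approx_ae hP
  obtain ⟨M, hM⟩ := hχ.hasCompactSupport.exists_bound_of_continuous hχ.continuous
  obtain ⟨M', hM'⟩ := hχ.hasCompactSupport_gradient.exists_bound_of_continuous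
    hχ.continuous_gradient
  have hχm : AEStronglyMeasurable χ volume := hχ.continuous.aestronglyMeasurable
  have hχm' : AEStronglyMeasurable (∇ χ) volume := hχ.continuous_gradient.aestronglyMeasurable
  have k1 := tendsto_eLpNorm_bdd_smul_sub (c := fun _ ↦ χ) (c' := χ) hP hP'
    (fun n ↦ ((h1 n).memLp P).1) h.memLp (fun _ ↦ hχm) (fun n ↦ ae_of_all _ hM)
    (ae_of_all _ fun x ↦ tendsto_const_nhds) h2
  have k2 := tendsto_eLpNorm_bdd_smul_sub (c := fun _ ↦ χ) (c' := χ) hP hP'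
    (fun n ↦ ((h1 n).memLp_gradient P).1) h.memLp_grad (fun _ ↦ hχm) (fun n ↦ ae_of_all _ hM)
    (ae_of_all _ fun x ↦ tendsto_const_nhds) h3
  have k3 : MemLp (fun x ↦ u x • ∇ χ x) P volume :=
    h.memLp.of_le_mul (c := M') (h.memLp.1.smul hχm') (ae_of_all _ fun x ↦ by
      rw [norm_smul, mul_comm]; exact mul_le_mul_of_nonneg_right (hM' x) (norm_nonneg _))
  have k4 : Tendsto (fun n ↦ eLpNorm (fun x ↦ φ n x • ∇ χ x - u x • ∇ χ x) P volume)
      atTop (𝓝 0) := by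
    refine tendsto_of_tendsto_of_tendsto_of_le_of_le tendsto_const_nhds
      (h := fun n ↦ ENNReal.ofReal M' * eLpNorm (fun x ↦ φ n x - u x) P volume)
      (by simpa using ENNReal.Tendsto.const_mul h2 (Or.inr ENNReal.ofReal_ne_top))
      (fun _ ↦ zero_le) fun n ↦ ?_
    refine eLpNorm_le_mul_eLpNorm_of_ae_le_mul (ae_of_all _ fun x ↦ ?_) P
    rw [← sub_smul, norm_smul, mul_comm]
    exact mul_le_mul_of_nonneg_right (hM' x) (norm_nonneg _)
  refine ⟨k1.1, k2.1.add k3, fun n x ↦ χ x * φ n x, fun n ↦ hχ.mul (h1 n).contDiff, k1.2, ?_⟩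
  simp_rw [fun n ↦ gradient_mul_fun hχ.differentiable (h1 n).differentiable]
  exact tendsto_eLpNorm_add_sub hP (fun n ↦ hχm.smul ((h1 n).memLp_gradient P).1)
    (fun n ↦ ((h1 n).memLp P).1.smul hχm') (k2.1.1) k3.1 k2.2 k4

end InX

/-- A smooth approximation of `|t| ^ p`. -/
def smoothPow (p δ t : ℝ) : ℝ := (t ^ 2 + δ ^ 2) ^ (p / 2) - (δ ^ 2) ^ (p / 2)

section SmoothPow

variable {p δ : ℝ}

theorem contDiff_smoothPow (hδ : 0 < δ) : ContDiff ℝ ∞ (smoothPow p δ) := by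
  refine ContDiff.sub (ContDiff.rpow_const_of_ne (by fun_prop) fun t ↦ ?_) contDiff_const
  positivity

theorem hasDerivAt_smoothPow (hδ : 0 < δ) (t : ℝ) :
    HasDerivAt (smoothPow p δ) (p * ((t ^ 2 + δ ^ 2) ^ (p / 2 - 1) * t)) t := by
  have h1 : HasDerivAt (fun t : ℝ ↦ t ^ 2 + δ ^ 2) (2 * t) t := by
    simpa using ((hasDerivAt_id t).pow 2).add_const (δ ^ 2)
  have h2 := (h1.rpow_const (p := p / 2) (Or.inl (by positivity))).sub_const ((δ ^ 2) ^ (p / 2))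
  exact h2.congr_deriv (by ring)

theorem smoothPow_zero : smoothPow p δ 0 = 0 := by simp [smoothPow]

theorem abs_smoothPow_le (hp : 0 < p) (hδ : |δ| ≤ 1) {M t : ℝ} (ht : |t| ≤ M) :
    |smoothPow p δ t| ≤ (M ^ 2 + 1) ^ (p / 2) := by
  have h1 : t ^ 2 ≤ M ^ 2 := sq_le_sq' (abs_le.1 ht).1 (abs_le.1 ht).2
  have h2 : δ ^ 2 ≤ 1 := by rw [← sq_abs]; nlinarith [abs_nonneg δ]
  have h3 : (δ ^ 2) ^ (p / 2) ≤ (t ^ 2 + δ ^ 2) ^ (p / 2) :=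
    Real.rpow_le_rpow (by positivity) (by nlinarith [sq_nonneg t]) (by positivity)
  have h4 : (t ^ 2 + δ ^ 2) ^ (p / 2) ≤ (M ^ 2 + 1) ^ (p / 2) :=
    Real.rpow_le_rpow (by positivity) (by linarith) (by positivity)
  have h5 : 0 ≤ (δ ^ 2) ^ (p / 2) := by positivity
  rw [smoothPow, abs_of_nonneg (by linarith)]
  linarith

theorem abs_deriv_smoothPow_le (hp : 1 < p) (hδ0 : 0 < δ) (hδ : |δ| ≤ 1) {M t : ℝ}
    (ht : |t| ≤ M) :
    |p * ((t ^ 2 + δ ^ 2) ^ (p / 2 - 1) * t)| ≤ p * (M ^ 2 + 1) ^ ((p - 1) / 2) := by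
  have h1 : t ^ 2 ≤ M ^ 2 := sq_le_sq' (abs_le.1 ht).1 (abs_le.1 ht).2
  have h2 : δ ^ 2 ≤ 1 := by rw [← sq_abs]; nlinarith [abs_nonneg δ]
  have hpos : 0 < t ^ 2 + δ ^ 2 := by positivity
  have h3 : |t| ≤ (t ^ 2 + δ ^ 2) ^ (1 / 2 : ℝ) := by
    rw [← Real.sqrt_eq_rpow]
    exact Real.abs_le_sqrt (by nlinarith)
  rw [abs_mul, abs_mul, abs_of_pos (by linarith : 0 < p),
    abs_of_nonneg (Real.rpow_nonneg hpos.le _)]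
  gcongr
  calc (t ^ 2 + δ ^ 2) ^ (p / 2 - 1) * |t|
      ≤ (t ^ 2 + δ ^ 2) ^ (p / 2 - 1) * (t ^ 2 + δ ^ 2) ^ (1 / 2 : ℝ) := by gcongr
    _ = (t ^ 2 + δ ^ 2) ^ ((p - 1) / 2) := by rw [← Real.rpow_add hpos]; congr 1; ring
    _ ≤ (M ^ 2 + 1) ^ ((p - 1) / 2) :=
        Real.rpow_le_rpow hpos.le (by linarith) (by linarith)

theorem sq_rpow_half (t r : ℝ) : (t ^ 2) ^ (r / 2) = |t| ^ r := by
  rw [← sq_abs, ← Real.rpow_natCast, ← Real.rpow_mul (abs_nonneg t)]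
  congr 1
  push_cast
  ring

theorem tendsto_smoothPow (hp : 0 < p) {d : ℕ → ℝ} (hd : Tendsto d atTop (𝓝 0)) (t : ℝ) :
    Tendsto (fun n ↦ smoothPow p (d n) t) atTop (𝓝 (|t| ^ p)) := by
  have hr : Continuous fun r : ℝ ↦ r ^ (p / 2) := Real.continuous_rpow_const (by positivity)
  have : Continuous fun δ : ℝ ↦ smoothPow p δ t := by
    unfold smoothPow
    exact (hr.comp (by fun_prop)).sub (hr.comp (by fun_prop))
  have := (this.tendsto 0).comp hd
  simpa [smoothPow, Function.comp_def, sq_rpow_half, hp.ne'] using this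

theorem tendsto_deriv_smoothPow {d : ℕ → ℝ} (hd : Tendsto d atTop (𝓝 0)) (t : ℝ) :
    Tendsto (fun n ↦ p * ((t ^ 2 + d n ^ 2) ^ (p / 2 - 1) * t)) atTop
      (𝓝 (p * (|t| ^ (p - 2) * t))) := by
  rcases eq_or_ne t 0 with rfl | ht
  · simp
  · have h1 : Tendsto (fun n ↦ t ^ 2 + d n ^ 2) atTop (𝓝 (t ^ 2)) := by
      simpa using (hd.pow 2).const_add (t ^ 2)
    have h2 := h1.rpow_const (p := p / 2 - 1) (Or.inl (by positivity))
    rw [show p / 2 - 1 = (p - 2) / 2 by ring] at h2 ⊢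
    rw [sq_rpow_half] at h2
    exact (h2.mul_const t).const_mul p

end SmoothPow

/-- The test function `|φ|^p (v + ε)^{1 - p}` of Picone's inequality. -/
theorem InX.picone_test {p ε : ℝ} (hp : 1 < p) (hε : 0 < ε)
    (h : InX Ω (ENNReal.ofReal p) v H) (hv : ∀ᵐ x, 0 ≤ v x) (hφ : IsTestFunction Ω φ) :
    InX Ω (ENNReal.ofReal p) (fun x ↦ |φ x| ^ p * (v x + ε) ^ (1 - p))
      (fun x ↦ (|φ x| ^ p * ((1 - p) * (v x + ε) ^ (-p))) • H x +
        ((v x + ε) ^ (1 - p) * (p * (|φ x| ^ (p - 2) * φ x))) • ∇ φ x) := by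
  have hp0 : 0 < p := by linarith
  have hP1 : 1 ≤ ENNReal.ofReal p := by simpa using hp.le
  have hPt : ENNReal.ofReal p ≠ ⊤ := ENNReal.ofReal_ne_top
  set P := ENNReal.ofReal p
  -- `v = |v|` a.e., so uniqueness of the gradient removes the sign factor, also on `{v = 0}`, where
  -- that factor is zero.
  have hH : ∀ᵐ x, (v x / |v x|) • H x = H x := by
    refine ((h.abs hP1 hPt).congr_ae (u' := v) (G' := fun x ↦ (v x / |v x|) • H x) ?_
      (EventuallyEq.refl _ _)).grad_unique hP1 h
    filter_upwards [hv] with x hx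
    exact abs_of_nonneg hx
  -- Subtracting `ε^(1-p)` makes the profile vanish at 0, as the chain rule requires. The constant
  -- is added back after multiplication by a test function.
  have hF : InX Ω P (fun x ↦ (v x + ε) ^ (1 - p) - ε ^ (1 - p))
      (fun x ↦ ((1 - p) * (v x + ε) ^ (-p)) • H x) := by
    have hs : ∀ δ t, smoothAbs δ t + ε ≠ 0 := fun δ t ↦ by
      have := smoothAbs_nonneg (δ := δ) t
      linarith
    have := h.comp_abs (F := fun t ↦ (t + ε) ^ (1 - p) - ε ^ (1 - p))
      (F' := fun t ↦ (1 - p) * (t + ε) ^ (-p)) (M := (p - 1) * ε ^ (-p)) hP1 hPt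
      (fun δ hδ ↦ (((contDiff_smoothAbs hδ).add contDiff_const).rpow_const_of_ne (hs δ)).sub
        contDiff_const)
      (fun t ht ↦ by
        have h1 := (((hasDerivAt_id t).add_const ε).rpow_const (p := 1 - p)
          (Or.inl (by simp only [id]; linarith))).sub_const (ε ^ (1 - p))
        simpa using h1)
      (fun t ht ↦ ContinuousAt.mul continuousAt_const (ContinuousAt.rpow_const (by fun_prop)
        (Or.inl (by linarith))))
      (by simp)
      (fun t ht ↦ by
        rw [abs_mul, abs_of_neg (by linarith : 1 - p < 0), neg_sub,
          abs_of_nonneg (Real.rpow_nonneg (by linarith) _)]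
        exact mul_le_mul_of_nonneg_left (Real.rpow_le_rpow_of_nonpos hε (by linarith)
          (by linarith)) (by linarith))
    refine this.congr_ae ?_ ?_
    · filter_upwards [hv] with x hx
      simp only [abs_of_nonneg hx]
    · filter_upwards [hv, hH] with x hx hx'
      rw [mul_smul, hx', abs_of_nonneg hx]
  -- `|φ|^p` need not be smooth, so it is replaced by `smoothPow p (d n) ∘ φ`; `d n ≤ 1` keeps the
  -- bounds uniform in `n`.
  set d : ℕ → ℝ := fun n ↦ 1 / ((n : ℝ) + 1)
  have hd0 : ∀ n, 0 < d n := fun n ↦ by positivity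
  have hd1 : ∀ n, |d n| ≤ 1 := fun n ↦ by
    rw [abs_of_pos (hd0 n), div_le_one (by positivity)]
    have : (0 : ℝ) ≤ n := by positivity
    linarith
  have hd : Tendsto d atTop (𝓝 0) := tendsto_one_div_add_atTop_nhds_zero_nat
  obtain ⟨M, hM⟩ := hφ.hasCompactSupport.exists_bound_of_continuous hφ.continuous
  have hχ : ∀ n, IsTestFunction Ω (fun x ↦ smoothPow p (d n) (φ x)) := fun n ↦
    hφ.comp (contDiff_smoothPow (hd0 n)) smoothPow_zero
  have hgrad : ∀ n x, ∇ (fun x ↦ smoothPow p (d n) (φ x)) x =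
      (p * ((φ x ^ 2 + d n ^ 2) ^ (p / 2 - 1) * φ x)) • ∇ φ x := fun n x ↦ by
    rw [gradient_comp_fun hφ.differentiable
      ((contDiff_smoothPow (hd0 n)).differentiable (by simp)), (hasDerivAt_smoothPow (hd0 n) _).deriv]
  have hn : ∀ n, InX Ω P (fun x ↦ smoothPow p (d n) (φ x) * (v x + ε) ^ (1 - p))
      (fun x ↦ smoothPow p (d n) (φ x) • (((1 - p) * (v x + ε) ^ (-p)) • H x) +
        ((v x + ε) ^ (1 - p) * (p * ((φ x ^ 2 + d n ^ 2) ^ (p / 2 - 1) * φ x))) • ∇ φ x) := by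
    intro n
    refine ((hF.mul_test hP1 hPt (hχ n)).add hP1 ((InX.of_test (hχ n)).const_mul
      (ε ^ (1 - p)))).congr_ae (ae_of_all _ fun x ↦ ?_) (ae_of_all _ fun x ↦ ?_)
    · simp only; ring
    · simp only [hgrad]
      module
  have hvm := h.memLp.1.aemeasurable
  have hφm : Measurable φ := hφ.continuous.measurable
  have hvb : ∀ᵐ x, (v x + ε) ^ (1 - p) ≤ ε ^ (1 - p) ∧ 0 ≤ (v x + ε) ^ (1 - p) := by
    filter_upwards [hv] with x hx
    exact ⟨Real.rpow_le_rpow_of_nonpos hε (by linarith) (by linarith),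
      Real.rpow_nonneg (by linarith) _⟩
  have k1 := tendsto_eLpNorm_sub_of_dominated
    (f := fun n x ↦ smoothPow p (d n) (φ x) * (v x + ε) ^ (1 - p))
    (g := fun x ↦ |φ x| ^ p * (v x + ε) ^ (1 - p))
    (b := (tsupport φ).indicator fun _ ↦ (M ^ 2 + 1) ^ (p / 2) * ε ^ (1 - p)) hP1 hPt
    (fun n ↦ (hn n).memLp.1)
    (memLp_indicator_const P (isClosed_tsupport φ).measurableSet _
      (Or.inr hφ.hasCompactSupport.measure_lt_top.ne))
    (fun n ↦ hvb.mono fun x hx ↦ ?_)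
    (ae_of_all _ fun x ↦ (tendsto_smoothPow hp0 hd (φ x)).mul_const _)
  swap
  · by_cases hxs : x ∈ tsupport φ
    · rw [indicator_of_mem hxs, norm_mul, Real.norm_of_nonneg hx.2]
      exact mul_le_mul (abs_smoothPow_le hp0 (hd1 n) (hM x)) hx.1 hx.2 (by positivity)
    · rw [indicator_of_notMem hxs, image_eq_zero_of_notMem_tsupport hxs, smoothPow_zero]
      simp
  have k2 := tendsto_eLpNorm_bdd_smul_sub (c := fun n x ↦ smoothPow p (d n) (φ x))
    (c' := fun x ↦ |φ x| ^ p) (M := (M ^ 2 + 1) ^ (p / 2)) hP1 hPt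
    (f := fun _ x ↦ ((1 - p) * (v x + ε) ^ (-p)) • H x) (fun _ ↦ hF.memLp_grad.1) hF.memLp_grad
    (fun n ↦ (hχ n).continuous.aestronglyMeasurable)
    (fun n ↦ ae_of_all _ fun x ↦ abs_smoothPow_le hp0 (hd1 n) (hM x))
    (ae_of_all _ fun x ↦ tendsto_smoothPow hp0 hd (φ x)) (by simp)
  have hcm : ∀ n, AEStronglyMeasurable (fun x ↦ (v x + ε) ^ (1 - p) *
      (p * ((φ x ^ 2 + d n ^ 2) ^ (p / 2 - 1) * φ x))) volume := fun n ↦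
    AEMeasurable.aestronglyMeasurable (by fun_prop)
  have k3 := tendsto_eLpNorm_bdd_smul_sub
    (c := fun n x ↦ (v x + ε) ^ (1 - p) * (p * ((φ x ^ 2 + d n ^ 2) ^ (p / 2 - 1) * φ x)))
    (c' := fun x ↦ (v x + ε) ^ (1 - p) * (p * (|φ x| ^ (p - 2) * φ x)))
    (M := ε ^ (1 - p) * (p * (M ^ 2 + 1) ^ ((p - 1) / 2))) hP1 hPt
    (f := fun _ ↦ ∇ φ) (fun _ ↦ (hφ.memLp_gradient P).1) (hφ.memLp_gradient P)
    hcm (fun n ↦ hvb.mono fun x hx ↦ by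
      rw [norm_mul, Real.norm_of_nonneg hx.2]
      exact mul_le_mul hx.1 (abs_deriv_smoothPow_le hp (hd0 n) (hd1 n) (hM x)) (abs_nonneg _)
        (by positivity))
    (ae_of_all _ fun x ↦ (tendsto_deriv_smoothPow hd (φ x)).const_mul _) (by simp)
  refine (InX.of_tendsto hP1 hn k1.1 (k2.1.add k3.1) k1.2 ?_).congr_ae (EventuallyEq.refl _ _)
    (ae_of_all _ fun x ↦ by simp [mul_smul])
  refine tendsto_eLpNorm_add_sub hP1 (fun n ↦ ?_) (fun n ↦ ?_) k2.1.1 k3.1.1 k2.2 k3.2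
  · exact (hχ n).continuous.aestronglyMeasurable.smul hF.memLp_grad.1
  · exact (hcm n).smul (hφ.memLp_gradient P).1

end

/-! ### Pointwise Picone inequalities -/

section

section Picone

variable {p : ℝ}

theorem rpow_sub_two_mul_self (hp : 1 < p) {x : ℝ} (hx : 0 ≤ x) :
    x ^ (p - 2) * x = x ^ (p - 1) := by
  rcases hx.eq_or_lt with rfl | hx
  · simp [show p - 1 ≠ 0 by linarith]
  · rw [← Real.rpow_add_one hx.ne']; congr 1; ring

theorem rpow_sub_one_mul_self (hp : 1 < p) {x : ℝ} (hx : 0 ≤ x) :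
    x ^ (p - 1) * x = x ^ p := by
  rcases hx.eq_or_lt with rfl | hx
  · simp [show p ≠ 0 by linarith]
  · rw [← Real.rpow_add_one hx.ne']; congr 1; ring

theorem young_rpow (hp : 1 < p) {x y : ℝ} (hx : 0 ≤ x) (hy : 0 ≤ y) :
    p * (x ^ (p - 1) * y) ≤ (p - 1) * x ^ p + y ^ p := by
  have hp0 : 0 < p := by linarith
  have hp1 : p - 1 ≠ 0 := by linarith
  have h := Real.young_inequality_of_nonneg hy (Real.rpow_nonneg hx (p - 1))
    (Real.HolderConjugate.conjExponent hp)
  rw [Real.conjExponent, ← Real.rpow_mul hx, mul_div_cancel₀ _ hp1] at h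
  have h2 : p * (y * x ^ (p - 1)) ≤ p * (y ^ p / p + x ^ p / (p / (p - 1))) := by gcongr
  have h3 : p * (y ^ p / p + x ^ p / (p / (p - 1))) = (p - 1) * x ^ p + y ^ p := by
    field_simp; ring
  linarith [mul_comm y (x ^ (p - 1))]

/-- With `x = |c| ‖a‖ / t`, Cauchy–Schwarz bounds the left side by `-(p-1) x^p + p x^(p-1) ‖b‖`, and
Young's inequality bounds this by `‖b‖^p`. -/
theorem picone_local {F : Type*} [NormedAddCommGroup F] [InnerProductSpace ℝ F] (hp : 1 < p)
    (a b : F) (c : ℝ) {t : ℝ} (ht : 0 < t) :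
    ‖a‖ ^ (p - 2) * inner ℝ a ((|c| ^ p * ((1 - p) * t ^ (-p))) • a +
      (t ^ (1 - p) * (p * (|c| ^ (p - 2) * c))) • b) ≤ ‖b‖ ^ p := by
  have hp0 : 0 < p := by linarith
  set x := |c| * ‖a‖ * t⁻¹ with hx
  have hx0 : 0 ≤ x := by positivity
  have e1 : x ^ p = |c| ^ p * ‖a‖ ^ p * t ^ (-p) := by
    rw [hx, Real.mul_rpow (by positivity) (by positivity), Real.mul_rpow (by positivity)
      (by positivity), Real.inv_rpow ht.le, Real.rpow_neg ht.le]
  have e2 : x ^ (p - 1) = |c| ^ (p - 1) * ‖a‖ ^ (p - 1) * t ^ (1 - p) := by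
    rw [hx, Real.mul_rpow (by positivity) (by positivity), Real.mul_rpow (by positivity)
      (by positivity), Real.inv_rpow ht.le, ← Real.rpow_neg ht.le, neg_sub]
  have e3 : ‖a‖ ^ (p - 2) * inner ℝ a a = ‖a‖ ^ p := by
    rw [real_inner_self_eq_norm_sq, sq, ← mul_assoc, rpow_sub_two_mul_self hp (norm_nonneg _),
      rpow_sub_one_mul_self hp (norm_nonneg _)]
  have e4 : (|c| ^ (p - 2) * c) * (‖a‖ ^ (p - 2) * inner ℝ a b) ≤
      |c| ^ (p - 1) * (‖a‖ ^ (p - 1) * ‖b‖) := by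
    refine (le_abs_self _).trans ?_
    rw [abs_mul]
    refine mul_le_mul (le_of_eq ?_) (norm_pairing_le hp a b) (abs_nonneg _) (by positivity)
    rw [abs_mul, abs_of_nonneg (Real.rpow_nonneg (abs_nonneg _) _),
      rpow_sub_two_mul_self hp (abs_nonneg _)]
  have h1 := young_rpow hp hx0 (norm_nonneg b)
  rw [inner_add_right, inner_smul_right, inner_smul_right]
  have e5 : p * t ^ (1 - p) * ((|c| ^ (p - 2) * c) * (‖a‖ ^ (p - 2) * inner ℝ a b)) ≤
      p * t ^ (1 - p) * (|c| ^ (p - 1) * (‖a‖ ^ (p - 1) * ‖b‖)) := by gcongr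
  have e6 : p * t ^ (1 - p) * (|c| ^ (p - 1) * (‖a‖ ^ (p - 1) * ‖b‖)) =
      p * (x ^ (p - 1) * ‖b‖) := by rw [e2]; ring
  calc _ = -((p - 1) * (|c| ^ p * (‖a‖ ^ (p - 2) * inner ℝ a a) * t ^ (-p))) +
        p * t ^ (1 - p) * ((|c| ^ (p - 2) * c) * (‖a‖ ^ (p - 2) * inner ℝ a b)) := by ring
    _ ≤ -((p - 1) * x ^ p) + p * (x ^ (p - 1) * ‖b‖) := by rw [e3, ← e1, ← e6]; gcongr
    _ ≤ ‖b‖ ^ p := by linarith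

/-- Convexity of `r^p`: the number `|c - d| + d ≥ c` is the combination of `|c - d| A / (A - B)` and
`d A / B` with weights `(A - B) / A` and `B / A`. Multiply the resulting inequality by `(A -
B)^(p-1) A^(1-p)`. -/
theorem picone_discrete_aux (hp : 1 < p) {A B c d : ℝ} (hB : 0 < B) (hAB : B < A) (hc : 0 ≤ c)
    (hd : 0 ≤ d) :
    (A - B) ^ (p - 1) * (c ^ p * A ^ (1 - p) - d ^ p * B ^ (1 - p)) ≤ |c - d| ^ p := by
  have hA : 0 < A := hB.trans hAB
  have hs : 0 < A - B := sub_pos.2 hAB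
  have hx : 0 ≤ |c - d| * A / (A - B) := by positivity
  have hy : 0 ≤ d * A / B := by positivity
  have hw1 : 0 ≤ (A - B) / A := by positivity
  have hw2 : 0 ≤ B / A := by positivity
  have h1 := (convexOn_rpow hp.le).2 hx hy hw1 hw2 (by field_simp; ring)
  simp only [smul_eq_mul] at h1
  have e1 : (A - B) / A * (|c - d| * A / (A - B)) + B / A * (d * A / B) = |c - d| + d := by
    field_simp
  have h2 : c ^ p ≤ (|c - d| + d) ^ p :=
    Real.rpow_le_rpow hc (by linarith [le_abs_self (c - d)]) (by linarith)
  have key : ∀ x y : ℝ, 0 ≤ x → 0 < y → y / A * (x * A / y) ^ p = x ^ p * A ^ (p - 1) * y ^ (1 - p) := by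
    intro x y hx hy
    rw [Real.div_rpow (by positivity) hy.le, Real.mul_rpow hx hA.le, Real.rpow_sub hA,
      Real.rpow_sub hy, Real.rpow_one, Real.rpow_one]
    field_simp
  rw [e1, key _ _ (abs_nonneg _) hs, key _ _ hd hB] at h1
  have h3 := h2.trans h1
  have h4 : (A - B) ^ (p - 1) * A ^ (1 - p) * c ^ p ≤ (A - B) ^ (p - 1) * A ^ (1 - p) *
      (|c - d| ^ p * A ^ (p - 1) * (A - B) ^ (1 - p) + d ^ p * A ^ (p - 1) * B ^ (1 - p)) := by
    gcongr
  have e2 : A ^ (1 - p) * A ^ (p - 1) = 1 := by rw [← Real.rpow_add hA]; simp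
  have e3 : (A - B) ^ (p - 1) * (A - B) ^ (1 - p) = 1 := by rw [← Real.rpow_add hs]; simp
  have e4 : (A - B) ^ (p - 1) * A ^ (1 - p) *
      (|c - d| ^ p * A ^ (p - 1) * (A - B) ^ (1 - p) + d ^ p * A ^ (p - 1) * B ^ (1 - p)) =
      ((A - B) ^ (p - 1) * (A - B) ^ (1 - p)) * (A ^ (1 - p) * A ^ (p - 1)) * |c - d| ^ p +
      (A ^ (1 - p) * A ^ (p - 1)) * ((A - B) ^ (p - 1) * (d ^ p * B ^ (1 - p))) := by ring
  rw [e4, e2, e3] at h4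
  linarith

theorem picone_discrete (hp : 1 < p) {A B c d : ℝ} (hA : 0 < A) (hB : 0 < B) (hc : 0 ≤ c)
    (hd : 0 ≤ d) :
    |A - B| ^ (p - 2) * (A - B) * (c ^ p * A ^ (1 - p) - d ^ p * B ^ (1 - p)) ≤ |c - d| ^ p := by
  rcases lt_trichotomy A B with h | h | h
  · have h1 := picone_discrete_aux hp hA h hd hc
    rw [abs_sub_comm d c, ← rpow_sub_two_mul_self hp (by linarith)] at h1
    rw [abs_sub_comm A B, abs_of_pos (by linarith)]
    linarith
  · have : 0 ≤ |c - d| ^ p := by positivity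
    simpa [h] using this
  · have h1 := picone_discrete_aux hp hB h hc hd
    rw [← rpow_sub_two_mul_self hp (by linarith)] at h1
    rw [abs_of_pos (by linarith)]
    exact h1

theorem norm_mul_pairing (hp : 1 < p) {k : ℝ} (hk : 0 ≤ k) (a b : ℝ) :
    ‖k * a‖ ^ (p - 2) * inner ℝ (k * a) (k * b) = k ^ p * (|a| ^ (p - 2) * a * b) := by
  have e : inner ℝ (k * a) (k * b) = (k * a) * (k * b) := by simp [mul_comm]
  rw [e, norm_mul, Real.mul_rpow (norm_nonneg _) (norm_nonneg _), Real.norm_of_nonneg hk,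
    Real.norm_eq_abs, ← rpow_sub_one_mul_self hp hk, ← rpow_sub_two_mul_self hp hk]
  ring

theorem rpow_mul_rpow_add_le_one (hp : 1 < p) {v ε : ℝ} (hv : 0 ≤ v) (hε : 0 < ε) :
    v ^ (p - 1) * (v + ε) ^ (1 - p) ≤ 1 := by
  have h0 : 0 < v + ε := by linarith
  rw [← neg_sub p 1, Real.rpow_neg h0.le, ← div_eq_mul_inv]
  exact div_le_one_of_le₀ (Real.rpow_le_rpow hv (by linarith) (by linarith)) (by positivity)

theorem weighted_picone (hp : 1 < p) {k v ε : ℝ} (hk : 0 ≤ k) (hv : 0 ≤ v) (c : ℝ) :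
    ‖k * v‖ ^ (p - 2) * inner ℝ (k * v) (k * (|c| ^ p * (v + ε) ^ (1 - p))) =
      ‖k * c‖ ^ p * (v ^ (p - 1) * (v + ε) ^ (1 - p)) := by
  rw [norm_mul_pairing hp hk, norm_mul, Real.mul_rpow (norm_nonneg _) (norm_nonneg _),
    Real.norm_of_nonneg hk, Real.norm_eq_abs, abs_of_nonneg hv, rpow_sub_two_mul_self hp hv]
  ring

end Picone

/-! ### Nonnegative solutions: positivity and the Picone bound -/

section Eigenfunction

variable {N : ℕ} {Ω : Set (E N)} {s p q : ℝ} {V g : E N → ℝ} {u v : E N → ℝ} {G H : E N → E N}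
  {φ : E N → ℝ} {l ε : ℝ}

/-- The weak formulation in terms of pairs in `InX`. -/
def IsPairSolution (Ω : Set (E N)) (s p : ℝ) (V g : E N → ℝ) (l : ℝ) (u : E N → ℝ)
    (G : E N → E N) : Prop :=
  ∀ v H, InX Ω (ENNReal.ofReal p) v H →
    pairing (volume.restrict Ω) p G H + pairing volume p (fracDiff s p u) (fracDiff s p v) +
      pairing (volume.restrict Ω) p (rootWeight p V u) (rootWeight p V v) -
      l * pairing (volume.restrict Ω) p (rootWeight p g u) (rootWeight p g v) = 0

/-- The test function of Picone's inequality. -/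
def piconeFun (p ε : ℝ) (v φ : E N → ℝ) (x : E N) : ℝ := |φ x| ^ p * (v x + ε) ^ (1 - p)

/-- The defect in the discrete Picone inequality. -/
def piconeGap (s p ε : ℝ) (v φ : E N → ℝ) (z : E N × E N) : ℝ :=
  ‖fracDiff s p φ z‖ ^ p - ‖fracDiff s p v z‖ ^ (p - 2) *
    inner ℝ (fracDiff s p v z) (fracDiff s p (piconeFun p ε v φ) z)

theorem piconeGap_eq (hp : 1 < p) (z : E N × E N) :
    piconeGap s p ε v φ z = ‖z.1 - z.2‖ ^ (-(N + p * s)) * (|φ z.1 - φ z.2| ^ p -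
      |v z.1 - v z.2| ^ (p - 2) * (v z.1 - v z.2) *
        (piconeFun p ε v φ z.1 - piconeFun p ε v φ z.2)) := by
  have hp0 : 0 < p := by linarith
  rw [piconeGap, norm_fracDiff_rpow hp0, fracDiff, fracDiff,
    norm_mul_pairing hp (Real.rpow_nonneg (norm_nonneg _) _), ← Real.rpow_mul (norm_nonneg _),
    Real.norm_eq_abs]
  rw [show -(((N : ℝ) + p * s) / p) * p = -(N + p * s) by field_simp]
  ring

theorem piconeGap_nonneg (hp : 1 < p) (hε : 0 < ε) {z : E N × E N} (h1 : 0 ≤ v z.1)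
    (h2 : 0 ≤ v z.2) : 0 ≤ piconeGap s p ε v φ z := by
  rw [piconeGap_eq hp]
  refine mul_nonneg (Real.rpow_nonneg (norm_nonneg _) _) (sub_nonneg.2 ?_)
  have h3 := picone_discrete hp (A := v z.1 + ε) (B := v z.2 + ε) (by linarith) (by linarith)
    (abs_nonneg (φ z.1)) (abs_nonneg (φ z.2))
  rw [add_sub_add_right_eq_sub] at h3
  exact h3.trans (Real.rpow_le_rpow (abs_nonneg _) (abs_abs_sub_abs_le _ _) (by linarith))

/-- The only term unbounded as `ε → 0` carries `ε^(1-p)` and enters with a positive sign. This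
blow-up on pairs with `v z.1 = 0 < v z.2` forces positivity of `v`. -/
theorem le_piconeGap (hp : 1 < p) (hε : 0 < ε) {z : E N × E N} (h1 : v z.1 = 0) (h2 : 0 < v z.2) :
    ‖z.1 - z.2‖ ^ (-(N + p * s)) * (v z.2 ^ (p - 1) * |φ z.1| ^ p * ε ^ (1 - p) - |φ z.2| ^ p) ≤
      piconeGap s p ε v φ z := by
  rw [piconeGap_eq hp]
  refine mul_le_mul_of_nonneg_left ?_ (Real.rpow_nonneg (norm_nonneg _) _)
  simp only [piconeFun, h1, zero_sub, zero_add, abs_neg, abs_of_pos h2]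
  have e := rpow_sub_two_mul_self hp h2.le
  have h3 : |φ z.2| ^ p * (v z.2 ^ (p - 1) * (v z.2 + ε) ^ (1 - p)) ≤ |φ z.2| ^ p * 1 := by
    gcongr; exact rpow_mul_rpow_add_le_one hp h2.le hε
  have h4 : 0 ≤ |φ z.1 - φ z.2| ^ p := by positivity
  have h5 : v z.2 ^ (p - 2) * -v z.2 * (|φ z.1| ^ p * ε ^ (1 - p) -
      |φ z.2| ^ p * (v z.2 + ε) ^ (1 - p)) = -(v z.2 ^ (p - 1) * |φ z.1| ^ p * ε ^ (1 - p)) +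
      |φ z.2| ^ p * (v z.2 ^ (p - 1) * (v z.2 + ε) ^ (1 - p)) := by rw [← e]; ring
  rw [h5]
  linarith

namespace Admissible

variable (h : Admissible Ω s p q V g)
include h

theorem integrable_piconeGap (hε : 0 < ε) (hv : InX Ω (ENNReal.ofReal p) v H)
    (hv0 : ∀ᵐ x, 0 ≤ v x) (hφ : IsTestFunction Ω φ) :
    Integrable (piconeGap s p ε v φ) volume := by
  have h1 := hv.picone_test h.one_lt_p hε hv0 hφ
  exact ((h.memLp_fracDiff (InX.of_test hφ)).integrable_norm_rpow_ofReal h.p_pos).sub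
    (integrable_pairing h.one_lt_p (h.memLp_fracDiff hv) (h.memLp_fracDiff h1))

theorem pairing_rootWeight_picone {k : E N → ℝ} (hv0 : ∀ᵐ x, 0 ≤ v x) :
    pairing (volume.restrict Ω) p (rootWeight p k v) (rootWeight p k (piconeFun p ε v φ)) =
      ∫ x in Ω, ‖rootWeight p k φ x‖ ^ p * (v x ^ (p - 1) * (v x + ε) ^ (1 - p)) := by
  refine integral_congr_ae ?_
  filter_upwards [ae_restrict_of_ae hv0] with x hx
  exact weighted_picone h.one_lt_p (by positivity) hx (φ x)

/-- The integrated Picone inequality for a nonnegative solution. -/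
theorem integral_piconeGap_add_le (hε : 0 < ε) (hv : InX Ω (ENNReal.ofReal p) v H)
    (hv0 : ∀ᵐ x, 0 ≤ v x) (hsol : IsPairSolution Ω s p V g l v H) (hφ : IsTestFunction Ω φ) :
    (∫ z, piconeGap s p ε v φ z) + l * (∫ x in Ω, ‖rootWeight p g φ x‖ ^ p *
      (v x ^ (p - 1) * (v x + ε) ^ (1 - p))) ≤ energy Ω s p V φ (∇ φ) := by
  have hp := h.one_lt_p
  have hp0 := h.p_pos
  have hφX : InX Ω (ENNReal.ofReal p) φ (∇ φ) := InX.of_test hφ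
  have hψ := hv.picone_test hp hε hv0 hφ
  have heq := hsol _ _ hψ
  have e1 : (∫ z, piconeGap s p ε v φ z) = (∫ z, ‖fracDiff s p φ z‖ ^ p) -
      pairing volume p (fracDiff s p v) (fracDiff s p (piconeFun p ε v φ)) :=
    integral_sub ((h.memLp_fracDiff hφX).integrable_norm_rpow_ofReal hp0)
      (integrable_pairing hp (h.memLp_fracDiff hv) (h.memLp_fracDiff hψ))
  have e2 := h.pairing_rootWeight_picone (ε := ε) (φ := φ) (k := V) hv0
  have e3 := h.pairing_rootWeight_picone (ε := ε) (φ := φ) (k := g) hv0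
  -- The local Picone inequality bounds the gradient term. The potential term below needs only `(v /
  -- (v + ε))^(p-1) ≤ 1`, and the nonlocal term is kept exactly, as the gap.
  have i1 : pairing (volume.restrict Ω) p H (fun x ↦ (|φ x| ^ p * ((1 - p) * (v x + ε) ^ (-p))) • H x +
        ((v x + ε) ^ (1 - p) * (p * (|φ x| ^ (p - 2) * φ x))) • ∇ φ x) ≤
      ∫ x in Ω, ‖∇ φ x‖ ^ p := by
    refine integral_mono_ae (integrable_pairing hp (hv.memLp_grad.restrict Ω)
      (hψ.memLp_grad.restrict Ω)) ((hφX.memLp_grad.restrict Ω).integrable_norm_rpow_ofReal hp0) ?_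
    filter_upwards [ae_restrict_of_ae hv0] with x hx
    exact picone_local hp _ _ _ (by linarith)
  have i2 : pairing (volume.restrict Ω) p (rootWeight p V v)
      (rootWeight p V (piconeFun p ε v φ)) ≤ ∫ x in Ω, ‖rootWeight p V φ x‖ ^ p := by
    refine integral_mono_ae (integrable_pairing hp (h.memLp_rootWeight_V hv)
      (h.memLp_rootWeight_V hψ)) ((h.memLp_rootWeight_V hφX).integrable_norm_rpow_ofReal hp0) ?_
    filter_upwards [ae_restrict_of_ae hv0] with x hx
    refine (weighted_picone hp (by positivity) hx (φ x)).trans_le ?_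
    exact mul_le_of_le_one_right (by positivity) (rpow_mul_rpow_add_le_one hp hx hε)
  rw [e1, ← e3, energy]
  change _ + pairing volume p (fracDiff s p v) (fracDiff s p (piconeFun p ε v φ)) +
    pairing (volume.restrict Ω) p (rootWeight p V v) (rootWeight p V (piconeFun p ε v φ)) -
    l * pairing (volume.restrict Ω) p (rootWeight p g v) (rootWeight p g (piconeFun p ε v φ)) = 0
    at heq
  linarith

/-- A nonnegative nonzero solution is positive. -/
theorem ae_pos_of_ne_zero (hl : 0 ≤ l) (hv : InX Ω (ENNReal.ofReal p) v H)
    (hv0 : ∀ᵐ x, 0 ≤ v x) (hvne : ¬ v =ᵐ[volume] 0) (hsol : IsPairSolution Ω s p V g l v H)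
    (hφ : IsTestFunction Ω φ) : ∀ᵐ x, φ x ≠ 0 → 0 < v x := by
  have hp := h.one_lt_p
  set d : ℕ → ℝ := fun n ↦ 1 / ((n : ℝ) + 1)
  have hd0 : ∀ n, 0 < d n := fun n ↦ by positivity
  have hd : Tendsto d atTop (𝓝[>] 0) := tendsto_nhdsWithin_iff.2
    ⟨tendsto_one_div_add_atTop_nhds_zero_nat, Eventually.of_forall hd0⟩
  have hgap0 : ∀ n, ∀ᵐ z, 0 ≤ piconeGap s p (d n) v φ z := fun n ↦
    (ae_prod_of_ae hv0).mono fun z hz ↦ piconeGap_nonneg hp (hd0 n) hz.1 hz.2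
  have hint := fun n ↦ h.integrable_piconeGap (hd0 n) hv hv0 hφ
  have hb : ∀ n, ∫⁻ z, ENNReal.ofReal (piconeGap s p (d n) v φ z) ≤
      ENNReal.ofReal (energy Ω s p V φ (∇ φ)) := by
    intro n
    rw [← ofReal_integral_eq_lintegral_ofReal (hint n) (hgap0 n)]
    refine ENNReal.ofReal_le_ofReal ?_
    have h1 := h.integral_piconeGap_add_le (hd0 n) hv hv0 hsol hφ
    have h2 : 0 ≤ ∫ x in Ω, ‖rootWeight p g φ x‖ ^ p * (v x ^ (p - 1) * (v x + d n) ^ (1 - p)) := by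
      refine integral_nonneg_of_ae ?_
      filter_upwards [ae_restrict_of_ae hv0] with x hx
      have : 0 ≤ v x + d n := by linarith [hd0 n]
      simp only [Pi.zero_apply]
      positivity
    have := mul_nonneg hl h2
    linarith
  have hmeas : ∀ n, AEMeasurable (fun z ↦ ENNReal.ofReal (piconeGap s p (d n) v φ z)) volume :=
    fun n ↦ (hint n).1.aemeasurable.ennreal_ofReal
  -- The gap integrals are bounded by the energy of `φ` uniformly in `n`, so by Fatou the lower
  -- limit of the gaps is finite a.e.
  have hF : ∫⁻ z, liminf (fun n ↦ ENNReal.ofReal (piconeGap s p (d n) v φ z)) atTop < ⊤ := by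
    refine lt_of_le_of_lt (lintegral_liminf_le' hmeas) ?_
    refine lt_of_le_of_lt (liminf_le_liminf (Eventually.of_forall hb)) ?_
    simp
  have hlm : AEMeasurable (fun z ↦ liminf (fun n ↦
      ENNReal.ofReal (piconeGap s p (d n) v φ z)) atTop) volume := by
    simp_rw [liminf_eq_iSup_iInf_of_nat]
    exact AEMeasurable.iSup fun n ↦ AEMeasurable.biInf _ (to_countable _) fun i _ ↦ hmeas i
  have hlt := ae_lt_top' hlm hF.ne
  rw [Measure.volume_eq_prod] at hlt
  -- If `v x = 0` and `φ x ≠ 0`, the lower limit is infinite at every `y` with `v y > 0`. For a.e.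
  -- such `x` this leaves `v = 0` a.e., against `hvne`.
  filter_upwards [Measure.ae_ae_of_ae_prod hlt, hv0] with x hx hx0 hφx
  refine lt_of_le_of_ne hx0 fun hvx ↦ hvne ?_
  filter_upwards [hx, hv0] with y hy hy0
  by_contra hvy
  have hvy : 0 < v y := lt_of_le_of_ne hy0 (Ne.symm hvy)
  refine hy.ne ?_
  have hxy : 0 < ‖x - y‖ := by
    rw [norm_pos_iff, sub_ne_zero]
    rintro rfl
    linarith
  have hinf : Tendsto (fun n ↦ ‖x - y‖ ^ (-(N + p * s)) *
      (v y ^ (p - 1) * |φ x| ^ p * d n ^ (1 - p) - |φ y| ^ p)) atTop atTop := by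
    have h1 : Tendsto (fun n ↦ d n ^ (1 - p)) atTop atTop := by
      rw [← neg_sub p 1]
      exact (tendsto_rpow_neg_nhdsGT_zero (by linarith)).comp hd
    refine Tendsto.const_mul_atTop (by positivity) (tendsto_atTop_add_const_right _ _ ?_)
    exact Tendsto.const_mul_atTop (by positivity) h1
  have hinf' := tendsto_atTop_mono (fun n ↦ le_piconeGap (z := (x, y)) (φ := φ) (s := s) hp (hd0 n)
    hvx.symm hvy) hinf
  exact (ENNReal.tendsto_ofReal_atTop.comp hinf').liminf_eq

/-- Drop the nonnegative gap and let `ε → 0`: the factor `(v / (v + ε))^(p-1)` tends to 1 where `v >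
0`, hence a.e. where `φ ≠ 0`, and the integrand vanishes elsewhere. -/
theorem mul_mass_le_energy_of_test (hl : 0 ≤ l) (hv : InX Ω (ENNReal.ofReal p) v H)
    (hv0 : ∀ᵐ x, 0 ≤ v x) (hvne : ¬ v =ᵐ[volume] 0) (hsol : IsPairSolution Ω s p V g l v H)
    (hφ : IsTestFunction Ω φ) : l * mass Ω p g φ ≤ energy Ω s p V φ (∇ φ) := by
  have hp := h.one_lt_p
  have hpos := h.ae_pos_of_ne_zero hl hv hv0 hvne hsol hφ
  set d : ℕ → ℝ := fun n ↦ 1 / ((n : ℝ) + 1)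
  have hd0 : ∀ n, 0 < d n := fun n ↦ by positivity
  have hd : Tendsto d atTop (𝓝 0) := tendsto_one_div_add_atTop_nhds_zero_nat
  have hφm := h.memLp_rootWeight_g (InX.of_test hφ)
  have hφi := hφm.integrable_norm_rpow_ofReal h.p_pos
  have hvm := hv.memLp.1.aemeasurable.restrict (s := Ω)
  have hlim : Tendsto (fun n ↦ ∫ x in Ω, ‖rootWeight p g φ x‖ ^ p *
      (v x ^ (p - 1) * (v x + d n) ^ (1 - p))) atTop (𝓝 (mass Ω p g φ)) := by
    refine tendsto_integral_of_dominated_convergence (fun x ↦ ‖rootWeight p g φ x‖ ^ p)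
      (fun n ↦ hφi.1.mul (AEMeasurable.aestronglyMeasurable (by fun_prop))) hφi
      (fun n ↦ ?_) ?_
    · filter_upwards [ae_restrict_of_ae hv0] with x hx
      have : 0 ≤ v x + d n := by linarith [hd0 n]
      rw [Real.norm_of_nonneg (by positivity)]
      exact mul_le_of_le_one_right (by positivity) (rpow_mul_rpow_add_le_one hp hx (hd0 n))
    · filter_upwards [ae_restrict_of_ae hpos] with x hx
      by_cases hφx : φ x = 0
      · simp [rootWeight, hφx, h.p_pos.ne']
      · have hvx := hx hφx
        have h1 : Tendsto (fun n ↦ (v x + d n) ^ (1 - p)) atTop (𝓝 (v x ^ (1 - p))) := by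
          have := hd.const_add (v x)
          rw [add_zero] at this
          exact this.rpow_const (Or.inl hvx.ne')
        have h2 := (h1.const_mul (v x ^ (p - 1))).const_mul (‖rootWeight p g φ x‖ ^ p)
        rw [← Real.rpow_add hvx] at h2
        simpa using h2
  refine le_of_tendsto (hlim.const_mul l) (Eventually.of_forall fun n ↦ ?_)
  have h1 := h.integral_piconeGap_add_le (hd0 n) hv hv0 hsol hφ
  have h2 : 0 ≤ ∫ z, piconeGap s p (d n) v φ z := integral_nonneg_of_ae <|
    (ae_prod_of_ae hv0).mono fun z hz ↦ piconeGap_nonneg hp (hd0 n) hz.1 hz.2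
  linarith

/-- An eigenvalue with a nonnegative eigenfunction is a lower bound for the Rayleigh quotient. -/
theorem mul_mass_le_energy (hl : 0 ≤ l) (hv : InX Ω (ENNReal.ofReal p) v H)
    (hv0 : ∀ᵐ x, 0 ≤ v x) (hvne : ¬ v =ᵐ[volume] 0) (hsol : IsPairSolution Ω s p V g l v H)
    (hu : InX Ω (ENNReal.ofReal p) u G) : l * mass Ω p g u ≤ energy Ω s p V u G := by
  obtain ⟨φ, h1, -, h3⟩ := hu.exists_approx
  have hφ : ∀ n, InX Ω (ENNReal.ofReal p) (φ n) (∇ (φ n)) := fun n ↦ InX.of_test (h1 n)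
  exact le_of_tendsto_of_tendsto' ((h.tendsto_mass hφ hu h3).const_mul l)
    (h.tendsto_energy hφ hu h3)
    fun n ↦ h.mul_mass_le_energy_of_test hl hv hv0 hvne hsol (h1 n)

end Admissible

end Eigenfunction

end

/-! ### Translation to the original formulation and the conclusion -/

section

variable {N : ℕ} {Ω : Set (E N)} {s p q : ℝ} {V g : E N → ℝ} {u v : E N → ℝ} {G H : E N → E N}
  {l : ℝ}

theorem norm_pairing_self {F : Type*} [NormedAddCommGroup F] [InnerProductSpace ℝ F] (hp : 1 < p)
    (a : F) : ‖a‖ ^ (p - 2) * inner ℝ a a = ‖a‖ ^ p := by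
  rw [real_inner_self_eq_norm_sq, sq, ← mul_assoc, rpow_sub_two_mul_self hp (norm_nonneg _),
    rpow_sub_one_mul_self hp (norm_nonneg _)]

theorem pairing_neg_left {α F : Type*} [MeasurableSpace α] [NormedAddCommGroup F]
    [InnerProductSpace ℝ F] (μ : Measure α) (a b : α → F) :
    pairing μ p (fun x ↦ -a x) b = -pairing μ p a b := by
  simp only [pairing, norm_neg, inner_neg_left, mul_neg, integral_neg]

theorem IsPairSolution.neg (h : IsPairSolution Ω s p V g l u G) :
    IsPairSolution Ω s p V g l (fun x ↦ -u x) (fun x ↦ -G x) := by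
  intro v H hv
  have e1 : fracDiff s p (fun x ↦ -u x) = fun z ↦ -fracDiff s p u z := by
    ext z; simp only [fracDiff]; ring
  have e2 : ∀ k : E N → ℝ, rootWeight p k (fun x ↦ -u x) = fun x ↦ -rootWeight p k u x := by
    intro k; ext z; simp only [rootWeight]; ring
  have := h v H hv
  simp only [e1, e2, pairing_neg_left]
  linarith

theorem IsPairSolution.energy_eq (hp : 1 < p) (h : IsPairSolution Ω s p V g l u G)
    (hu : InX Ω (ENNReal.ofReal p) u G) : energy Ω s p V u G = l * mass Ω p g u := by
  have := h u G hu
  simp only [pairing, norm_pairing_self hp] at this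
  rw [energy, mass]
  linarith

theorem rootWeight_norm_rpow (hp : 0 < p) (k u : E N → ℝ) (x : E N) :
    ‖rootWeight p k u x‖ ^ p = |k x| * |u x| ^ p := by
  rw [rootWeight, norm_mul, Real.mul_rpow (norm_nonneg _) (norm_nonneg _),
    Real.norm_of_nonneg (by positivity), ← Real.rpow_mul (abs_nonneg _), one_div_mul_cancel hp.ne',
    Real.rpow_one, Real.norm_eq_abs]

theorem integral_rootWeight_norm_rpow (hp : 0 < p) {k : E N → ℝ}
    (hk : ∀ᵐ x ∂(volume.restrict Ω), 0 ≤ k x) (u : E N → ℝ) :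
    ∫ x in Ω, ‖rootWeight p k u x‖ ^ p = ∫ x in Ω, k x * |u x| ^ p := by
  refine integral_congr_ae (hk.mono fun x hx ↦ ?_)
  simp only [rootWeight_norm_rpow hp, abs_of_nonneg hx]

theorem pairing_rootWeight (hp : 1 < p) {k : E N → ℝ}
    (hk : ∀ᵐ x ∂(volume.restrict Ω), 0 ≤ k x) (u v : E N → ℝ) :
    pairing (volume.restrict Ω) p (rootWeight p k u) (rootWeight p k v) =
      ∫ x in Ω, k x * |u x| ^ (p - 2) * u x * v x := by
  refine integral_congr_ae (hk.mono fun x hx ↦ ?_)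
  simp only [rootWeight]
  rw [norm_mul_pairing hp (by positivity), ← Real.rpow_mul (abs_nonneg _),
    one_div_mul_cancel (by linarith), Real.rpow_one, abs_of_nonneg hx]
  ring

theorem kernel_rpow (hp : 0 < p) (z : E N × E N) :
    (‖z.1 - z.2‖ ^ (-(((N : ℝ) + p * s) / p))) ^ p = (‖z.1 - z.2‖ ^ ((N : ℝ) + p * s))⁻¹ := by
  rw [← Real.rpow_mul (norm_nonneg _), ← Real.rpow_neg (norm_nonneg _)]
  congr 1
  field_simp

theorem pairing_fracDiff (hp : 1 < p) (u v : E N → ℝ) :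
    pairing volume p (fracDiff s p u) (fracDiff s p v) =
      ∫ z : E N × E N, |u z.1 - u z.2| ^ (p - 2) * (u z.1 - u z.2) * (v z.1 - v z.2) /
        ‖z.1 - z.2‖ ^ ((N : ℝ) + p * s) := by
  refine integral_congr_ae (ae_of_all _ fun z ↦ ?_)
  simp only [fracDiff]
  rw [norm_mul_pairing hp (by positivity), kernel_rpow (by linarith), inv_mul_eq_div]

theorem integral_fracDiff_norm_rpow (hp : 0 < p) (u : E N → ℝ) :
    ∫ z, ‖fracDiff s p u z‖ ^ p =
      ∫ z : E N × E N, |u z.1 - u z.2| ^ p / ‖z.1 - z.2‖ ^ ((N : ℝ) + p * s) := by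
  refine integral_congr_ae (ae_of_all _ fun z ↦ ?_)
  simp only
  rw [norm_fracDiff_rpow hp, Real.rpow_neg (norm_nonneg _), inv_mul_eq_div, Real.norm_eq_abs]

namespace Admissible

variable (h : Admissible Ω s p q V g)
include h

theorem normPow_add_eq_energy (hV : ∀ᵐ x ∂(volume.restrict Ω), 0 ≤ V x)
    (hu : InX Ω (ENNReal.ofReal p) u G) :
    normPow Ω s p u + ∫ x in Ω, V x * |u x| ^ p = energy Ω s p V u G := by
  rw [normPow, energy, integral_fracDiff_norm_rpow h.p_pos, integral_rootWeight_norm_rpow h.p_pos hV]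
  congr 2
  exact integral_congr_ae ((hu.weakGrad_ae_eq h.one_le_P h.isOpen).mono fun x hx ↦ by
    simp only [hx])

theorem isWeakSolution_iff (hV : ∀ᵐ x ∂(volume.restrict Ω), 0 ≤ V x)
    (hg : ∀ᵐ x ∂(volume.restrict Ω), 0 ≤ g x) (hu : InX Ω (ENNReal.ofReal p) u G) :
    IsWeakSolution Ω s p V g l u ↔ IsPairSolution Ω s p V g l u G := by
  have hp := h.one_lt_p
  have hmem : ∀ {w K}, InX Ω (ENNReal.ofReal p) w K → MemX0 Ω p w :=
    fun hw ↦ hw.memX0 hp.le h.isOpen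
  have hform : ∀ {v H}, InX Ω (ENNReal.ofReal p) v H →
      mixedForm Ω s p u v + (∫ x in Ω, V x * |u x| ^ (p - 2) * u x * v x) -
        l * (∫ x in Ω, g x * |u x| ^ (p - 2) * u x * v x) =
      pairing (volume.restrict Ω) p G H + pairing volume p (fracDiff s p u) (fracDiff s p v) +
        pairing (volume.restrict Ω) p (rootWeight p V u) (rootWeight p V v) -
        l * pairing (volume.restrict Ω) p (rootWeight p g u) (rootWeight p g v) := by
    intro v H hv
    rw [pairing_rootWeight hp hV, pairing_rootWeight hp hg, pairing_fracDiff hp, mixedForm]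
    congr 3
    refine integral_congr_ae ?_
    filter_upwards [hu.weakGrad_ae_eq h.one_le_P h.isOpen,
      hv.weakGrad_ae_eq h.one_le_P h.isOpen] with x hx hx'
    rw [hx, hx']
  constructor
  · rintro ⟨-, h2⟩ v H hv
    rw [← hform hv]
    exact h2 v (hmem hv)
  · intro h2
    refine ⟨hmem hu, fun v hv ↦ ?_⟩
    have hv' := hv.inX h.isOpen
    rw [hform hv']
    exact h2 _ _ hv'

theorem mass_eq_zero (hu : u =ᵐ[volume] 0) : mass Ω p g u = 0 := by
  have : ∀ᵐ x ∂(volume.restrict Ω), ‖rootWeight p g u x‖ ^ p = 0 := by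
    filter_upwards [ae_restrict_of_ae hu] with x hx
    rw [rootWeight_norm_rpow h.p_pos, hx]
    simp [h.p_pos.ne']
  rw [mass, integral_congr_ae this]
  simp

theorem mass_pos (hg : ∀ᵐ x ∂(volume.restrict Ω), 0 < g x) (hu : InX Ω (ENNReal.ofReal p) u G)
    (hne : ¬ u =ᵐ[volume] 0) : 0 < mass Ω p g u := by
  refine lt_of_le_of_ne mass_nonneg fun h0 ↦ hne ?_
  rw [mass, eq_comm, integral_eq_zero_iff_of_nonneg (fun x ↦ by positivity)
    ((h.memLp_rootWeight_g hu).integrable_norm_rpow_ofReal h.p_pos)] at h0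
  have h1 : ∀ᵐ x ∂(volume.restrict Ω), u x = 0 := by
    filter_upwards [h0, hg] with x hx hgx
    simp only [rootWeight_norm_rpow h.p_pos, Pi.zero_apply, mul_eq_zero, abs_eq_zero] at hx
    simpa using (Real.rpow_eq_zero (abs_nonneg _) h.p_pos.ne').1 (hx.resolve_left hgx.ne')
  filter_upwards [(ae_restrict_iff' h.isOpen.measurableSet).1 h1,
    hu.ae_eq_zero_of_notMem h.one_le_P] with x hx hx'
  by_cases hxΩ : x ∈ Ω
  · exact hx hxΩ
  · exact (hx' hxΩ).1

/-- Zero energy means zero gradient, and then Poincaré gives `u = 0`. -/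
theorem energy_pos (hu : InX Ω (ENNReal.ofReal p) u G) (hne : ¬ u =ᵐ[volume] 0) :
    0 < energy Ω s p V u G := by
  refine lt_of_le_of_ne energy_nonneg fun h0 ↦ hne ?_
  obtain ⟨C, hC⟩ := InX.exists_poincare (N := N) h.one_lt_p.le h.p_lt h.isBounded
  have h1 : ∫ x in Ω, ‖G x‖ ^ p = 0 :=
    le_antisymm (integral_grad_le_energy.trans h0.symm.le) (integral_nonneg fun x ↦ by positivity)
  have h2 := hC u G hu
  rw [h.eLpNorm_grad_eq hu, h1, Real.zero_rpow (inv_ne_zero h.p_pos.ne')] at h2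
  simp only [ENNReal.ofReal_zero, mul_zero, nonpos_iff_eq_zero] at h2
  exact (eLpNorm_eq_zero_iff hu.memLp.1 (by simpa using h.p_pos)).1 h2

/-- The sign factor has modulus at most 1 in the gradient term, `||a| - |b|| ≤ |a - b|` serves the
nonlocal term, and the potential term is unchanged. -/
theorem energy_abs_le (hu : InX Ω (ENNReal.ofReal p) u G) :
    energy Ω s p V (fun x ↦ |u x|) (fun x ↦ (u x / |u x|) • G x) ≤ energy Ω s p V u G := by
  have hp0 := h.p_pos
  have ha := hu.abs h.one_le_P ENNReal.ofReal_ne_top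
  refine add_le_add (add_le_add ?_ ?_) (le_of_eq ?_)
  · refine integral_mono ((ha.memLp_grad.restrict Ω).integrable_norm_rpow_ofReal hp0)
      ((hu.memLp_grad.restrict Ω).integrable_norm_rpow_ofReal hp0) fun x ↦ ?_
    refine Real.rpow_le_rpow (norm_nonneg _) ?_ hp0.le
    rw [norm_smul]
    refine mul_le_of_le_one_left (norm_nonneg _) ?_
    rw [norm_div, norm_abs_eq_norm]
    exact div_self_le_one _
  · refine integral_mono ((h.memLp_fracDiff ha).integrable_norm_rpow_ofReal hp0)
      ((h.memLp_fracDiff hu).integrable_norm_rpow_ofReal hp0) fun z ↦ ?_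
    simp only [norm_fracDiff_rpow hp0]
    gcongr
    exact abs_abs_sub_abs_le _ _
  · simp only [rootWeight_norm_rpow hp0, abs_abs]

theorem mass_abs : mass Ω p g (fun x ↦ |u x|) = mass Ω p g u := by
  simp only [mass, rootWeight_norm_rpow h.p_pos, abs_abs]

theorem exists_inX_ne_zero (hne : Ω.Nonempty) :
    ∃ u G, InX Ω (ENNReal.ofReal p) u G ∧ ¬ u =ᵐ[volume] 0 := by
  obtain ⟨x, hx⟩ := hne
  obtain ⟨f, h1, h2, h3, -, h5⟩ := exists_contDiff_tsupport_subset (n := ⊤)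
    (h.isOpen.mem_nhds hx)
  refine ⟨f, ∇ f, InX.of_test ⟨h3, h2, h1⟩, fun h0 ↦ ?_⟩
  have h6 : f = fun _ ↦ (0 : ℝ) := (h3.continuous.ae_eq_iff_eq volume continuous_const).1 h0
  rw [h6] at h5
  exact zero_ne_one h5

theorem lambda1_eq (hV : ∀ᵐ x ∂(volume.restrict Ω), 0 ≤ V x)
    (hg : ∀ᵐ x ∂(volume.restrict Ω), 0 < g x) :
    lambda1 Ω s p V g = sInf {R : ℝ | ∃ u G, InX Ω (ENNReal.ofReal p) u G ∧
      ¬ u =ᵐ[volume] 0 ∧ R = energy Ω s p V u G / mass Ω p g u} := by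
  have hg' : ∀ᵐ x ∂(volume.restrict Ω), 0 ≤ g x := hg.mono fun x hx ↦ hx.le
  rw [lambda1]
  congr 1
  ext R
  simp only [memX0_iff h.one_lt_p.le h.isOpen, mem_ofPred_eq]
  constructor
  · rintro ⟨u, ⟨G, hu⟩, h1, h2⟩
    refine ⟨u, G, hu, h1, ?_⟩
    rw [h2, h.normPow_add_eq_energy hV hu, mass, integral_rootWeight_norm_rpow h.p_pos hg']
  · rintro ⟨u, G, hu, h1, h2⟩
    refine ⟨u, ⟨G, hu⟩, h1, ?_⟩
    rw [h2, h.normPow_add_eq_energy hV hu, mass, integral_rootWeight_norm_rpow h.p_pos hg']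

theorem lambda1_mul_mass_le (hV : ∀ᵐ x ∂(volume.restrict Ω), 0 ≤ V x)
    (hg : ∀ᵐ x ∂(volume.restrict Ω), 0 < g x) (hu : InX Ω (ENNReal.ofReal p) u G) :
    lambda1 Ω s p V g * mass Ω p g u ≤ energy Ω s p V u G := by
  by_cases hne : u =ᵐ[volume] 0
  · rw [h.mass_eq_zero hne, mul_zero]
    exact energy_nonneg
  · rw [← le_div_iff₀ (h.mass_pos hg hu hne), h.lambda1_eq hV hg]
    refine csInf_le ⟨0, ?_⟩ ⟨u, G, hu, hne, rfl⟩
    rintro R ⟨u, G, -, -, rfl⟩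
    exact div_nonneg energy_nonneg mass_nonneg

theorem exists_lambda1_minimizer (hne : Ω.Nonempty)
    (hV : ∀ᵐ x ∂(volume.restrict Ω), 0 ≤ V x) (hg : ∀ᵐ x ∂(volume.restrict Ω), 0 < g x) :
    ∃ u G, InX Ω (ENNReal.ofReal p) u G ∧ mass Ω p g u = 1 ∧
      energy Ω s p V u G = lambda1 Ω s p V g := by
  have hp0 := h.p_pos
  refine h.exists_minimizer ?_ (fun u G hu ↦ h.lambda1_mul_mass_le hV hg hu) fun ε hε ↦ ?_
  · rw [h.lambda1_eq hV hg]
    refine Real.sInf_nonneg ?_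
    rintro R ⟨u, G, -, -, rfl⟩
    exact div_nonneg energy_nonneg mass_nonneg
  · obtain ⟨u₀, G₀, hu₀, hne₀⟩ := h.exists_inX_ne_zero hne
    rw [h.lambda1_eq hV hg]
    obtain ⟨R, ⟨u, G, hu, hne, rfl⟩, hR⟩ := exists_lt_of_csInf_lt
      (s := {R : ℝ | ∃ u G, InX Ω (ENNReal.ofReal p) u G ∧
        ¬ u =ᵐ[volume] 0 ∧ R = energy Ω s p V u G / mass Ω p g u}) ⟨_, u₀, G₀, hu₀, hne₀, rfl⟩
      (lt_add_of_pos_right _ hε)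
    have hm := h.mass_pos hg hu hne
    -- Energy and mass are both homogeneous of degree `p`, so this factor normalises the mass and
    -- keeps the quotient.
    set c := mass Ω p g u ^ (-p⁻¹) with hc
    have hc0 : 0 < c := Real.rpow_pos_of_pos hm _
    have hcp : |c| ^ p = (mass Ω p g u)⁻¹ := by
      rw [abs_of_pos hc0, hc, ← Real.rpow_mul hm.le, neg_mul, inv_mul_cancel₀ hp0.ne',
        Real.rpow_neg_one]
    refine ⟨_, _, hu.const_mul c, ?_, ?_⟩
    · rw [mass_const_mul, hcp, inv_mul_cancel₀ hm.ne']
    · rw [energy_const_mul, hcp, inv_mul_eq_div]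
      exact hR.le

theorem lambda1_pos (hne : Ω.Nonempty)
    (hV : ∀ᵐ x ∂(volume.restrict Ω), 0 ≤ V x) (hg : ∀ᵐ x ∂(volume.restrict Ω), 0 < g x) :
    0 < lambda1 Ω s p V g := by
  obtain ⟨u, G, hu, hm, he⟩ := h.exists_lambda1_minimizer hne hV hg
  rw [← he]
  refine h.energy_pos hu fun h0 ↦ ?_
  rw [h.mass_eq_zero h0] at hm
  exact zero_ne_one hm

theorem isPrincipalEigenvalue_lambda1 (hne : Ω.Nonempty)
    (hV : ∀ᵐ x ∂(volume.restrict Ω), 0 ≤ V x) (hg : ∀ᵐ x ∂(volume.restrict Ω), 0 < g x) :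
    IsPrincipalEigenvalue Ω s p V g (lambda1 Ω s p V g) := by
  obtain ⟨u, G, hu, hm, he⟩ := h.exists_lambda1_minimizer hne hV hg
  have ha := hu.abs h.one_le_P ENNReal.ofReal_ne_top
  have hma : mass Ω p g (fun x ↦ |u x|) = 1 := h.mass_abs.trans hm
  have hmin := fun (w : E N → ℝ) (K : E N → E N) (hw : InX Ω (ENNReal.ofReal p) w K) ↦
    h.lambda1_mul_mass_le hV hg hw
  have hea : energy Ω s p V (fun x ↦ |u x|) (fun x ↦ (u x / |u x|) • G x) =
      lambda1 Ω s p V g * mass Ω p g (fun x ↦ |u x|) := by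
    refine le_antisymm ((h.energy_abs_le hu).trans ?_) (hmin _ _ ha)
    rw [hma, mul_one, he]
  refine ⟨fun x ↦ |u x|, ⟨?_, fun h0 ↦ ?_⟩, ae_of_all _ fun x ↦ abs_nonneg _⟩
  · rw [h.isWeakSolution_iff hV (hg.mono fun x hx ↦ hx.le) ha]
    exact fun v H hv ↦ h.euler_lagrange hmin ha hea hv
  · rw [h.mass_eq_zero h0] at hma
    exact zero_ne_one hma

theorem exists_pair_of_isEigenfunction (hV : ∀ᵐ x ∂(volume.restrict Ω), 0 ≤ V x)
    (hg : ∀ᵐ x ∂(volume.restrict Ω), 0 < g x) (hu : IsEigenfunction Ω s p V g l u) :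
    ∃ G, InX Ω (ENNReal.ofReal p) u G ∧ IsPairSolution Ω s p V g l u G := by
  have hX := hu.1.1.inX h.isOpen
  exact ⟨_, hX, (h.isWeakSolution_iff hV (hg.mono fun x hx ↦ hx.le) hX).1 hu.1⟩

/-- Testing the equation with the eigenfunction itself gives `energy = l * mass`. -/
theorem lambda1_le_of_isEigenvalue (hV : ∀ᵐ x ∂(volume.restrict Ω), 0 ≤ V x)
    (hg : ∀ᵐ x ∂(volume.restrict Ω), 0 < g x) (hl : IsEigenvalue Ω s p V g l) :
    lambda1 Ω s p V g ≤ l := by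
  obtain ⟨u, hu⟩ := hl
  obtain ⟨G, hX, hsol⟩ := h.exists_pair_of_isEigenfunction hV hg hu
  have h1 := h.lambda1_mul_mass_le hV hg hX
  rw [hsol.energy_eq h.one_lt_p hX] at h1
  exact le_of_mul_le_mul_right h1 (h.mass_pos hg hX hu.2)

/-- A nonnegative solution can only occur for `l ≤ lambda1`. -/
theorem le_lambda1_of_nonneg (hne : Ω.Nonempty) (hV : ∀ᵐ x ∂(volume.restrict Ω), 0 ≤ V x)
    (hg : ∀ᵐ x ∂(volume.restrict Ω), 0 < g x) (hl : 0 ≤ l)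
    (hv : InX Ω (ENNReal.ofReal p) v H) (hsol : IsPairSolution Ω s p V g l v H)
    (hvne : ¬ v =ᵐ[volume] 0) (hv0 : ∀ᵐ x, 0 ≤ v x) : l ≤ lambda1 Ω s p V g := by
  obtain ⟨u, G, hu, hm, he⟩ := h.exists_lambda1_minimizer hne hV hg
  have := h.mul_mass_le_energy hl hv hv0 hvne hsol hu
  rwa [hm, he, mul_one] at this

theorem measure_neg_pos (hne : Ω.Nonempty) (hV : ∀ᵐ x ∂(volume.restrict Ω), 0 ≤ V x)
    (hg : ∀ᵐ x ∂(volume.restrict Ω), 0 < g x) (hl : lambda1 Ω s p V g < l)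
    (hv : InX Ω (ENNReal.ofReal p) v H) (hsol : IsPairSolution Ω s p V g l v H)
    (hvne : ¬ v =ᵐ[volume] 0) : 0 < volume {x | x ∈ Ω ∧ v x < 0} := by
  refine pos_iff_ne_zero.2 fun h0 ↦ hl.not_ge ?_
  refine h.le_lambda1_of_nonneg hne hV hg ((h.lambda1_pos hne hV hg).le.trans hl.le) hv hsol hvne ?_
  filter_upwards [measure_eq_zero_iff_ae_notMem.1 h0, hv.ae_eq_zero_of_notMem h.one_le_P]
    with x hx hx'
  by_cases hxΩ : x ∈ Ω
  · exact not_lt.1 fun hlt ↦ hx ⟨hxΩ, hlt⟩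
  · exact (hx' hxΩ).1.ge

theorem changesSign (hne : Ω.Nonempty) (hV : ∀ᵐ x ∂(volume.restrict Ω), 0 ≤ V x)
    (hg : ∀ᵐ x ∂(volume.restrict Ω), 0 < g x) (hl : lambda1 Ω s p V g < l)
    (hv : IsEigenfunction Ω s p V g l v) : ChangesSign Ω v := by
  obtain ⟨H, hX, hsol⟩ := h.exists_pair_of_isEigenfunction hV hg hv
  refine ⟨?_, h.measure_neg_pos hne hV hg hl hX hsol hv.2⟩
  -- The equation is odd, so `-v` is also a solution and its negative part gives the positive part
  -- of `v`.
  have hX' : InX Ω (ENNReal.ofReal p) (fun x ↦ -v x) (fun x ↦ -H x) := by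
    simpa using hX.const_mul (-1)
  have := h.measure_neg_pos hne hV hg hl hX' hsol.neg fun h0 ↦ hv.2 (by
    filter_upwards [h0] with x hx
    simpa using hx)
  simpa using this

end Admissible

end

end

end MixedEigenvalue

theorem mainTheorem7 (N : ℕ) (hN : 2 ≤ N) (s p q : ℝ) (hs0 : 0 < s) (hs1 : s < 1) (hp : 1 < p)
    (hpN : p < N) (hq : (N : ℝ) / (s * p) < q)
    (Ω : Set (MixedEigenvalue.E N)) (hΩ_open : IsOpen Ω) (hΩ_bdd : Bornology.IsBounded Ω)
    (hΩ_ne : Ω.Nonempty) (hΩ_lip : MixedEigenvalue.HasLipschitzBoundary Ω)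
    (V g : MixedEigenvalue.E N → ℝ)
    (hV : MemLp V (ENNReal.ofReal q) (volume.restrict Ω))
    (hg : MemLp g (ENNReal.ofReal q) (volume.restrict Ω))
    (hV_nonneg : ∀ᵐ x ∂(volume.restrict Ω), 0 ≤ V x)
    (hg_pos : ∀ᵐ x ∂(volume.restrict Ω), 0 < g x) :
    IsLeast {l : ℝ | 0 < l ∧ MixedEigenvalue.IsEigenvalue Ω s p V g l}
        (MixedEigenvalue.lambda1 Ω s p V g) ∧
      (∀ (l : ℝ) (v : MixedEigenvalue.E N → ℝ), MixedEigenvalue.lambda1 Ω s p V g < l →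
        MixedEigenvalue.IsEigenfunction Ω s p V g l v → MixedEigenvalue.ChangesSign Ω v) ∧
      (∀ l : ℝ, MixedEigenvalue.IsPrincipalEigenvalue Ω s p V g l ↔
        l = MixedEigenvalue.lambda1 Ω s p V g) := by
  -- Since `s < 1`, the bound `N / (s p)` dominates the exponent `N / p` required by the weighted
  -- estimates.
  have hle : (N : ℝ) / p ≤ q := by
    refine le_trans ?_ hq.le
    exact div_le_div_of_nonneg_left (by positivity) (by positivity) (by nlinarith)
  have h : MixedEigenvalue.Admissible Ω s p q V g :=
    ⟨hs0, hs1, hp, hpN, hle, hΩ_open, hΩ_bdd, hV, hg⟩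
  have hpos := h.lambda1_pos hΩ_ne hV_nonneg hg_pos
  have hprinc := h.isPrincipalEigenvalue_lambda1 hΩ_ne hV_nonneg hg_pos
  have hlow : ∀ l, MixedEigenvalue.IsEigenvalue Ω s p V g l →
      MixedEigenvalue.lambda1 Ω s p V g ≤ l := fun l hl ↦
    h.lambda1_le_of_isEigenvalue hV_nonneg hg_pos hl
  refine ⟨⟨⟨hpos, hprinc.imp fun u hu ↦ hu.1⟩, fun l hl ↦ hlow l hl.2⟩,
    fun l v hl hv ↦ h.changesSign hΩ_ne hV_nonneg hg_pos hl hv, fun l ↦ ⟨?_, ?_⟩⟩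
  · rintro ⟨u, hu, hu0⟩
    have hll := hlow l ⟨u, hu⟩
    obtain ⟨G, hX, hsol⟩ := h.exists_pair_of_isEigenfunction hV_nonneg hg_pos hu
    exact le_antisymm (h.le_lambda1_of_nonneg hΩ_ne hV_nonneg hg_pos (hpos.le.trans hll) hX hsol
      hu.2 hu0) hll
  · rintro rfl
    exact hprinc
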